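/- **Definitions.** A *tt-category* is an essentially small, idempotent-complete triangulated category $\mathcal K$ with a symmetric monoidal structure $(\otimes,\mathbb 1)$ such that every functor $x\otimes-$ is exact, the isomorphisms $x\otimes\Sigma z\cong\Sigma(x\otimes z)$ being natural in $x$ and $z$ and compatible with the unit and associativity constraints. A *tt-functor* is an exact, symmetric (strong) monoidal functor whose exact and monoidal structures are compatible with these isomorphisms. The spectrum $\mathrm{Spc}(\mathcal K)$ is the set of prime thick $\otimes$-ideals $\mathcal P\subsetneq\mathcal K$ (thick: triangulated and closed under direct summands; prime: $x\otimes y\in\mathcal P$ implies $x\in\mathcal P$ or $y\in\mathcal P$), with open basis the sets $\{\mathcal P\mid x\in\mathcal P\}$ for $x\in\mathcal K$. A tt-functor $G$ induces the continuous map $\mathrm{Spc}(G)\colon\mathcal P\mapsto G^{-1}(\mathcal P)$. A *tt-ring* in $\mathcal K$ is a commutative monoid $(A,\mu,\eta)$ which is separable: $\mu$ has a section $\sigma\colon A\to A\otimes A$ with $(1\otimes\mu)(\sigma\otimes1)=\sigma\mu=(\mu\otimes1)(1\otimes\sigma)$. Then $A\text{-}\mathrm{Mod}_{\mathcal K}$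 denotes the category of left $A$-modules in $\mathcal K$, where a triangle is distinguished if its underlying triangle in $\mathcal K$ is, and where the tensor product $\otimes_A$ is the (split) coequalizer of $x\otimes A\otimes y\rightrightarrows x\otimes y$. Let $F_A\colon\mathcal K\to A\text{-}\mathrm{Mod}_{\mathcal K}$, $y\mapsto A\otimes y$, be extension of scalars and $\varphi_A=\mathrm{Spc}(F_A)$. *Degree.* If $R\to A$ is a homomorphism of tt-rings, there is an essentially unique decomposition $A\otimes_RA\cong A\times C$ of rings with first component the multiplication; let $g\colon A\otimes A\to C$ be the second component, and view $C$ as an $A$-algebra through $g\circ(1\otimes\eta)$. Starting from $A^{[0]}=\mathbb 1\to A^{[1]}=A$ and letting $A^{[n+1]}$ be the $C$ obtained from $A^{[n-1]}\to A^{[n]}$, one gets the splitting tower of $A$; the tt-ring $A$ has *finite degree* if $A^{[d+1]}=0$ for some $d\ge0$. **Statement.** Let $\mathcal K,\mathcal L$ be tt-categories, $A$ a tt-ring of finite degree in $\mathcal K$, $F\colon\mathcal K\to\mathcal L$ a tt-functor and $B=F(A)$, which is a tt-ring in $\mathcal L$. Let $\varphi=\mathrm{Spc}(F)$, and let $\bar\varphi=\mathrm{Spc}(\bar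 F)\colon\mathrm{Spc}(B\text{-}\mathrm{Mod}_{\mathcal L})\to\mathrm{Spc}(A\text{-}\mathrm{Mod}_{\mathcal K})$ be induced by the functor $\bar F\colon(x,\rho)\mapsto(F(x),F(\rho))$. Then the square $$\begin{array}{ccc}\mathrm{Spc}(\mathcal K)&\xleftarrow{\ \varphi\ }&\mathrm{Spc}(\mathcal L)\\[2pt]{\scriptstyle\varphi_A}\uparrow&&\uparrow{\scriptstyle\varphi_B}\\[2pt]\mathrm{Spc}(A\text{-}\mathrm{Mod}_{\mathcal K})&\xleftarrow{\ \bar\varphi\ }&\mathrm{Spc}(B\text{-}\mathrm{Mod}_{\mathcal L})\end{array}$$ commutes and is weakly cartesian: for all $\mathcal P\in\mathrm{Spc}(A\text{-}\mathrm{Mod}_{\mathcal K})$ and $\mathcal Q\in\mathrm{Spc}(\mathcal L)$ with $\varphi_A(\mathcal P)=\varphi(\mathcal Q)$ there exists $\mathcal Q'\in\mathrm{Spc}(B\text{-}\mathrm{Mod}_{\mathcal L})$ with $\bar\varphi(\mathcal Q')=\mathcal P$ and $\varphi_B(\mathcal Q')=\mathcal Q$. -/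

import Mathlib

open CategoryTheory Category Limits MonoidalCategory Pretriangulated MonObj
open scoped Obj

universe v u v' u'

noncomputable section

namespace TTGeom

section Spectrum

variable {C : Type u} [Category.{v} C] [HasShift C ℤ]

/-- Thick tensor-ideals of a category with shift, for a class `𝒯` of distinguished triangles and a
tensor product `t` on objects: triangulated subcategories which are closed under direct summands
and under tensoring with any object. -/
structure IsThickTensorIdeal (𝒯 : Set (Triangle C)) (t : C → C → C) (P : ObjectProperty C) :
    Prop where
  zero : ∃ z, IsZero z ∧ P z
  shift (n : ℤ) {x : C} (hx : P x) : P (x⟦n⟧)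
  ext₁ {T : Triangle C} (hT : T ∈ 𝒯) (h₂ : P T.obj₂) (h₃ : P T.obj₃) : P T.obj₁
  ext₂ {T : Triangle C} (hT : T ∈ 𝒯) (h₁ : P T.obj₁) (h₃ : P T.obj₃) : P T.obj₂
  ext₃ {T : Triangle C} (hT : T ∈ 𝒯) (h₁ : P T.obj₁) (h₂ : P T.obj₂) : P T.obj₃
  summand {x y : C} (r : Retract x y) (hy : P y) : P x
  tensor (x : C) {y : C} (hy : P y) : P (t x y)

/-- Prime thick tensor-ideals. -/
structure IsPrimeTensorIdeal (𝒯 : Set (Triangle C)) (t : C → C → C) (P : ObjectProperty C) :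
    Prop extends IsThickTensorIdeal 𝒯 t P where
  proper : ∃ x, ¬ P x
  prime {x y : C} (h : P (t x y)) : P x ∨ P y

/-- The set of prime thick tensor-ideals. -/
def Spectrum (𝒯 : Set (Triangle C)) (t : C → C → C) : Type u :=
  { P : ObjectProperty C // IsPrimeTensorIdeal 𝒯 t P }

/-- The topology with open basis the sets `{P | x ∈ P}`. -/
instance (𝒯 : Set (Triangle C)) (t : C → C → C) : TopologicalSpace (Spectrum 𝒯 t) :=
  TopologicalSpace.generateFrom (Set.range fun x : C => { P | P.1 x })

variable {D : Type u'} [Category.{v'} D] [HasShift D ℤ]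

/-- Functors which preserve shifts, distinguished triangles and tensor products. -/
structure IsTensorExact (𝒯 : Set (Triangle C)) (t : C → C → C) (𝒯' : Set (Triangle D))
    (t' : D → D → D) (G : C ⥤ D) [G.CommShift ℤ] : Prop where
  zero {z : C} (hz : IsZero z) : IsZero (G.obj z)
  triangle {T : Triangle C} (hT : T ∈ 𝒯) : G.mapTriangle.obj T ∈ 𝒯'
  tensor (x y : C) : Nonempty (G.obj (t x y) ≅ t' (G.obj x) (G.obj y))
  unit : ∃ u : C, ∀ y : D, Nonempty (t' y (G.obj u) ≅ y)

variable {𝒯 : Set (Triangle C)} {t : C → C → C} {𝒯' : Set (Triangle D)} {t' : D → D → D}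

lemma IsThickTensorIdeal.of_iso {P : ObjectProperty C} (h : IsThickTensorIdeal 𝒯 t P) {x y : C}
    (e : x ≅ y) (hx : P x) : P y :=
  h.summand (.ofIso e.symm) hx

lemma IsPrimeTensorIdeal.inverseImage {G : C ⥤ D} [G.CommShift ℤ]
    (hG : IsTensorExact 𝒯 t 𝒯' t' G) (hC : HasZeroObject C) {P : ObjectProperty D}
    (hP : IsPrimeTensorIdeal 𝒯' t' P) : IsPrimeTensorIdeal 𝒯 t (P.inverseImage G) where
  zero := by
    obtain ⟨z, hz⟩ := hC.zero
    obtain ⟨z', hz', h⟩ := hP.zero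
    exact ⟨z, hz, hP.of_iso (hz'.iso (hG.zero hz)) h⟩
  shift n x hx := hP.of_iso ((G.commShiftIso n).app x).symm (hP.shift n hx)
  ext₁ hT h₂ h₃ := hP.ext₁ (hG.triangle hT) h₂ h₃
  ext₂ hT h₁ h₃ := hP.ext₂ (hG.triangle hT) h₁ h₃
  ext₃ hT h₁ h₂ := hP.ext₃ (hG.triangle hT) h₁ h₂
  summand r hy := hP.summand (r.map G) hy
  tensor x y hy := hP.of_iso (hG.tensor x y).some.symm (hP.tensor (G.obj x) hy)
  proper := by
    obtain ⟨u, hu⟩ := hG.unit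
    obtain ⟨y, hy⟩ := hP.proper
    exact ⟨u, fun h => hy (hP.of_iso (hu y).some (hP.tensor y h))⟩
  prime {x y} h := hP.prime (hP.of_iso (hG.tensor x y).some h)

/-- The continuous map `P ↦ G⁻¹(P)` on spectra. -/
def Spectrum.comap (G : C ⥤ D) [G.CommShift ℤ] (hG : IsTensorExact 𝒯 t 𝒯' t' G)
    (hC : HasZeroObject C) : C(Spectrum 𝒯' t', Spectrum 𝒯 t) where
  toFun P := ⟨P.1.inverseImage G, P.2.inverseImage hG hC⟩
  continuous_toFun := by
    refine continuous_generateFrom_iff.2 ?_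
    rintro _ ⟨x, rfl⟩
    exact TopologicalSpace.isOpen_generateFrom_of_mem ⟨G.obj x, rfl⟩

end Spectrum

section Modules

variable {K : Type u} [Category.{v} K] [MonoidalCategory K] {A : K} [MonObj A]

/-- The action `A ⊗ x ⟶ x` of a left `A`-module `x`. -/
abbrev act (x : Mod K A) : A ⊗ x.X ⟶ x.X := ModObj.smul (M := A) (X := x.X)

lemma one_act (x : Mod K A) : η ▷ x.X ≫ act x = (λ_ x.X).hom :=
  ModObj.one_smul_self A x.X

lemma mul_act (x : Mod K A) :
    μ ▷ x.X ≫ act x = (α_ A A x.X).hom ≫ A ◁ act x ≫ act x :=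
  ModObj.mul_smul_self A x.X

lemma act_hom {x y : Mod K A} (f : x ⟶ y) : act x ≫ f.hom = A ◁ f.hom ≫ act y :=
  IsModHom.smul_hom (A := A) (f := f.hom)

/-- The `A`-module with underlying object `X` and action `ρ`. -/
def mkMod (X : K) (ρ : A ⊗ X ⟶ X) (h₁ : η ▷ X ≫ ρ = (λ_ X).hom)
    (h₂ : μ ▷ X ≫ ρ = (α_ A A X).hom ≫ A ◁ ρ ≫ ρ) : Mod K A :=
  letI : ModObj A X := { smul := ρ, one_smul := h₁, mul_smul := h₂ }
  ⟨X⟩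

/-- The morphism of `A`-modules given by an `A`-linear morphism. -/
def mkHom {x y : Mod K A} (f : x.X ⟶ y.X) (h : act x ≫ f = A ◁ f ≫ act y) : x ⟶ y :=
  letI : IsModHom A f := ⟨h⟩
  { hom := f }

@[simp] lemma mkHom_hom {x y : Mod K A} (f : x.X ⟶ y.X) (h) : (mkHom (A := A) f h).hom = f := rfl

/-- An `A`-linear isomorphism is an isomorphism of `A`-modules. -/
def mkIso {x y : Mod K A} (f : x.X ≅ y.X) (h : act x ≫ f.hom = A ◁ f.hom ≫ act y) : x ≅ y where
  hom := mkHom f.hom h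
  inv := mkHom f.inv (by
    rw [← cancel_mono f.hom, assoc, assoc, h, ← MonoidalCategory.whiskerLeft_comp_assoc]
    simp)
  hom_inv_id := Mod.hom_ext _ _ f.hom_inv_id
  inv_hom_id := Mod.hom_ext _ _ f.inv_hom_id

lemma eqToHom_hom {x y : Mod K A} (h : x = y) :
    (eqToHom h).hom = eqToHom (congr_arg Mod.X h) := by
  subst h; rfl

variable (A) in
/-- Extension of scalars `F_A : K ⥤ A-Mod`, `y ↦ (A ⊗ y, μ ⊗ 1)`. -/
def extScalars : K ⥤ Mod K A where
  obj y := mkMod (A ⊗ y) ((α_ A A y).inv ≫ μ ▷ y)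
    (by
      rw [associator_inv_naturality_left_assoc, ← comp_whiskerRight, one_mul]
      simp)
    (by
      rw [associator_inv_naturality_left_assoc, ← comp_whiskerRight, mul_assoc]
      simp)
  map f := mkHom (A ◁ f) (by
    change ((α_ A A _).inv ≫ μ ▷ _) ≫ A ◁ f = A ◁ A ◁ f ≫ (α_ A A _).inv ≫ μ ▷ _
    rw [assoc, ← whisker_exchange]
    simp)
  map_id _ := Mod.hom_ext _ _ (MonoidalCategory.whiskerLeft_id _ _)
  map_comp _ _ := Mod.hom_ext _ _ (MonoidalCategory.whiskerLeft_comp _ _ _)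

lemma act_extScalars (y : K) : act ((extScalars A).obj y) = (α_ A A y).inv ≫ μ ▷ y := rfl

end Modules

/-- A monoid object `A` is separable if its multiplication has a section `σ` which is linear
on both sides. -/
class IsSeparableMon {K : Type u} [Category.{v} K] [MonoidalCategory K] (A : K) [MonObj A] :
    Prop where
  exists_section : ∃ σ : A ⟶ A ⊗ A, σ ≫ μ = 𝟙 A ∧
    σ ▷ A ≫ (α_ A A A).hom ≫ A ◁ μ = μ ≫ σ ∧
    A ◁ σ ≫ (α_ A A A).inv ≫ μ ▷ A = μ ≫ σ

/-- A section of the action which is `A`-linear. -/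
lemma exists_linear_section {K : Type u} [Category.{v} K] [MonoidalCategory K] {A : K} [MonObj A]
    [IsSeparableMon A] (y : Mod K A) :
    ∃ s : y.X ⟶ A ⊗ y.X, s ≫ act y = 𝟙 _ ∧
      act y ≫ s = A ◁ s ≫ (α_ A A y.X).inv ≫ μ ▷ y.X := by
  obtain ⟨σ, h₁, h₂, h₃⟩ := IsSeparableMon.exists_section (A := A)
  refine ⟨(λ_ y.X).inv ≫ (η ≫ σ) ▷ y.X ≫ (α_ A A y.X).hom ≫ A ◁ act y, ?_, ?_⟩
  · have := mul_act y
    simp only [assoc]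
    rw [← mul_act, ← comp_whiskerRight_assoc, assoc, h₁, comp_id, one_act]
    simp
  · have e₁ : act y ≫ (λ_ y.X).inv ≫ (η ≫ σ) ▷ y.X ≫ (α_ A A y.X).hom ≫ A ◁ act y =
        σ ▷ y.X ≫ (α_ A A y.X).hom ≫ A ◁ act y := by
      have h : (λ_ A).inv ≫ (η ≫ σ) ▷ A ≫ (α_ A A A).hom ≫ A ◁ μ = σ := by
        rw [comp_whiskerRight_assoc, h₂, one_mul_assoc]
        simp
      have h' : A ◁ A ◁ act y ≫ A ◁ act y =
          A ◁ (α_ A A y.X).inv ≫ A ◁ μ ▷ y.X ≫ A ◁ act y := by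
        simp only [← MonoidalCategory.whiskerLeft_comp]
        rw [mul_act]
        simp
      conv_rhs => rw [← h]
      rw [leftUnitor_inv_naturality_assoc, whisker_exchange_assoc,
        associator_naturality_right_assoc, h']
      simp
    have e₂ : A ◁ ((λ_ y.X).inv ≫ (η ≫ σ) ▷ y.X ≫ (α_ A A y.X).hom ≫ A ◁ act y) ≫
        (α_ A A y.X).inv ≫ μ ▷ y.X = σ ▷ y.X ≫ (α_ A A y.X).hom ≫ A ◁ act y := by
      have h : (ρ_ A).inv ≫ A ◁ (η ≫ σ) ≫ (α_ A A A).inv ≫ μ ▷ A = σ := by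
        rw [MonoidalCategory.whiskerLeft_comp_assoc, h₃, mul_one_assoc]
        simp
      conv_rhs => rw [← h]
      have h' : A ◁ A ◁ act y ≫ (α_ A A y.X).inv ≫ μ ▷ y.X =
          (α_ A A (A ⊗ y.X)).inv ≫ μ ▷ (A ⊗ y.X) ≫ A ◁ act y := by
        rw [← whisker_exchange]
        simp
      simp only [MonoidalCategory.whiskerLeft_comp, assoc, h']
      simp
    rw [e₁, e₂]

section TensorOver

variable {K : Type u} [Category.{v} K] [MonoidalCategory K] [SymmetricCategory K]
  {A : K} [MonObj A]

/-- The right action `x ⊗ A ⟶ x` on a left module `x` over a commutative monoid `A`, obtained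
from the left action with the symmetry. -/
def ract (x : Mod K A) : x.X ⊗ A ⟶ x.X := (β_ x.X A).hom ≫ act x

/-- A tensor product of `x` and `y` over `A`: the coequalizer of the two maps
`x ⊗ A ⊗ y ⇉ x ⊗ y` given by the actions of `A` on `x` and on `y`, with the `A`-module structure
induced by that of `x`. -/
structure TensorOver (x y : Mod K A) where
  /-- the module `x ⊗_A y` -/
  obj : Mod K A
  /-- the projection onto `x ⊗_A y` -/
  π : x.X ⊗ y.X ⟶ obj.X
  condition : ract x ▷ y.X ≫ π = ((α_ x.X A y.X).hom ≫ x.X ◁ act y) ≫ π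
  isColimit : IsColimit (Cofork.ofπ π condition)
  linear : (α_ A x.X y.X).inv ≫ act x ▷ y.X ≫ π = A ◁ π ≫ act obj

lemma ract_one (x : Mod K A) : x.X ◁ η ≫ ract x = (ρ_ x.X).hom := by
  rw [ract, BraidedCategory.braiding_naturality_right_assoc, one_act]
  simp

variable [IsCommMonObj A]

lemma ract_act (x : Mod K A) :
    act x ▷ A ≫ ract x = (α_ A x.X A).hom ≫ A ◁ ract x ≫ act x := by
  have h := mul_act x
  rw [← IsCommMonObj.mul_comm A, comp_whiskerRight, assoc, mul_act] at h
  simp only [ract]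
  rw [BraidedCategory.braiding_naturality_left_assoc,
    BraidedCategory.braiding_tensor_left_hom]
  simp [h]

lemma ract_mul (x : Mod K A) :
    ract x ▷ A ≫ ract x = (α_ x.X A A).hom ≫ x.X ◁ μ ≫ ract x := by
  have h := mul_act x
  rw [← IsCommMonObj.mul_comm A, comp_whiskerRight, assoc, mul_act] at h
  simp only [ract]
  rw [BraidedCategory.braiding_naturality_right_assoc, mul_act, comp_whiskerRight, assoc,
    BraidedCategory.braiding_naturality_left_assoc,
    BraidedCategory.braiding_tensor_left_hom, BraidedCategory.braiding_tensor_right_hom]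
  simp [h]


/-- A balanced map out of `x ⊗ y` which has a section inducing the identity on balanced maps is a
coequalizer. -/
def isColimitOfSection {x y : Mod K A} {Z : K} (π : x.X ⊗ y.X ⟶ Z)
    (h : ract x ▷ y.X ≫ π = ((α_ x.X A y.X).hom ≫ x.X ◁ act y) ≫ π)
    (s : Z ⟶ x.X ⊗ y.X) (hs : s ≫ π = 𝟙 Z)
    (hf : ∀ ⦃T : K⦄ (f : x.X ⊗ y.X ⟶ T),
      ract x ▷ y.X ≫ f = ((α_ x.X A y.X).hom ≫ x.X ◁ act y) ≫ f → π ≫ s ≫ f = f) :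
    IsColimit (Cofork.ofπ π h) :=
  Cofork.IsColimit.mk _ (fun c => s ≫ c.π) (fun c => hf c.π c.condition)
    (fun c m hm => by
      have : π ≫ m = c.π := hm
      rw [← this, reassoc_of% hs])

/-- The pair of maps defining the tensor product over a separable monoid is split. -/
lemma exists_splitting [IsSeparableMon A] (x y : Mod K A) :
    ∃ S : x.X ⊗ y.X ⟶ (x.X ⊗ A) ⊗ y.X,
      S ≫ (α_ x.X A y.X).hom ≫ x.X ◁ act y = 𝟙 _ ∧
      ract x ▷ y.X ≫ S ≫ ract x ▷ y.X =
        ((α_ x.X A y.X).hom ≫ x.X ◁ act y) ≫ S ≫ ract x ▷ y.X ∧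
      (α_ A x.X y.X).inv ≫ act x ▷ y.X ≫ S ≫ ract x ▷ y.X =
        A ◁ (S ≫ ract x ▷ y.X) ≫ (α_ A x.X y.X).inv ≫ act x ▷ y.X := by
  obtain ⟨s, h₁, h₂⟩ := exists_linear_section y
  refine ⟨x.X ◁ s ≫ (α_ x.X A y.X).inv, ?_, ?_, ?_⟩
  · rw [assoc, Iso.inv_hom_id_assoc, ← MonoidalCategory.whiskerLeft_comp, h₁]
    simp
  · have e₁ : x.X ◁ act y ≫ x.X ◁ s = x.X ◁ A ◁ s ≫ x.X ◁ (α_ A A y.X).inv ≫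
        x.X ◁ μ ▷ y.X := by
      simp only [← MonoidalCategory.whiskerLeft_comp, h₂]
    simp only [assoc]
    rw [← whisker_exchange_assoc, associator_inv_naturality_left_assoc, ← comp_whiskerRight,
      ract_mul, reassoc_of% e₁]
    simp
  · simp only [assoc]
    rw [← whisker_exchange_assoc, associator_inv_naturality_left_assoc, ← comp_whiskerRight,
      ract_act]
    simp

/-- The projection onto the tensor product of modules over a separable monoid splits. -/
lemma TensorOver.exists_section [IsSeparableMon A] {x y : Mod K A} (t : TensorOver x y) :
    ∃ (s : t.obj.X ⟶ x.X ⊗ y.X) (S : x.X ⊗ y.X ⟶ (x.X ⊗ A) ⊗ y.X), s ≫ t.π = 𝟙 _ ∧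
      S ≫ (α_ x.X A y.X).hom ≫ x.X ◁ act y = 𝟙 _ ∧ t.π ≫ s = S ≫ ract x ▷ y.X := by
  obtain ⟨S, hS, he, -⟩ := exists_splitting x y
  have hπ : t.π ≫ Cofork.IsColimit.desc t.isColimit _ he = S ≫ ract x ▷ y.X :=
    Cofork.IsColimit.π_desc' t.isColimit _ he
  refine ⟨Cofork.IsColimit.desc t.isColimit _ he, S, ?_, hS, hπ⟩
  apply Cofork.IsColimit.hom_ext t.isColimit
  change t.π ≫ _ = t.π ≫ _
  rw [reassoc_of% hπ, t.condition, assoc, reassoc_of% hS]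
  simp

theorem TensorOver.nonempty [IsIdempotentComplete K] [IsSeparableMon A] (x y : Mod K A) :
    Nonempty (TensorOver x y) := by
  obtain ⟨S, hS, he, hl⟩ := exists_splitting x y
  have hf : ∀ ⦃T : K⦄ (f : x.X ⊗ y.X ⟶ T),
      ract x ▷ y.X ≫ f = ((α_ x.X A y.X).hom ≫ x.X ◁ act y) ≫ f →
        (S ≫ ract x ▷ y.X) ≫ f = f := fun T f h => by
    rw [assoc, h, assoc, reassoc_of% hS]
  generalize S ≫ ract x ▷ y.X = e at he hf hl
  obtain ⟨Z, i, p, hip, hpi⟩ := IsIdempotentComplete.idempotents_split _ e (hf e he)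
  have hp : e ≫ p = p := by rw [← hpi, assoc, hip, comp_id]
  have hi : i ≫ e = i := by rw [← hpi, reassoc_of% hip]
  have hb : ract x ▷ y.X ≫ p = ((α_ x.X A y.X).hom ≫ x.X ◁ act y) ≫ p := by
    rw [← hp, reassoc_of% he, assoc]
  have hm : A ◁ p ≫ A ◁ i ≫ (α_ A x.X y.X).inv ≫ act x ▷ y.X ≫ p =
      (α_ A x.X y.X).inv ≫ act x ▷ y.X ≫ p := by
    have := hl =≫ p
    simp only [assoc, hp] at this
    rw [← MonoidalCategory.whiskerLeft_comp_assoc, hpi, ← this]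
  refine ⟨⟨mkMod Z (A ◁ i ≫ (α_ A x.X y.X).inv ≫ act x ▷ y.X ≫ p) ?_ ?_, p, hb,
    isColimitOfSection p hb i hip fun T f h => by rw [reassoc_of% hpi, hf f h], ?_⟩⟩
  · rw [← whisker_exchange_assoc, associator_inv_naturality_left_assoc,
      ← comp_whiskerRight_assoc, one_act]
    simp [hip]
  · have h : A ◁ A ◁ i ≫ A ◁ (α_ A x.X y.X).inv ≫ A ◁ act x ▷ y.X ≫
        (α_ A x.X y.X).inv ≫ act x ▷ y.X ≫ p =
        A ◁ (A ◁ i ≫ (α_ A x.X y.X).inv ≫ act x ▷ y.X ≫ p) ≫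
          A ◁ i ≫ (α_ A x.X y.X).inv ≫ act x ▷ y.X ≫ p := by
      simp only [MonoidalCategory.whiskerLeft_comp, assoc, hm]
    rw [← h, ← whisker_exchange_assoc, associator_inv_naturality_left_assoc,
      ← comp_whiskerRight_assoc, mul_act]
    simp
  · exact hm.symm

/-- Two tensor products of `x` and `y` over `A` are isomorphic as `A`-modules. -/
lemma TensorOver.nonempty_iso [IsSeparableMon A] {x y : Mod K A} (t t' : TensorOver x y) :
    Nonempty (t.obj ≅ t'.obj) := by
  obtain ⟨s, -, hs, -⟩ := t.exists_section
  let e := t.isColimit.coconePointUniqueUpToIso t'.isColimit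
  have he : t.π ≫ e.hom = t'.π := t.isColimit.comp_coconePointUniqueUpToIso_hom t'.isColimit
    WalkingParallelPair.one
  refine ⟨mkIso e ?_⟩
  have : act t.obj = A ◁ s ≫ A ◁ t.π ≫ act t.obj := by
    rw [← MonoidalCategory.whiskerLeft_comp_assoc, hs]; simp
  have hl := t.linear =≫ e.hom
  simp only [assoc, he] at hl
  rw [this, assoc, assoc, ← hl, t'.linear, ← he]
  rw [MonoidalCategory.whiskerLeft_comp, assoc, ← MonoidalCategory.whiskerLeft_comp_assoc, hs]
  simp

variable (A) in
/-- The tensor product `x ⊗_A y` of modules over a commutative separable monoid in an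
idempotent-complete symmetric monoidal category; it exists by `TensorOver.nonempty` and is unique
up to isomorphism by `TensorOver.nonempty_iso`. -/
def tensorOver [IsIdempotentComplete K] [IsSeparableMon A] (x y : Mod K A) : Mod K A :=
  (TensorOver.nonempty x y).some.obj

/-- `tensorOver` is a tensor product. -/
def tensorOverData [IsIdempotentComplete K] [IsSeparableMon A] (x y : Mod K A) : TensorOver x y :=
  (TensorOver.nonempty x y).some

lemma TensorOver.nonempty_iso_tensorOver [IsIdempotentComplete K] [IsSeparableMon A] {x y : Mod K A}
    (t : TensorOver x y) : Nonempty (t.obj ≅ tensorOver A x y) :=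
  t.nonempty_iso (TensorOver.nonempty x y).some

/-- The regular module is a unit for the tensor product over `A`. -/
def tensorRegular (x : Mod K A) : TensorOver x (Mod.regular A) where
  obj := x
  π := ract x
  condition := by
    change ract x ▷ A ≫ ract x = ((α_ x.X A A).hom ≫ x.X ◁ μ) ≫ ract x
    rw [assoc, ract_mul]
  isColimit := isColimitOfSection _ _ ((ρ_ x.X).inv ≫ (x.X ◁ (η : 𝟙_ K ⟶ A)))
    (by
      change ((ρ_ x.X).inv ≫ x.X ◁ η) ≫ ract x = 𝟙 x.X
      rw [assoc, ract_one, Iso.inv_hom_id])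
    (by
      intro T f hf
      change x.X ⊗ A ⟶ T at f
      change ract x ▷ A ≫ f = ((α_ x.X A A).hom ≫ x.X ◁ μ) ≫ f at hf
      change ract x ≫ ((ρ_ x.X).inv ≫ x.X ◁ η) ≫ f = f
      rw [assoc, rightUnitor_inv_naturality_assoc, ← whisker_exchange_assoc, hf, assoc,
        associator_naturality_right_assoc, ← MonoidalCategory.whiskerLeft_comp_assoc, mul_one]
      simp)
  linear := by
    change (α_ A x.X A).inv ≫ act x ▷ A ≫ ract x = A ◁ ract x ≫ act x
    rw [ract_act, Iso.inv_hom_id_assoc]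

/-- The projection formula: `x ⊗ y`, with `A` acting on `x`, is a tensor product of `x` and
`F_A(y)` over `A`. -/
def tensorExtScalars (x : Mod K A) (y : K) : TensorOver x ((extScalars A).obj y) where
  obj := mkMod (x.X ⊗ y) ((α_ A x.X y).inv ≫ act x ▷ y)
    (by
      rw [associator_inv_naturality_left_assoc, ← comp_whiskerRight, one_act]
      simp)
    (by
      rw [associator_inv_naturality_left_assoc, ← comp_whiskerRight, mul_act]
      simp)
  π := (α_ x.X A y).inv ≫ ract x ▷ y
  condition := by
    change ract x ▷ (A ⊗ y) ≫ (α_ x.X A y).inv ≫ ract x ▷ y =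
      ((α_ x.X A (A ⊗ y)).hom ≫ x.X ◁ ((α_ A A y).inv ≫ μ ▷ y)) ≫ (α_ x.X A y).inv ≫ ract x ▷ y
    rw [associator_inv_naturality_left_assoc, ← comp_whiskerRight, ract_mul]
    simp
  isColimit := isColimitOfSection _ _ (x.X ◁ ((λ_ y).inv ≫ (η : 𝟙_ K ⟶ A) ▷ y))
    (by
      change x.X ◁ ((λ_ y).inv ≫ η ▷ y) ≫ (α_ x.X A y).inv ≫ ract x ▷ y = 𝟙 (x.X ⊗ y)
      have h := congr_arg (fun f => f ▷ y) (ract_one x)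
      simp only [comp_whiskerRight] at h
      rw [MonoidalCategory.whiskerLeft_comp, assoc, associator_inv_naturality_middle_assoc, h]
      simp)
    (by
      intro T f hf
      change x.X ⊗ (A ⊗ y) ⟶ T at f
      change ract x ▷ (A ⊗ y) ≫ f =
        ((α_ x.X A (A ⊗ y)).hom ≫ x.X ◁ ((α_ A A y).inv ≫ μ ▷ y)) ≫ f at hf
      change ((α_ x.X A y).inv ≫ ract x ▷ y) ≫ x.X ◁ ((λ_ y).inv ≫ η ▷ y) ≫ f = f
      have h : A ◁ ((λ_ y).inv ≫ η ▷ y) ≫ (α_ A A y).inv ≫ μ ▷ y = 𝟙 _ := by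
        rw [MonoidalCategory.whiskerLeft_comp, assoc, associator_inv_naturality_middle_assoc,
          ← comp_whiskerRight, mul_one]
        simp
      rw [assoc, ← whisker_exchange_assoc, hf, assoc, associator_naturality_right_assoc,
        ← MonoidalCategory.whiskerLeft_comp_assoc, h]
      simp)
  linear := by
    change (α_ A x.X (A ⊗ y)).inv ≫ act x ▷ (A ⊗ y) ≫ (α_ x.X A y).inv ≫ ract x ▷ y =
      A ◁ ((α_ x.X A y).inv ≫ ract x ▷ y) ≫ (α_ A x.X y).inv ≫ act x ▷ y
    rw [associator_inv_naturality_left_assoc, ← comp_whiskerRight, ract_act]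
    simp

lemma nonempty_extScalars_tensor_iso (x y : K) : ∃ t : TensorOver ((extScalars A).obj x)
    ((extScalars A).obj y), Nonempty (t.obj ≅ (extScalars A).obj (x ⊗ y)) := by
  refine ⟨tensorExtScalars _ y, ⟨mkIso (α_ A x y) ?_⟩⟩
  change ((α_ A (A ⊗ x) y).inv ≫ ((α_ A A x).inv ≫ μ ▷ x) ▷ y) ≫ (α_ A x y).hom =
    A ◁ (α_ A x y).hom ≫ (α_ A A (x ⊗ y)).inv ≫ μ ▷ (x ⊗ y)
  simp

end TensorOver

section MonoidalFunctor

variable {K : Type u} [Category.{v} K] [MonoidalCategory K] {L : Type u'} [Category.{v'} L]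
  [MonoidalCategory L]

section

variable (F : K ⥤ L) [F.Monoidal]

instance isSeparable_obj (A : K) [MonObj A] [IsSeparableMon A] : IsSeparableMon (F.obj A) where
  exists_section := by
    obtain ⟨σ, h₁, h₂, h₃⟩ := IsSeparableMon.exists_section (A := A)
    refine ⟨F.map σ ≫ Functor.OplaxMonoidal.δ F A A, ?_, ?_, ?_⟩
    · simp [← Functor.map_comp, h₁]
    · rw [← cancel_mono (Functor.LaxMonoidal.μ F A A)]
      simp only [Functor.obj.μ_def, comp_whiskerRight, MonoidalCategory.whiskerLeft_comp, assoc,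
        Functor.LaxMonoidal.μ_natural_right, Functor.Monoidal.δ_μ, comp_id, ← Functor.map_comp]
      rw [← h₂, ← Functor.LaxMonoidal.associativity_assoc,
        Functor.Monoidal.whiskerRight_δ_μ_assoc, Functor.LaxMonoidal.μ_natural_left_assoc]
      simp only [Functor.map_comp]
    · rw [← cancel_mono (Functor.LaxMonoidal.μ F A A)]
      simp only [Functor.obj.μ_def, comp_whiskerRight, MonoidalCategory.whiskerLeft_comp, assoc,
        Functor.LaxMonoidal.μ_natural_left, Functor.Monoidal.δ_μ, comp_id, ← Functor.map_comp]
      rw [← h₃, ← Functor.LaxMonoidal.associativity_inv_assoc,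
        Functor.Monoidal.whiskerLeft_δ_μ_assoc, Functor.LaxMonoidal.μ_natural_right_assoc]
      simp only [Functor.map_comp]

/-- The functor `A-Mod ⥤ F(A)-Mod` induced by `F`. -/
def modMap (A : K) [MonObj A] : Mod K A ⥤ Mod L (F.obj A) where
  obj x := mkMod (F.obj x.X) (Functor.LaxMonoidal.μ F A x.X ≫ F.map (act x))
    (by
      rw [Functor.obj.η_def, comp_whiskerRight, assoc, Functor.LaxMonoidal.μ_natural_left_assoc,
        ← F.map_comp, one_act, ← Functor.LaxMonoidal.left_unitality])
    (by
      rw [Functor.obj.μ_def, comp_whiskerRight, assoc, Functor.LaxMonoidal.μ_natural_left_assoc,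
        ← F.map_comp, mul_act, MonoidalCategory.whiskerLeft_comp, assoc,
        Functor.LaxMonoidal.μ_natural_right_assoc, F.map_comp, F.map_comp,
        Functor.LaxMonoidal.associativity_assoc])
  map {x y} f := mkHom (F.map f.hom) (by
    change (Functor.LaxMonoidal.μ F A x.X ≫ F.map (act x)) ≫ F.map f.hom =
      F.obj A ◁ F.map f.hom ≫ Functor.LaxMonoidal.μ F A y.X ≫ F.map (act y)
    rw [assoc, ← F.map_comp, act_hom]
    simp)
  map_id x := Mod.hom_ext _ _ (F.map_id x.X)
  map_comp f g := Mod.hom_ext _ _ (F.map_comp f.hom g.hom)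

end

variable [SymmetricCategory K] [SymmetricCategory L] (F : K ⥤ L) [F.Braided] (A : K) [MonObj A]

lemma ract_modMap (x : Mod K A) :
    ract ((modMap F A).obj x) = Functor.LaxMonoidal.μ F x.X A ≫ F.map (ract x) := by
  change (β_ (F.obj x.X) (F.obj A)).hom ≫ Functor.LaxMonoidal.μ F A x.X ≫ F.map (act x) = _
  rw [ract, F.map_comp, Functor.LaxBraided.braided_assoc]

/-- The functor `A-Mod ⥤ F(A)-Mod` preserves tensor products. -/
lemma exists_tensorOver_modMap [IsCommMonObj A] [IsSeparableMon A] {x y : Mod K A} (t : TensorOver x y) :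
    ∃ t' : TensorOver ((modMap F A).obj x) ((modMap F A).obj y),
      t'.obj = (modMap F A).obj t.obj := by
  obtain ⟨s, S, hs, hS, hπ⟩ := t.exists_section
  have hc : (Functor.LaxMonoidal.μ F x.X A ≫ F.map (ract x)) ▷ F.obj y.X ≫
      Functor.LaxMonoidal.μ F x.X y.X ≫ F.map t.π =
      ((α_ (F.obj x.X) (F.obj A) (F.obj y.X)).hom ≫
        F.obj x.X ◁ (Functor.LaxMonoidal.μ F A y.X ≫ F.map (act y))) ≫
          Functor.LaxMonoidal.μ F x.X y.X ≫ F.map t.π := by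
    have h := F.congr_map t.condition
    simp only [F.map_comp, assoc] at h
    simp only [comp_whiskerRight, MonoidalCategory.whiskerLeft_comp, assoc]
    rw [Functor.LaxMonoidal.μ_natural_left_assoc, h, Functor.LaxMonoidal.μ_natural_right_assoc,
      Functor.LaxMonoidal.associativity_assoc]
  have hc' : ract ((modMap F A).obj x) ▷ F.obj y.X ≫
      Functor.LaxMonoidal.μ F x.X y.X ≫ F.map t.π =
      ((α_ (F.obj x.X) (F.obj A) (F.obj y.X)).hom ≫
        F.obj x.X ◁ act ((modMap F A).obj y)) ≫ Functor.LaxMonoidal.μ F x.X y.X ≫ F.map t.π := by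
    rw [ract_modMap]
    exact hc
  refine ⟨⟨(modMap F A).obj t.obj, Functor.LaxMonoidal.μ F x.X y.X ≫ F.map t.π, hc',
    isColimitOfSection _ hc' (F.map s ≫ Functor.OplaxMonoidal.δ F x.X y.X) ?_ ?_, ?_⟩, rfl⟩
  · change (F.map s ≫ Functor.OplaxMonoidal.δ F x.X y.X) ≫
      Functor.LaxMonoidal.μ F x.X y.X ≫ F.map t.π = 𝟙 _
    simp [← F.map_comp, hs]
  · intro T f hf
    change F.obj x.X ⊗ F.obj y.X ⟶ T at f
    rw [ract_modMap] at hf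
    change (Functor.LaxMonoidal.μ F x.X A ≫ F.map (ract x)) ▷ F.obj y.X ≫ f =
      ((α_ (F.obj x.X) (F.obj A) (F.obj y.X)).hom ≫
        F.obj x.X ◁ (Functor.LaxMonoidal.μ F A y.X ≫ F.map (act y))) ≫ f at hf
    change (Functor.LaxMonoidal.μ F x.X y.X ≫ F.map t.π) ≫
      (F.map s ≫ Functor.OplaxMonoidal.δ F x.X y.X) ≫ f = f
    have h₁ : F.map (ract x ▷ y.X) ≫ Functor.OplaxMonoidal.δ F x.X y.X ≫ f =
        F.map ((α_ x.X A y.X).hom ≫ x.X ◁ act y) ≫ Functor.OplaxMonoidal.δ F x.X y.X ≫ f := by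
      rw [← cancel_epi (Functor.LaxMonoidal.μ F (x.X ⊗ A) y.X),
        ← cancel_epi (Functor.LaxMonoidal.μ F x.X A ▷ F.obj y.X)]
      simp only [comp_whiskerRight, MonoidalCategory.whiskerLeft_comp, assoc] at hf
      rw [← Functor.LaxMonoidal.μ_natural_left_assoc, Functor.Monoidal.μ_δ_assoc, hf, F.map_comp,
        assoc, Functor.LaxMonoidal.associativity_assoc,
        ← Functor.LaxMonoidal.μ_natural_right_assoc, Functor.Monoidal.μ_δ_assoc]
    have h₂ : F.map t.π ≫ F.map s = F.map S ≫ F.map (ract x ▷ y.X) := by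
      simp only [← F.map_comp, hπ]
    rw [assoc, assoc, reassoc_of% h₂, h₁, ← F.map_comp_assoc, hS]
    simp
  · change (α_ (F.obj A) (F.obj x.X) (F.obj y.X)).inv ≫
        (Functor.LaxMonoidal.μ F A x.X ≫ F.map (act x)) ▷ F.obj y.X ≫
          Functor.LaxMonoidal.μ F x.X y.X ≫ F.map t.π =
      F.obj A ◁ (Functor.LaxMonoidal.μ F x.X y.X ≫ F.map t.π) ≫
        Functor.LaxMonoidal.μ F A t.obj.X ≫ F.map (act t.obj)
    have h := F.congr_map t.linear
    simp only [F.map_comp] at h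
    simp only [comp_whiskerRight, MonoidalCategory.whiskerLeft_comp, assoc]
    rw [Functor.LaxMonoidal.μ_natural_right_assoc, ← h,
      Functor.LaxMonoidal.μ_natural_left_assoc, ← Functor.LaxMonoidal.associativity_inv_assoc]

end MonoidalFunctor

section TT

variable {K : Type u} [Category.{v} K] [Preadditive K] [HasZeroObject K] [HasShift K ℤ]
  [∀ n : ℤ, (shiftFunctor K n).Additive] [Pretriangulated K] [MonoidalCategory K]

variable (K) in
/-- Compatibility of a monoidal structure with a triangulation: each functor `x ⊗ -` is exact, for
isomorphisms `x ⊗ Σⁿ z ≅ Σⁿ (x ⊗ z)` natural in `x` and `z` and compatible with the unit and the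
associativity constraints. -/
class TensorTriangulated where
  commShift (x : K) : (tensorLeft x).CommShift ℤ
  exact (x : K) : (tensorLeft x).IsTriangulated
  natural {x y : K} (f : x ⟶ y) (n : ℤ) (z : K) :
    f ▷ z⟦n⟧ ≫ ((tensorLeft y).commShiftIso n).hom.app z =
      ((tensorLeft x).commShiftIso n).hom.app z ≫ (f ▷ z)⟦n⟧'
  unit (n : ℤ) (z : K) :
    ((tensorLeft (𝟙_ K)).commShiftIso n).hom.app z ≫ (λ_ z).hom⟦n⟧' = (λ_ (z⟦n⟧)).hom
  assoc (x y : K) (n : ℤ) (z : K) :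
    (α_ x y (z⟦n⟧)).hom ≫ x ◁ ((tensorLeft y).commShiftIso n).hom.app z ≫
        ((tensorLeft x).commShiftIso n).hom.app (y ⊗ z) =
      ((tensorLeft (x ⊗ y)).commShiftIso n).hom.app z ≫ (α_ x y z).hom⟦n⟧'

attribute [reducible, instance] TensorTriangulated.commShift
attribute [instance] TensorTriangulated.exact

variable [TensorTriangulated K]

/-- The isomorphism `x ⊗ Σⁿ z ≅ Σⁿ (x ⊗ z)`. -/
def tensorShift (x : K) (n : ℤ) (z : K) : x ⊗ z⟦n⟧ ≅ (x ⊗ z)⟦n⟧ :=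
  ((tensorLeft x).commShiftIso n).app z

lemma tensorShift_natural {x y : K} (f : x ⟶ y) (n : ℤ) (z : K) :
    f ▷ z⟦n⟧ ≫ (tensorShift y n z).hom = (tensorShift x n z).hom ≫ (f ▷ z)⟦n⟧' :=
  TensorTriangulated.natural f n z

lemma tensorShift_natural_right (x : K) (n : ℤ) {z z' : K} (f : z ⟶ z') :
    x ◁ f⟦n⟧' ≫ (tensorShift x n z').hom = (tensorShift x n z).hom ≫ (x ◁ f)⟦n⟧' :=
  ((tensorLeft x).commShiftIso n).hom.naturality f

lemma tensorShift_unit (n : ℤ) (z : K) :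
    (tensorShift (𝟙_ K) n z).hom ≫ (λ_ z).hom⟦n⟧' = (λ_ (z⟦n⟧)).hom :=
  TensorTriangulated.unit n z

lemma tensorShift_assoc (x y : K) (n : ℤ) (z : K) :
    (α_ x y (z⟦n⟧)).hom ≫ x ◁ (tensorShift y n z).hom ≫ (tensorShift x n (y ⊗ z)).hom =
      (tensorShift (x ⊗ y) n z).hom ≫ (α_ x y z).hom⟦n⟧' :=
  TensorTriangulated.assoc x y n z

lemma tensorShift_zero (x z : K) :
    (tensorShift x (0 : ℤ) z).hom = x ◁ (shiftFunctorZero K ℤ).hom.app z ≫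
      (shiftFunctorZero K ℤ).inv.app (x ⊗ z) := by
  have := congr_arg (fun e => e.hom.app z) ((tensorLeft x).commShiftIso_zero ℤ)
  simpa [tensorShift] using this

lemma tensorShift_add (x : K) (m n : ℤ) (z : K) :
    (tensorShift x (m + n) z).hom = x ◁ (shiftFunctorAdd K m n).hom.app z ≫
      (tensorShift x n (z⟦m⟧)).hom ≫ (tensorShift x m z).hom⟦n⟧' ≫
      (shiftFunctorAdd K m n).inv.app (x ⊗ z) := by
  have := congr_arg (fun e => e.hom.app z) ((tensorLeft x).commShiftIso_add m n)
  simpa [tensorShift] using this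

variable {A : K} [MonObj A]

/-- The shift functors on `A`-modules, given by the shift on underlying objects. -/
def modShift (n : ℤ) : Mod K A ⥤ Mod K A where
  obj x := mkMod (x.X⟦n⟧) ((tensorShift A n x.X).hom ≫ (act x)⟦n⟧')
    (by
      rw [reassoc_of% (@tensorShift_natural), ← Functor.map_comp, one_act, tensorShift_unit])
    (by
      rw [reassoc_of% (@tensorShift_natural), ← Functor.map_comp, mul_act]
      simp only [Functor.map_comp, MonoidalCategory.whiskerLeft_comp, assoc]
      rw [reassoc_of% (@tensorShift_natural_right), reassoc_of% (@tensorShift_assoc)])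
  map {x y} f := mkHom (f.hom⟦n⟧') (by
    change ((tensorShift A n x.X).hom ≫ (act x)⟦n⟧') ≫ f.hom⟦n⟧' =
      A ◁ f.hom⟦n⟧' ≫ ((tensorShift A n y.X).hom ≫ (act y)⟦n⟧')
    rw [assoc, ← Functor.map_comp, act_hom, reassoc_of% (@tensorShift_natural_right),
      Functor.map_comp])
  map_id x := Mod.hom_ext _ _ ((shiftFunctor K n).map_id x.X)
  map_comp f g := Mod.hom_ext _ _ ((shiftFunctor K n).map_comp f.hom g.hom)

instance modHasShift : HasShift (Mod K A) ℤ :=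
  hasShiftMk (Mod K A) ℤ
    { F := modShift
      zero := NatIso.ofComponents (fun x => mkIso ((shiftFunctorZero K ℤ).app x.X) (by
          change ((tensorShift A 0 x.X).hom ≫ (act x)⟦(0 : ℤ)⟧') ≫
            (shiftFunctorZero K ℤ).hom.app x.X = A ◁ (shiftFunctorZero K ℤ).hom.app x.X ≫ act x
          rw [tensorShift_zero]
          simp))
        (fun f => Mod.hom_ext _ _ ((shiftFunctorZero K ℤ).hom.naturality f.hom))
      add := fun m n => NatIso.ofComponents
        (fun x => mkIso ((shiftFunctorAdd K m n).app x.X) (by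
          change ((tensorShift A (m + n) x.X).hom ≫ (act x)⟦m + n⟧') ≫
            (shiftFunctorAdd K m n).hom.app x.X = A ◁ (shiftFunctorAdd K m n).hom.app x.X ≫
              (tensorShift A n (x.X⟦m⟧)).hom ≫
                ((tensorShift A m x.X).hom ≫ (act x)⟦m⟧')⟦n⟧'
          rw [tensorShift_add]
          simp))
        (fun f => Mod.hom_ext _ _ ((shiftFunctorAdd K m n).hom.naturality f.hom))
      assoc_hom_app := fun m₁ m₂ m₃ x => Mod.hom_ext _ _ (by
        have := shiftFunctorAdd_assoc_hom_app m₁ m₂ m₃ x.X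
        simp only [shiftFunctorAdd', Iso.trans_hom, eqToIso.hom, NatTrans.comp_app,
          eqToHom_app, assoc] at this
        simpa [eqToHom_hom] using! this)
      zero_add_hom_app := fun n x => Mod.hom_ext _ _ (by
        have := shiftFunctorAdd_zero_add_hom_app (A := ℤ) n x.X
        simpa [eqToHom_hom] using! this)
      add_zero_hom_app := fun n x => Mod.hom_ext _ _ (by
        have := shiftFunctorAdd_add_zero_hom_app (A := ℤ) n x.X
        simpa [eqToHom_hom] using! this) }

lemma shiftFunctorZero_hom_app_hom (x : Mod K A) :
    ((shiftFunctorZero (Mod K A) ℤ).hom.app x).hom = (shiftFunctorZero K ℤ).hom.app x.X := rfl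

lemma shiftFunctorZero_inv_app_hom (x : Mod K A) :
    ((shiftFunctorZero (Mod K A) ℤ).inv.app x).hom = (shiftFunctorZero K ℤ).inv.app x.X := rfl

lemma shiftFunctorAdd_hom_app_hom (m n : ℤ) (x : Mod K A) :
    ((shiftFunctorAdd (Mod K A) m n).hom.app x).hom = (shiftFunctorAdd K m n).hom.app x.X := rfl

lemma shiftFunctorAdd_inv_app_hom (m n : ℤ) (x : Mod K A) :
    ((shiftFunctorAdd (Mod K A) m n).inv.app x).hom = (shiftFunctorAdd K m n).inv.app x.X := rfl

/-- The forgetful functor `U_A` commutes with the shifts. -/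
instance forgetCommShift : (Mod.forget A : Mod K A ⥤ K).CommShift ℤ where
  commShiftIso n := NatIso.ofComponents (fun x => Iso.refl (x.X⟦n⟧)) (fun f => by
    change f.hom⟦n⟧' ≫ 𝟙 _ = 𝟙 _ ≫ f.hom⟦n⟧'
    simp)
  commShiftIso_zero := by
    ext x
    change 𝟙 _ = _
    rw [Functor.CommShift.isoZero_hom_app]
    change _ = (shiftFunctorZero K ℤ).hom.app x.X ≫ (shiftFunctorZero K ℤ).inv.app x.X
    simp
  commShiftIso_add m n := by
    ext x
    change 𝟙 _ = _
    rw [Functor.CommShift.isoAdd_hom_app]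
    change _ = (shiftFunctorAdd K m n).hom.app x.X ≫ 𝟙 _ ≫ (𝟙 (x.X⟦m⟧))⟦n⟧' ≫
      (shiftFunctorAdd K m n).inv.app x.X
    simp

variable (A) in
/-- The distinguished triangles of `A`-modules, for `A` separable: those whose underlying triangle
is distinguished. (This is the only triangulation for which `F_A` and `U_A` are exact.) -/
def modDist : Set (Triangle (Mod K A)) :=
  { T | (Mod.forget A).mapTriangle.obj T ∈ distTriang K }

/-- `F_A` commutes with the shifts. -/
instance extScalarsCommShift : (extScalars A : K ⥤ Mod K A).CommShift ℤ where
  commShiftIso n := NatIso.ofComponents (fun y => mkIso (tensorShift A n y) (by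
      change ((α_ A A _).inv ≫ μ ▷ _) ≫ (tensorShift A n y).hom =
        A ◁ (tensorShift A n y).hom ≫ (tensorShift A n (A ⊗ y)).hom ≫
          ((α_ A A y).inv ≫ μ ▷ y)⟦n⟧'
      have h := tensorShift_assoc A A n y
      rw [← Iso.eq_inv_comp] at h
      rw [reassoc_of% h, assoc, tensorShift_natural, ← Functor.map_comp, Iso.hom_inv_id_assoc]))
    (fun f => Mod.hom_ext _ _ (tensorShift_natural_right A n f))
  commShiftIso_zero := by
    ext y
    change (tensorShift A (0 : ℤ) y).hom = _
    rw [tensorShift_zero, Functor.CommShift.isoZero_hom_app]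
    rfl
  commShiftIso_add m n := by
    ext y
    change (tensorShift A (m + n) y).hom = _
    rw [tensorShift_add, Functor.CommShift.isoAdd_hom_app]
    rfl

lemma isZero_tensor (x : K) {z : K} (hz : IsZero z) : IsZero (x ⊗ z) :=
  (tensorLeft x).map_isZero hz

lemma isZero_mod {x : Mod K A} (h : IsZero x.X) : IsZero x where
  unique_to y := ⟨⟨⟨mkHom (h.to_ y.X) ((isZero_tensor A h).eq_of_src _ _)⟩,
    fun _ => Mod.hom_ext _ _ (h.eq_of_src _ _)⟩⟩
  unique_from y := ⟨⟨⟨mkHom (h.from_ y.X) (h.eq_of_tgt _ _)⟩,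
    fun _ => Mod.hom_ext _ _ (h.eq_of_tgt _ _)⟩⟩

lemma isZero_X {x : Mod K A} (h : IsZero x) : IsZero x.X := by
  obtain ⟨z, hz⟩ := HasZeroObject.zero (C := K)
  have h₀ : IsZero ((extScalars A).obj z) := isZero_mod (isZero_tensor A hz)
  exact IsZero.of_iso (isZero_tensor A hz) ((Mod.forget A).mapIso (h.iso h₀))

instance : HasZeroObject (Mod K A) where
  zero := by
    obtain ⟨z, hz⟩ := HasZeroObject.zero (C := K)
    exact ⟨(extScalars A).obj z, isZero_mod (isZero_tensor A hz)⟩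

end TT

section TTSpectra

variable {K : Type u} [Category.{v} K] [Preadditive K] [HasZeroObject K] [HasShift K ℤ]
  [∀ n : ℤ, (shiftFunctor K n).Additive] [Pretriangulated K] [MonoidalCategory K]
  [SymmetricCategory K] [TensorTriangulated K]

variable (K) in
/-- The spectrum `Spc K`. -/
abbrev Spc : Type u := Spectrum (distTriang K) (fun x y : K => x ⊗ y)

variable (A : K) [MonObj A] [IsCommMonObj A] [IsSeparableMon A] [IsIdempotentComplete K]

/-- The spectrum `Spc (A-Mod)` for a commutative separable monoid object `A`. -/
abbrev SpcMod : Type (max u v) := Spectrum (modDist A) (tensorOver A)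

lemma extScalars_isTensorExact : IsTensorExact (distTriang K) (fun x y : K => x ⊗ y)
    (modDist A) (tensorOver A) (extScalars A) where
  zero hz := isZero_mod (isZero_tensor A hz)
  triangle {T} hT := by
    refine isomorphic_distinguished _ ((tensorLeft A).map_distinguished T hT) _
      (Triangle.isoMk _ _ (Iso.refl _) (Iso.refl _) (Iso.refl _) ?_ ?_ ?_)
    · change (A ◁ T.mor₁) ≫ 𝟙 _ = 𝟙 _ ≫ A ◁ T.mor₁
      simp
    · change (A ◁ T.mor₂) ≫ 𝟙 _ = 𝟙 _ ≫ A ◁ T.mor₂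
      simp
    · change ((A ◁ T.mor₃ ≫ (tensorShift A 1 T.obj₁).hom) ≫ 𝟙 _) ≫ (𝟙 (A ⊗ T.obj₁))⟦(1 : ℤ)⟧' =
        𝟙 _ ≫ A ◁ T.mor₃ ≫ (tensorShift A 1 T.obj₁).hom
      simp
  tensor x y := by
    obtain ⟨t, ⟨e⟩⟩ := nonempty_extScalars_tensor_iso (A := A) x y
    obtain ⟨e'⟩ := t.nonempty_iso_tensorOver
    exact ⟨e.symm ≪≫ e'⟩
  unit := ⟨𝟙_ K, fun y => by
    obtain ⟨e⟩ := (tensorExtScalars y (𝟙_ K)).nonempty_iso_tensorOver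
    refine ⟨e.symm ≪≫ mkIso (ρ_ y.X) ?_⟩
    change ((α_ A y.X (𝟙_ K)).inv ≫ act y ▷ 𝟙_ K) ≫ (ρ_ y.X).hom = A ◁ (ρ_ y.X).hom ≫ act y
    simp⟩

/-- The map `φ_A = Spc(F_A)`. -/
def extScalarsSpc : C(SpcMod A, Spc K) :=
  Spectrum.comap (extScalars A) (extScalars_isTensorExact A) inferInstance

end TTSpectra

section Degree

variable {K : Type u} [Category.{v} K] [Preadditive K] [HasBinaryBiproducts K]
  [MonoidalCategory K] [SymmetricCategory K]

/-- For a commutative separable monoid `A` over `R`, with structure map `f : R ⟶ A`, this says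
that `A` has degree at most `d` over `R`. There is an essentially unique decomposition
`A ⊗_R A ≅ A × C` of monoids whose first component is the multiplication (here `A ⊗_R A` is
expressed as the coequalizer of `A ⊗ R ⊗ A ⇉ A ⊗ A`), and `C` is an `A`-algebra through
`g ∘ (1 ⊗ η)`. Iterating this gives the splitting tower `R ⟶ A ⟶ C ⟶ ⋯` of `A` over `R`; the degree
of `A` over `R` is at most `0` if `A = 0`, and at most `n + 1` if the degree of `C` over `A` is at
most `n`. -/
def DegreeLE : ℕ → ∀ {R A : K} [MonObj A], (R ⟶ A) → Prop
  | 0, _, A, _, _ => IsZero A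
  | n + 1, R, A, _, f => ∃ (C : K) (_ : MonObj C) (_ : IsCommMonObj C) (_ : IsSeparableMon C)
      (g : A ⊗ A ⟶ C) (_ : IsMonHom g)
      (w : (A ◁ f ≫ μ) ▷ A ≫ biprod.lift μ g =
        ((α_ A R A).hom ≫ A ◁ (f ▷ A ≫ μ)) ≫ biprod.lift μ g),
      Nonempty (IsColimit (Cofork.ofπ (biprod.lift μ g) w)) ∧
        DegreeLE n ((ρ_ A).inv ≫ A ◁ η ≫ g)

/-- A commutative separable monoid has finite degree if it has degree at most `d` over the unit,
for some `d`. -/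
def HasFiniteDegree (A : K) [MonObj A] : Prop :=
  ∃ d : ℕ, DegreeLE d (η : 𝟙_ K ⟶ A)

end Degree

section TTFunctor

variable {K : Type u} [Category.{v} K] [Preadditive K] [HasZeroObject K] [HasShift K ℤ]
  [∀ n : ℤ, (shiftFunctor K n).Additive] [Pretriangulated K] [MonoidalCategory K]
  [SymmetricCategory K] [TensorTriangulated K]
  {L : Type u'} [Category.{v'} L] [Preadditive L] [HasZeroObject L] [HasShift L ℤ]
  [∀ n : ℤ, (shiftFunctor L n).Additive] [Pretriangulated L] [MonoidalCategory L]
  [SymmetricCategory L] [TensorTriangulated L]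

/-- A tt-functor: a symmetric strong monoidal exact functor, such that the two structures are
compatible with the isomorphisms `x ⊗ Σⁿ y ≅ Σⁿ (x ⊗ y)`. -/
class IsTTFunctor (F : K ⥤ L) [F.CommShift ℤ] [F.Braided] : Prop extends F.IsTriangulated where
  compatible (F) (x y : K) (n : ℤ) :
    Functor.LaxMonoidal.μ F x (y⟦n⟧) ≫ F.map (tensorShift x n y).hom ≫
        (F.commShiftIso n).hom.app (x ⊗ y) =
      F.obj x ◁ (F.commShiftIso n).hom.app y ≫ (tensorShift (F.obj x) n (F.obj y)).hom ≫
        (Functor.LaxMonoidal.μ F x y)⟦n⟧'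

variable (F : K ⥤ L) [F.CommShift ℤ] [F.Braided] [IsTTFunctor F]

lemma IsTTFunctor.isTensorExact : IsTensorExact (distTriang K) (fun x y : K => x ⊗ y)
    (distTriang L) (fun x y : L => x ⊗ y) F where
  zero hz := F.map_isZero hz
  triangle hT := F.map_distinguished _ hT
  tensor x y := ⟨(Functor.Monoidal.μIso F x y).symm⟩
  unit := ⟨𝟙_ K, fun y => ⟨whiskerLeftIso y (Functor.Monoidal.εIso F).symm ≪≫ ρ_ y⟩⟩

/-- The map `Spc(F)`. -/
def ttSpc : C(Spc L, Spc K) :=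
  Spectrum.comap F (IsTTFunctor.isTensorExact F) inferInstance

instance modMapCommShift (A : K) [MonObj A] : (modMap F A).CommShift ℤ where
  commShiftIso n := NatIso.ofComponents (fun x => mkIso ((F.commShiftIso n).app x.X) (by
      change (Functor.LaxMonoidal.μ F A (x.X⟦n⟧) ≫
          F.map ((tensorShift A n x.X).hom ≫ (act x)⟦n⟧')) ≫ (F.commShiftIso n).hom.app x.X =
        F.obj A ◁ (F.commShiftIso n).hom.app x.X ≫ (tensorShift (F.obj A) n (F.obj x.X)).hom ≫
          (Functor.LaxMonoidal.μ F A x.X ≫ F.map (act x))⟦n⟧'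
      have h := F.commShiftIso_hom_naturality (act x) n
      rw [(shiftFunctor L n).map_comp, ← reassoc_of% (IsTTFunctor.compatible F), assoc, F.map_comp, assoc,
        h]))
    (fun f => Mod.hom_ext _ _ ((F.commShiftIso n).hom.naturality f.hom))
  commShiftIso_zero := by
    ext x
    change (F.commShiftIso (0 : ℤ)).hom.app x.X = _
    rw [F.commShiftIso_zero, Functor.CommShift.isoZero_hom_app,
      Functor.CommShift.isoZero_hom_app]
    rfl
  commShiftIso_add m n := by
    ext x
    change (F.commShiftIso (m + n)).hom.app x.X = _
    rw [F.commShiftIso_add, Functor.CommShift.isoAdd_hom_app,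
      Functor.CommShift.isoAdd_hom_app]
    rfl

variable (A : K) [MonObj A]

variable [IsCommMonObj A] [IsSeparableMon A] [IsIdempotentComplete K] [IsIdempotentComplete L]

lemma modMap_isTensorExact : IsTensorExact (modDist A) (tensorOver A)
    (modDist (F.obj A)) (tensorOver (F.obj A)) (modMap F A) where
  zero hz := isZero_mod (F.map_isZero (isZero_X hz))
  triangle {T} hT := by
    refine isomorphic_distinguished _ (F.map_distinguished _ hT) _
      (Triangle.isoMk _ _ (Iso.refl _) (Iso.refl _) (Iso.refl _) ?_ ?_ ?_)
    · change F.map T.mor₁.hom ≫ 𝟙 _ = 𝟙 _ ≫ F.map T.mor₁.hom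
      simp
    · change F.map T.mor₂.hom ≫ 𝟙 _ = 𝟙 _ ≫ F.map T.mor₂.hom
      simp
    · change ((F.map T.mor₃.hom ≫ (F.commShiftIso (1 : ℤ)).hom.app T.obj₁.X) ≫ 𝟙 _) ≫
          (𝟙 (F.obj T.obj₁.X))⟦(1 : ℤ)⟧' =
        𝟙 _ ≫ F.map (T.mor₃.hom ≫ 𝟙 (T.obj₁.X⟦(1 : ℤ)⟧)) ≫ (F.commShiftIso (1 : ℤ)).hom.app T.obj₁.X
      have h : T.mor₃.hom ≫ 𝟙 (T.obj₁.X⟦(1 : ℤ)⟧) = T.mor₃.hom := comp_id _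
      rw [h]
      simp
      rfl
  tensor x y := by
    obtain ⟨t, ht⟩ := exists_tensorOver_modMap F A (tensorOverData x y)
    obtain ⟨e⟩ := t.nonempty_iso_tensorOver
    exact ⟨eqToIso ht.symm ≪≫ e⟩
  unit := ⟨Mod.regular A, fun y => by
    obtain ⟨e⟩ := (tensorRegular y).nonempty_iso_tensorOver
    exact ⟨e.symm⟩⟩

/-- The map `Spc(F(A)-Mod) ⟶ Spc(A-Mod)` induced by the functor `A-Mod ⥤ F(A)-Mod`. -/
def modMapSpc : C(SpcMod (F.obj A), SpcMod A) :=
  Spectrum.comap (modMap F A) (modMap_isTensorExact F A) inferInstance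

end TTFunctor
end TTGeom

end

open TTGeom

/-! Write `B = F(A)`, and let `𝒫` and `𝒬` have the same image in the spectrum of `K`. The theorem
combines an existence statement, which needs no bound on the degree, with an incomparability
statement, which is where finite degree enters.

Existence (`exists_prime_over_of_extScalars`). Consider the ideal of `B`-modules whose underlying
object lies in `𝒬`. It contains no product `F(x) ⊗_B (B ⊗ y) ≅ F(x) ⊗ y` with `x ∉ 𝒫` and `y ∉ 𝒬`:
primality of `𝒬` would put `F(x)` in `𝒬`, hence `A ⊗ x` in `𝒫`, hence its summand `x` in `𝒫`. Zorn's
lemma (`exists_prime_avoiding`) yields a prime `𝒬'` that contains this ideal and avoids both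
classes. It lies exactly over `𝒬`, and its contraction to `A`-modules is contained in `𝒫`. This
contraction and `𝒫` have the same image in the spectrum of `K`, so it remains to see that two
comparable primes in one fibre are equal.

Incomparability (`DegreeLE.incomparable`), by induction on the degree of `R ⟶ A`. Let `P₁ ⊆ P` have
the same contraction to `R`, and let `M ⊆ P₁` be minimal in this fibre. The decomposition `A ⊗_R A ≅
A × C` shows that `A ⊗_R x` lies in `P` as soon as `x` and `C ⊗_A x` do (`IsIdeal.ext_res`). If `P ≠
M`, this permits the construction of a prime `T` of `C`-modules contracting to `M` along one map `A
⟶ C` and to `P` along the other. Going down along the second map gives a prime `T₁ ⊆ T` over `M`;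
minimality forces `T₁` and `T` to have the same contraction `M` along the first map. Since `C` has
smaller degree over `A`, induction gives `T₁ = T`, so `P = M`. In degree zero there are no primes at
all.

The module theory underneath rests on separability. One map `𝟙 ⟶ A ⊗ A` gives a natural linear
section of every action. Hence `z ⊗_A y` is the image of an explicit idempotent of `z ⊗ y`, the
functor `z ⊗_A -` is exact (`exists_relTensor_triangle`), and every module is a summand of the
extension of its restriction (`nonempty_retract_ext_res`). In particular a thick subcategory of
modules is a tensor-ideal once it is stable under the action of the base category
(`isIdeal_of_tens`). -/

noncomputable section

namespace TTGeom

set_option linter.unusedSectionVars false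

/-! ### Restriction of scalars. -/

section ModuleMorphisms

variable {K : Type u} [Category.{v} K] [MonoidalCategory K] {A : K} [MonObj A]

lemma hom_comp_id {x y : Mod K A} {f : x ⟶ y} {g : y ⟶ x} (h : f ≫ g = 𝟙 x) :
    f.hom ≫ g.hom = 𝟙 x.X := congr_arg Mod.Hom.hom h

end ModuleMorphisms

section Restriction

variable {K : Type u} [Category.{v} K] [MonoidalCategory K]
  {A B D : K} [MonObj A] [MonObj B] [MonObj D]

/-- Restriction of scalars on objects. -/
def res (f : A ⟶ B) [IsMonHom f] (z : Mod K B) : Mod K A :=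
  mkMod z.X (f ▷ z.X ≫ act z)
    (by rw [← comp_whiskerRight_assoc, IsMonHom.one_hom, one_act])
    (by
      rw [← comp_whiskerRight_assoc, IsMonHom.mul_hom, comp_whiskerRight_assoc, mul_act]
      have h : A ◁ act z ≫ f ▷ z.X = f ▷ (B ⊗ z.X) ≫ B ◁ act z := whisker_exchange _ _
      simp only [MonoidalCategory.whiskerLeft_comp, assoc]
      rw [reassoc_of% h, MonoidalCategory.tensorHom_def']
      simp)

lemma act_res (f : A ⟶ B) [IsMonHom f] (z : Mod K B) : act (res f z) = f ▷ z.X ≫ act z := rfl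

/-- Restriction of scalars on morphisms. -/
def resMap (f : A ⟶ B) [IsMonHom f] {z w : Mod K B} (φ : z ⟶ w) : res f z ⟶ res f w :=
  mkHom (x := res f z) (y := res f w) φ.hom (by
    change (f ▷ z.X ≫ act z) ≫ φ.hom = A ◁ φ.hom ≫ f ▷ w.X ≫ act w
    rw [assoc, act_hom, whisker_exchange_assoc])

/-- Restriction of scalars preserves isomorphisms. -/
def resIso (f : A ⟶ B) [IsMonHom f] {z w : Mod K B} (e : z ≅ w) : res f z ≅ res f w where
  hom := resMap f e.hom
  inv := resMap f e.inv
  hom_inv_id := Mod.hom_ext _ _ (hom_comp_id e.hom_inv_id : e.hom.hom ≫ e.inv.hom = 𝟙 z.X)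
  inv_hom_id := Mod.hom_ext _ _ (hom_comp_id e.inv_hom_id : e.inv.hom ≫ e.hom.hom = 𝟙 w.X)

end Restriction

/-! ### A natural section of the action from the separability idempotent. -/

section NaturalSection

variable {K : Type u} [Category.{v} K] [MonoidalCategory K] {A : K} [MonObj A] [IsSeparableMon A]

variable (A) in
/-- The separability idempotent, as a map `𝟙 ⟶ A ⊗ A`. -/
def sepElement : 𝟙_ K ⟶ A ⊗ A := η ≫ (IsSeparableMon.exists_section (A := A)).choose

/-- The section of the action given by the separability idempotent. -/
def sec (y : Mod K A) : y.X ⟶ A ⊗ y.X :=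
  (λ_ y.X).inv ≫ sepElement A ▷ y.X ≫ (α_ A A y.X).hom ≫ A ◁ act y

@[simp] lemma sec_act (y : Mod K A) : sec y ≫ act y = 𝟙 _ := by
  obtain ⟨h₁, h₂, h₃⟩ := (IsSeparableMon.exists_section (A := A)).choose_spec
  simp only [sec, assoc, sepElement]
  rw [← mul_act, ← comp_whiskerRight_assoc, assoc, h₁, comp_id, one_act]
  simp

lemma act_sec (y : Mod K A) :
    act y ≫ sec y = A ◁ sec y ≫ (α_ A A y.X).inv ≫ μ ▷ y.X := by
  obtain ⟨h₁, h₂, h₃⟩ := (IsSeparableMon.exists_section (A := A)).choose_spec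
  rw [sec, sepElement]
  set σ := (IsSeparableMon.exists_section (A := A)).choose
  -- Both composites are `a ⊗ v ↦ σ(a) v`: `e₁` uses right linearity of `σ`, in the form `σ(1) a =
  -- σ(a)`, and `e₂` uses left linearity.
  have e₁ : act y ≫ (λ_ y.X).inv ≫ (η ≫ σ) ▷ y.X ≫ (α_ A A y.X).hom ≫ A ◁ act y =
      σ ▷ y.X ≫ (α_ A A y.X).hom ≫ A ◁ act y := by
    have h : (λ_ A).inv ≫ (η ≫ σ) ▷ A ≫ (α_ A A A).hom ≫ A ◁ μ = σ := by
      rw [comp_whiskerRight_assoc, h₂, one_mul_assoc]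
      simp
    have h' : A ◁ A ◁ act y ≫ A ◁ act y =
        A ◁ (α_ A A y.X).inv ≫ A ◁ μ ▷ y.X ≫ A ◁ act y := by
      simp only [← MonoidalCategory.whiskerLeft_comp]
      rw [mul_act]
      simp
    conv_rhs => rw [← h]
    rw [leftUnitor_inv_naturality_assoc, whisker_exchange_assoc,
      associator_naturality_right_assoc, h']
    simp
  have e₂ : A ◁ ((λ_ y.X).inv ≫ (η ≫ σ) ▷ y.X ≫ (α_ A A y.X).hom ≫ A ◁ act y) ≫
      (α_ A A y.X).inv ≫ μ ▷ y.X = σ ▷ y.X ≫ (α_ A A y.X).hom ≫ A ◁ act y := by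
    have h : (ρ_ A).inv ≫ A ◁ (η ≫ σ) ≫ (α_ A A A).inv ≫ μ ▷ A = σ := by
      rw [MonoidalCategory.whiskerLeft_comp_assoc, h₃, mul_one_assoc]
      simp
    conv_rhs => rw [← h]
    have h' : A ◁ A ◁ act y ≫ (α_ A A y.X).inv ≫ μ ▷ y.X =
        (α_ A A (A ⊗ y.X)).inv ≫ μ ▷ (A ⊗ y.X) ≫ A ◁ act y := by
      rw [← whisker_exchange]
      simp
    simp only [MonoidalCategory.whiskerLeft_comp, assoc, h']
    simp
  rw [e₁, e₂]

/-- One element `sepElement` serves all modules, so linear maps commute with the sections; this is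
what makes the idempotents of relative tensor products natural. -/
lemma sec_natural {y y' : Mod K A} (φ : y ⟶ y') :
    φ.hom ≫ sec y' = sec y ≫ A ◁ φ.hom := by
  simp only [sec, assoc]
  rw [← MonoidalCategory.whiskerLeft_comp, act_hom, MonoidalCategory.whiskerLeft_comp,
    ← associator_naturality_right_assoc, ← whisker_exchange_assoc, leftUnitor_inv_naturality_assoc]

end NaturalSection

/-! ### The relative tensor product as the image of an idempotent. -/

section RelativeTensor

variable {K : Type u} [Category.{v} K] [MonoidalCategory K] [SymmetricCategory K]
  {A B D : K} [MonObj A] [MonObj B] [MonObj D]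

/-- The right action of `A` on a `B`-module, for a morphism `f : A ⟶ B`. -/
def fract (f : A ⟶ B) (z : Mod K B) : z.X ⊗ A ⟶ z.X := z.X ◁ f ≫ ract z

lemma ract_res (f : A ⟶ B) [IsMonHom f] (z : Mod K B) : ract (res f z) = fract f z := by
  rw [ract, fract, ract, act_res, BraidedCategory.braiding_naturality_right_assoc]
  rfl

@[simp] lemma fract_id (z : Mod K B) : fract (𝟙 B) z = ract z := by simp [fract]

lemma fract_hom (f : A ⟶ B) {x y : Mod K B} (φ : x ⟶ y) :
    fract f x ≫ φ.hom = φ.hom ▷ A ≫ fract f y := by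
  rw [fract, fract, ract, ract, assoc, assoc, act_hom, ← whisker_exchange_assoc,
    BraidedCategory.braiding_naturality_left_assoc]

lemma fract_one (f : A ⟶ B) [IsMonHom f] (z : Mod K B) :
    z.X ◁ η ≫ fract f z = (ρ_ z.X).hom := by
  rw [fract, ← MonoidalCategory.whiskerLeft_comp_assoc, IsMonHom.one_hom, ract_one]

lemma fract_mul [IsCommMonObj B] (f : A ⟶ B) [IsMonHom f] (z : Mod K B) :
    fract f z ▷ A ≫ fract f z = (α_ z.X A A).hom ≫ z.X ◁ μ ≫ fract f z := by
  simp only [fract]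
  rw [← MonoidalCategory.whiskerLeft_comp_assoc, IsMonHom.mul_hom,
    MonoidalCategory.whiskerLeft_comp_assoc, comp_whiskerRight_assoc,
    ← whisker_exchange_assoc, ract_mul, MonoidalCategory.tensorHom_def]
  simp

lemma fract_act [IsCommMonObj B] (f : A ⟶ B) (z : Mod K B) :
    act z ▷ A ≫ fract f z = (α_ B z.X A).hom ≫ B ◁ fract f z ≫ act z := by
  rw [fract, ← whisker_exchange_assoc, ract_act]
  simp

/-- Maps out of `z ⊗ y` which are balanced for the actions of `A` on `z` and on `y`. -/
def IsBalanced (f : A ⟶ B) (z : Mod K B) (y : Mod K A) {T : K} (φ : z.X ⊗ y.X ⟶ T) : Prop :=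
  fract f z ▷ y.X ≫ φ = (α_ z.X A y.X).hom ≫ z.X ◁ act y ≫ φ

lemma IsBalanced.comp {f : A ⟶ B} {z : Mod K B} {y : Mod K A} {T T' : K} {φ : z.X ⊗ y.X ⟶ T}
    (h : IsBalanced f z y φ) (ψ : T ⟶ T') : IsBalanced f z y (φ ≫ ψ) := by
  have h' := h =≫ ψ
  simpa only [IsBalanced, assoc] using h'

variable [IsSeparableMon A] (f : A ⟶ B)

/-- The idempotent of `z ⊗ y` whose image is `z ⊗_A y`. -/
def balancing (z : Mod K B) (y : Mod K A) : z.X ⊗ y.X ⟶ z.X ⊗ y.X :=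
  z.X ◁ sec y ≫ (α_ z.X A y.X).inv ≫ fract f z ▷ y.X

variable {f} in
-- A balanced map lets the scalar split off by `sec` return to `y`, where `sec_act` cancels it.
-- Together with `isBalanced_balancing` this makes `balancing` the idempotent onto the universal
-- balanced quotient.
lemma IsBalanced.balancing_comp {z : Mod K B} {y : Mod K A} {T : K} {φ : z.X ⊗ y.X ⟶ T}
    (h : IsBalanced f z y φ) : balancing f z y ≫ φ = φ := by
  rw [balancing, assoc, assoc, h, Iso.inv_hom_id_assoc,
    ← MonoidalCategory.whiskerLeft_comp_assoc, sec_act]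
  simp

lemma balancing_natural_right (z : Mod K B) {y y' : Mod K A} (φ : y ⟶ y') :
    z.X ◁ φ.hom ≫ balancing f z y' = balancing f z y ≫ z.X ◁ φ.hom := by
  simp only [balancing, assoc]
  rw [← MonoidalCategory.whiskerLeft_comp_assoc, sec_natural,
    MonoidalCategory.whiskerLeft_comp_assoc, associator_inv_naturality_right_assoc,
    whisker_exchange]

lemma balancing_natural_left {z z' : Mod K B} (φ : z ⟶ z') (y : Mod K A) :
    φ.hom ▷ y.X ≫ balancing f z' y = balancing f z y ≫ φ.hom ▷ y.X := by
  simp only [balancing, assoc]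
  rw [← whisker_exchange_assoc, associator_inv_naturality_left_assoc, ← comp_whiskerRight,
    ← comp_whiskerRight, fract_hom]

variable [IsCommMonObj B] [IsMonHom f]

/-- Linearity of `sec` turns a scalar acting on `y` into a left factor of the separability element,
and this factor is then absorbed by the action on `z`. -/
lemma isBalanced_balancing (z : Mod K B) (y : Mod K A) :
    IsBalanced f z y (balancing f z y) := by
  have e₁ : z.X ◁ act y ≫ z.X ◁ sec y = z.X ◁ A ◁ sec y ≫ z.X ◁ (α_ A A y.X).inv ≫
      z.X ◁ μ ▷ y.X := by
    simp only [← MonoidalCategory.whiskerLeft_comp, act_sec]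
  simp only [IsBalanced, balancing]
  rw [← whisker_exchange_assoc, associator_inv_naturality_left_assoc, ← comp_whiskerRight,
    fract_mul, reassoc_of% e₁]
  simp

lemma balancing_idem (z : Mod K B) (y : Mod K A) :
    balancing f z y ≫ balancing f z y = balancing f z y :=
  (isBalanced_balancing f z y).balancing_comp

lemma balancing_linear (z : Mod K B) (y : Mod K A) :
    ((α_ B z.X y.X).inv ≫ act z ▷ y.X) ≫ balancing f z y =
      B ◁ balancing f z y ≫ (α_ B z.X y.X).inv ≫ act z ▷ y.X := by
  rw [balancing, assoc, ← whisker_exchange_assoc, associator_inv_naturality_left_assoc,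
    ← comp_whiskerRight, fract_act]
  simp

/-- The module `x ⊗ k`, with `B` acting on `x`. -/
def tens (x : Mod K B) (k : K) : Mod K B := (tensorExtScalars x k).obj

variable [IsIdempotentComplete K]

/-- The idempotent is `B`-linear, so when it splits in the underlying category its image inherits
the action of `B`, with linear inclusion and projection. -/
lemma exists_relTensor (z : Mod K B) (y : Mod K A) :
    ∃ (m : Mod K B) (i : m.X ⟶ z.X ⊗ y.X) (p : z.X ⊗ y.X ⟶ m.X), i ≫ p = 𝟙 m.X ∧
      p ≫ i = balancing f z y ∧ ((α_ B z.X y.X).inv ≫ act z ▷ y.X) ≫ p = B ◁ p ≫ act m ∧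
      act m ≫ i = B ◁ i ≫ (α_ B z.X y.X).inv ≫ act z ▷ y.X := by
  obtain ⟨Z, i, p, hip, hpi⟩ :=
    IsIdempotentComplete.idempotents_split _ _ (balancing_idem f z y)
  have he := balancing_linear f z y
  generalize balancing f z y = e at *
  have hp : e ≫ p = p := by rw [← hpi, assoc, hip, comp_id]
  have hi : i ≫ e = i := by rw [← hpi, reassoc_of% hip]
  have he' {T : K} (q : z.X ⊗ y.X ⟶ T) : B ◁ e ≫ ((α_ B z.X y.X).inv ≫ act z ▷ y.X) ≫ q =
      ((α_ B z.X y.X).inv ≫ act z ▷ y.X) ≫ e ≫ q := by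
    rw [← assoc _ e, he]
    simp only [assoc]
  have hl : B ◁ p ≫ B ◁ i ≫ ((α_ B z.X y.X).inv ≫ act z ▷ y.X) ≫ p =
      ((α_ B z.X y.X).inv ≫ act z ▷ y.X) ≫ p := by
    rw [← MonoidalCategory.whiskerLeft_comp_assoc, hpi, he', hp]
  have h₁ : η ▷ (z.X ⊗ y.X) ≫ (α_ B z.X y.X).inv ≫ act z ▷ y.X = (λ_ (z.X ⊗ y.X)).hom :=
    one_act (tens z y.X)
  have h₂ := mul_act (tens z y.X)
  change μ ▷ (z.X ⊗ y.X) ≫ (α_ B z.X y.X).inv ≫ act z ▷ y.X = (α_ B B (z.X ⊗ y.X)).hom ≫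
    B ◁ ((α_ B z.X y.X).inv ≫ act z ▷ y.X) ≫ (α_ B z.X y.X).inv ≫ act z ▷ y.X at h₂
  generalize (α_ B z.X y.X).inv ≫ act z ▷ y.X = ρ at *
  refine ⟨mkMod Z (B ◁ i ≫ ρ ≫ p) ?_ ?_, i, p, hip, hpi, hl.symm, ?_⟩
  · rw [← whisker_exchange_assoc, reassoc_of% h₁]
    simp [hip]
  · rw [← whisker_exchange_assoc, reassoc_of% h₂]
    simp only [MonoidalCategory.whiskerLeft_comp, assoc, hl]
    simp
  · change (B ◁ i ≫ ρ ≫ p) ≫ i = B ◁ i ≫ ρ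
    rw [assoc, assoc, hpi, he, ← MonoidalCategory.whiskerLeft_comp_assoc, hi]

/-- The `B`-module `z ⊗_A y`, for a `B`-module `z` and an `A`-module `y`. -/
def relTensor (z : Mod K B) (y : Mod K A) : Mod K B := (exists_relTensor f z y).choose

/-- The inclusion of `z ⊗_A y` into `z ⊗ y`. -/
def relι (z : Mod K B) (y : Mod K A) : (relTensor f z y).X ⟶ z.X ⊗ y.X :=
  (exists_relTensor f z y).choose_spec.choose

/-- The projection of `z ⊗ y` onto `z ⊗_A y`. -/
def relπ (z : Mod K B) (y : Mod K A) : z.X ⊗ y.X ⟶ (relTensor f z y).X :=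
  (exists_relTensor f z y).choose_spec.choose_spec.choose

@[simp] lemma relι_relπ (z : Mod K B) (y : Mod K A) :
    relι f z y ≫ relπ f z y = 𝟙 _ :=
  (exists_relTensor f z y).choose_spec.choose_spec.choose_spec.1

lemma relπ_relι (z : Mod K B) (y : Mod K A) :
    relπ f z y ≫ relι f z y = balancing f z y :=
  (exists_relTensor f z y).choose_spec.choose_spec.choose_spec.2.1

lemma relπ_relι_assoc (z : Mod K B) (y : Mod K A) {T : K} (φ : z.X ⊗ y.X ⟶ T) :
    relπ f z y ≫ relι f z y ≫ φ = balancing f z y ≫ φ := by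
  rw [← assoc, relπ_relι]

lemma relπ_linear (z : Mod K B) (y : Mod K A) :
    (α_ B z.X y.X).inv ≫ act z ▷ y.X ≫ relπ f z y = B ◁ relπ f z y ≫ act (relTensor f z y) := by
  rw [← assoc]
  exact (exists_relTensor f z y).choose_spec.choose_spec.choose_spec.2.2.1

lemma relι_linear (z : Mod K B) (y : Mod K A) :
    act (relTensor f z y) ≫ relι f z y = B ◁ relι f z y ≫ (α_ B z.X y.X).inv ≫ act z ▷ y.X :=
  (exists_relTensor f z y).choose_spec.choose_spec.choose_spec.2.2.2

lemma balancing_relπ (z : Mod K B) (y : Mod K A) :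
    balancing f z y ≫ relπ f z y = relπ f z y := by
  rw [← relπ_relι, assoc, relι_relπ, comp_id]

lemma isBalanced_relπ (z : Mod K B) (y : Mod K A) : IsBalanced f z y (relπ f z y) := by
  rw [← balancing_relπ]
  exact (isBalanced_balancing _ _ _).comp _

instance (z : Mod K B) (y : Mod K A) : IsSplitEpi (relπ f z y) := ⟨⟨_, relι_relπ f z y⟩⟩

variable {f} in
lemma IsBalanced.relπ_relι_comp {z : Mod K B} {y : Mod K A} {T : K}
    {φ : z.X ⊗ y.X ⟶ T} (h : IsBalanced f z y φ) : relπ f z y ≫ relι f z y ≫ φ = φ := by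
  rw [relπ_relι_assoc]
  exact h.balancing_comp

/-- The functor `z ⊗_A -`. -/
def relFunctor (z : Mod K B) : Mod K A ⥤ Mod K B where
  obj y := relTensor f z y
  map {y y'} φ := mkHom (relι f z y ≫ z.X ◁ φ.hom ≫ relπ f z y') (by
    rw [reassoc_of% (@relι_linear), ← whisker_exchange_assoc]
    simp only [MonoidalCategory.whiskerLeft_comp, assoc]
    rw [← relπ_linear]
    simp)
  map_id y := Mod.hom_ext _ _ (by
    change relι f z y ≫ z.X ◁ 𝟙 y.X ≫ relπ f z y = 𝟙 _
    simp)
  map_comp {y y' y''} φ ψ := Mod.hom_ext _ _ (by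
    change relι f z y ≫ z.X ◁ (φ.hom ≫ ψ.hom) ≫ relπ f z y'' =
      (relι f z y ≫ z.X ◁ φ.hom ≫ relπ f z y') ≫ relι f z y' ≫ z.X ◁ ψ.hom ≫ relπ f z y''
    simp only [assoc, relπ_relι_assoc]
    rw [← reassoc_of% (@balancing_natural_right), balancing_relπ]
    simp)

/-- The functor `- ⊗_A y`. -/
def relFunctorLeft (y : Mod K A) : Mod K B ⥤ Mod K B where
  obj z := relTensor f z y
  map {z z'} φ := mkHom (relι f z y ≫ φ.hom ▷ y.X ≫ relπ f z' y) (by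
    rw [reassoc_of% (@relι_linear), ← comp_whiskerRight_assoc, act_hom]
    simp only [MonoidalCategory.whiskerLeft_comp, assoc]
    rw [← relπ_linear]
    simp)
  map_id z := Mod.hom_ext _ _ (by
    change relι f z y ≫ 𝟙 z.X ▷ y.X ≫ relπ f z y = 𝟙 _
    simp)
  map_comp {z z' z''} φ ψ := Mod.hom_ext _ _ (by
    change relι f z y ≫ (φ.hom ≫ ψ.hom) ▷ y.X ≫ relπ f z'' y =
      (relι f z y ≫ φ.hom ▷ y.X ≫ relπ f z' y) ≫ relι f z' y ≫ ψ.hom ▷ y.X ≫ relπ f z'' y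
    simp only [assoc, relπ_relι_assoc]
    rw [← reassoc_of% (@balancing_natural_left), balancing_relπ]
    simp)

/-- Extension of scalars along `f`. -/
def ext (y : Mod K A) : Mod K B := relTensor f (Mod.regular B) y

end RelativeTensor

/-! ### Unit, symmetry and associativity of the relative tensor product. -/

section RelativeTensorIsos

variable {K : Type u} [Category.{v} K] [MonoidalCategory K] [SymmetricCategory K]
  {A B D : K} [MonObj A] [MonObj B] [MonObj D] [IsSeparableMon A] [IsCommMonObj B]
  [IsIdempotentComplete K] (f : A ⟶ B) [IsMonHom f]

/-- A balanced isomorphism out of a tensor product: universal maps with linear sections. -/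
def relIsoOf (z : Mod K B) (y : Mod K A) (m : Mod K B) (φ : z.X ⊗ y.X ⟶ m.X)
    (hφ : IsBalanced f z y φ) (ψ : m.X ⟶ z.X ⊗ y.X) (hψ : ψ ≫ φ = 𝟙 _)
    (h : φ ≫ ψ ≫ relπ f z y = relπ f z y)
    (hl : (α_ B z.X y.X).inv ≫ act z ▷ y.X ≫ φ = B ◁ φ ≫ act m) : relTensor f z y ≅ m :=
  mkIso
    { hom := relι f z y ≫ φ
      inv := ψ ≫ relπ f z y
      hom_inv_id := by rw [assoc, h, relι_relπ]
      inv_hom_id := by rw [assoc, hφ.relπ_relι_comp, hψ] }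
    (by
      change act _ ≫ relι f z y ≫ φ = B ◁ (relι f z y ≫ φ) ≫ act m
      rw [reassoc_of% (@relι_linear), hl, MonoidalCategory.whiskerLeft_comp_assoc])

/-- The regular module is a right unit. -/
def relRegular (z : Mod K B) : relTensor f z (Mod.regular A) ≅ z :=
  relIsoOf f z (Mod.regular A) z (fract f z) (fract_mul f z)
    ((ρ_ z.X).inv ≫ z.X ◁ (η : 𝟙_ K ⟶ A))
    (by
      change ((ρ_ z.X).inv ≫ z.X ◁ (η : 𝟙_ K ⟶ A)) ≫ fract f z = 𝟙 z.X
      rw [assoc, fract_one, Iso.inv_hom_id])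
    (by
      have key {T : K} (φ : z.X ⊗ A ⟶ T)
          (h : fract f z ▷ A ≫ φ = (α_ z.X A A).hom ≫ z.X ◁ μ ≫ φ) :
          fract f z ≫ ((ρ_ z.X).inv ≫ z.X ◁ η) ≫ φ = φ := by
        rw [assoc, rightUnitor_inv_naturality_assoc, ← whisker_exchange_assoc, h,
          associator_naturality_right_assoc, ← MonoidalCategory.whiskerLeft_comp_assoc,
          MonObj.mul_one]
        simp
      exact key _ (isBalanced_relπ f z (Mod.regular A)))
    (by
      change (α_ B z.X A).inv ≫ act z ▷ A ≫ fract f z = B ◁ fract f z ≫ act z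
      rw [fract_act, Iso.inv_hom_id_assoc])

/-- The projection formula for free modules. -/
def relFree [IsCommMonObj A] (z : Mod K B) (k : K) :
    relTensor f z ((extScalars A).obj k) ≅ tens z k :=
  relIsoOf f z ((extScalars A).obj k) (tens z k) ((α_ z.X A k).inv ≫ fract f z ▷ k)
    (by
      change fract f z ▷ (A ⊗ k) ≫ (α_ z.X A k).inv ≫ fract f z ▷ k =
        (α_ z.X A (A ⊗ k)).hom ≫ z.X ◁ ((α_ A A k).inv ≫ μ ▷ k) ≫
          (α_ z.X A k).inv ≫ fract f z ▷ k
      rw [associator_inv_naturality_left_assoc, ← comp_whiskerRight, fract_mul]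
      simp)
    (z.X ◁ ((λ_ k).inv ≫ (η : 𝟙_ K ⟶ A) ▷ k))
    (by
      change z.X ◁ ((λ_ k).inv ≫ η ▷ k) ≫ (α_ z.X A k).inv ≫ fract f z ▷ k = 𝟙 (z.X ⊗ k)
      rw [MonoidalCategory.whiskerLeft_comp, assoc, associator_inv_naturality_middle_assoc,
        ← comp_whiskerRight, fract_one]
      simp)
    (by
      have h' : A ◁ ((λ_ k).inv ≫ η ▷ k) ≫ (α_ A A k).inv ≫ μ ▷ k = 𝟙 _ := by
        rw [MonoidalCategory.whiskerLeft_comp, assoc, associator_inv_naturality_middle_assoc,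
          ← comp_whiskerRight, MonObj.mul_one]
        simp
      have key {T : K} (φ : z.X ⊗ (A ⊗ k) ⟶ T) (h : fract f z ▷ (A ⊗ k) ≫ φ =
          (α_ z.X A (A ⊗ k)).hom ≫ z.X ◁ ((α_ A A k).inv ≫ μ ▷ k) ≫ φ) :
          ((α_ z.X A k).inv ≫ fract f z ▷ k) ≫ z.X ◁ ((λ_ k).inv ≫ η ▷ k) ≫ φ = φ := by
        rw [assoc, ← whisker_exchange_assoc, h, associator_naturality_right_assoc,
          ← MonoidalCategory.whiskerLeft_comp_assoc, h']
        simp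
      exact key _ (isBalanced_relπ f z ((extScalars A).obj k)))
    (by
      change (α_ B z.X (A ⊗ k)).inv ≫ act z ▷ (A ⊗ k) ≫ (α_ z.X A k).inv ≫ fract f z ▷ k =
        B ◁ ((α_ z.X A k).inv ≫ fract f z ▷ k) ≫ (α_ B z.X k).inv ≫ act z ▷ k
      rw [associator_inv_naturality_left_assoc, ← comp_whiskerRight, fract_act]
      simp)

/-- `relTensor` over the identity is a tensor product over `B`. -/
def relTensorOver [IsSeparableMon B] (z w : Mod K B) : TensorOver z w where
  obj := relTensor (𝟙 B) z w
  π := relπ (𝟙 B) z w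
  condition := by
    have h := isBalanced_relπ (𝟙 B) z w
    rw [IsBalanced, fract_id] at h
    rw [h, assoc]
  isColimit := isColimitOfSection _ _ (relι (𝟙 B) z w) (relι_relπ _ _ _) (fun T φ h => by
    have h' : IsBalanced (𝟙 B) z w φ := by rw [IsBalanced, fract_id, h, assoc]
    exact h'.relπ_relι_comp)
  linear := relπ_linear _ _ _

lemma nonempty_tensorOver_iso [IsSeparableMon B] (z w : Mod K B) :
    Nonempty (relTensor (𝟙 B) z w ≅ tensorOver B z w) :=
  (relTensorOver z w).nonempty_iso_tensorOver

lemma isBalanced_res_iff (z : Mod K B) (y : Mod K A) {T : K} (φ : z.X ⊗ y.X ⟶ T) :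
    IsBalanced (𝟙 A) (res f z) y φ ↔ IsBalanced f z y φ := by
  have e : (fract (𝟙 A) (res f z) : z.X ⊗ A ⟶ z.X) = fract f z := by
    rw [fract_id]
    exact ract_res f z
  change (fract (𝟙 A) (res f z) : z.X ⊗ A ⟶ z.X) ▷ y.X ≫ φ = _ ↔ _
  rw [e]
  rfl

/-- The relative tensor product restricted to `A`. -/
def resRelTensor [IsCommMonObj A] (z : Mod K B) (y : Mod K A) :
    relTensor (𝟙 A) (res f z) y ≅ res f (relTensor f z y) :=
  relIsoOf (𝟙 A) (res f z) y (res f (relTensor f z y)) (relπ f z y)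
    ((isBalanced_res_iff f z y _).2 (isBalanced_relπ f z y))
    (relι f z y) (relι_relπ f z y)
    (((isBalanced_res_iff f z y _).1 (isBalanced_relπ (𝟙 A) (res f z) y)).relπ_relι_comp)
    (by
      change (α_ A z.X y.X).inv ≫ (f ▷ z.X ≫ act z) ▷ y.X ≫ relπ f z y =
        A ◁ relπ f z y ≫ f ▷ _ ≫ act (relTensor f z y)
      rw [whisker_exchange_assoc, ← relπ_linear]
      simp)

/-- The symmetry of the tensor product over `B`. -/
lemma nonempty_relTensor_swap [IsSeparableMon B] (z w : Mod K B) :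
    Nonempty (relTensor (𝟙 B) z w ≅ relTensor (𝟙 B) w z) := by
  have h (z w : Mod K B) : IsBalanced (𝟙 B) z w ((β_ z.X w.X).hom ≫ relπ (𝟙 B) w z) := by
    have h := isBalanced_relπ (𝟙 B) w z
    rw [IsBalanced, fract_id] at h ⊢
    have e : z.X ◁ act w = z.X ◁ (β_ B w.X).hom ≫ z.X ◁ ract w := by
      rw [← MonoidalCategory.whiskerLeft_comp, ract, SymmetricCategory.symmetry_assoc]
    rw [BraidedCategory.braiding_naturality_left_assoc, e, assoc,
      BraidedCategory.braiding_naturality_right_assoc, h, ract,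
      BraidedCategory.braiding_tensor_left_hom, BraidedCategory.braiding_tensor_right_hom]
    simp
  refine ⟨relIsoOf (𝟙 B) z w _ _ (h z w) (relι _ w z ≫ (β_ w.X z.X).hom) ?_ ?_ ?_⟩
  · simp
  · rw [assoc, assoc, (h w z).relπ_relι_comp, SymmetricCategory.symmetry_assoc]
  · have e := isBalanced_relπ (𝟙 B) w z
    rw [IsBalanced, fract_id] at e
    have e' := relπ_linear (𝟙 B) w z
    rw [BraidedCategory.braiding_naturality_left_assoc, ← cancel_epi (α_ B z.X w.X).hom]
    rw [MonoidalCategory.whiskerLeft_comp_assoc, ← e']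
    have e₂ : w.X ◁ act z ≫ relπ (𝟙 B) w z = (α_ w.X B z.X).inv ≫
        (β_ w.X B).hom ▷ z.X ≫ act w ▷ z.X ≫ relπ (𝟙 B) w z := by
      rw [← cancel_epi (α_ w.X B z.X).hom, ← e, ract]
      simp
    rw [e₂, BraidedCategory.braiding_tensor_left_hom]
    simp only [assoc, Iso.hom_inv_id_assoc]
    rw [← comp_whiskerRight_assoc, SymmetricCategory.symmetry]
    simp

section

variable [IsCommMonObj D] (h : B ⟶ D) [IsMonHom h] [IsSeparableMon B]

/-- On `z ⊗_B w` a scalar of `B` may act through either factor. So `A`, which acts through `f ≫ h`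
on the whole, may act through `f` on `w` alone. The remaining steps move this scalar through the
braidings. -/
lemma fract_relTensor (z : Mod K D) (w : Mod K B) :
    relπ h z w ▷ A ≫ fract (f ≫ h) (relTensor h z w) =
      (α_ z.X w.X A).hom ≫ z.X ◁ fract f w ≫ relπ h z w := by
  have e := relπ_linear h z w
  have e' := isBalanced_relπ h z w
  rw [IsBalanced] at e'
  have b {k l : K} (g : k ⟶ l) : z.X ◁ w.X ◁ g ≫ z.X ◁ (β_ w.X l).hom =
      z.X ◁ (β_ w.X k).hom ≫ z.X ◁ g ▷ w.X := by
    simp only [← MonoidalCategory.whiskerLeft_comp, BraidedCategory.braiding_naturality_right]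
  have e₂ : relπ h z w ▷ D ≫ ract (relTensor h z w) = (α_ z.X w.X D).hom ≫
      z.X ◁ (β_ w.X D).hom ≫ (α_ z.X D w.X).inv ≫ ract z ▷ w.X ≫ relπ h z w := by
    rw [ract, BraidedCategory.braiding_naturality_left_assoc, ← e,
      BraidedCategory.braiding_tensor_left_hom, ract]
    simp
  have e₄ : z.X ◁ fract f w ≫ relπ h z w = z.X ◁ w.X ◁ f ≫ z.X ◁ (β_ w.X B).hom ≫
      (α_ z.X B w.X).inv ≫ fract h z ▷ w.X ≫ relπ h z w := by
    rw [e', Iso.inv_hom_id_assoc, fract, ract]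
    simp only [MonoidalCategory.whiskerLeft_comp, assoc]
  rw [e₄, fract, ← whisker_exchange_assoc, e₂, fract]
  simp only [comp_whiskerRight, assoc, MonoidalCategory.whiskerLeft_comp]
  rw [associator_naturality_right_assoc, associator_naturality_right_assoc, reassoc_of% b,
    reassoc_of% b, reassoc_of% b, ← associator_inv_naturality_middle_assoc]

/-- Maps out of `z ⊗ (w ⊗ y)` which are balanced over `B` in `z`, `w` and over `A` in `w`, `y`. -/
structure IsBibalanced (z : Mod K D) (w : Mod K B) (y : Mod K A) {T : K}
    (φ : z.X ⊗ (w.X ⊗ y.X) ⟶ T) : Prop where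
  left : fract h z ▷ (w.X ⊗ y.X) ≫ φ =
    (α_ z.X B (w.X ⊗ y.X)).hom ≫ z.X ◁ ((α_ B w.X y.X).inv ≫ act w ▷ y.X) ≫ φ
  right : z.X ◁ (fract f w ▷ y.X) ≫ φ = z.X ◁ ((α_ w.X A y.X).hom ≫ w.X ◁ act y) ≫ φ

variable {f h} {z : Mod K D} {w : Mod K B} {y : Mod K A} {T : K} {φ : z.X ⊗ (w.X ⊗ y.X) ⟶ T}

lemma IsBibalanced.right_comp (H : IsBibalanced f h z w y φ) :
    z.X ◁ balancing f w y ≫ φ = φ := by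
  have e : z.X ◁ w.X ◁ sec y ≫ z.X ◁ w.X ◁ act y = 𝟙 _ := by
    simp only [← MonoidalCategory.whiskerLeft_comp, sec_act, MonoidalCategory.whiskerLeft_id]
  rw [balancing]
  simp only [MonoidalCategory.whiskerLeft_comp, assoc]
  rw [H.right]
  simp [reassoc_of% e]

lemma IsBibalanced.left_comp (H : IsBibalanced f h z w y φ) :
    balancing h z w ▷ y.X ≫ (α_ z.X w.X y.X).hom ≫ φ = (α_ z.X w.X y.X).hom ≫ φ := by
  have e : z.X ◁ sec w ▷ y.X ≫ z.X ◁ act w ▷ y.X = 𝟙 _ := by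
    rw [← MonoidalCategory.whiskerLeft_comp, ← comp_whiskerRight, sec_act]
    simp
  have e' := H.left
  rw [balancing]
  simp only [comp_whiskerRight, assoc]
  rw [associator_naturality_left_assoc, e']
  simp only [MonoidalCategory.whiskerLeft_comp, assoc, whisker_assoc]
  rw [← cancel_epi (α_ z.X w.X y.X).inv]
  simp [reassoc_of% e]

/-- Bibalanced maps factor through `z ⊗_B (w ⊗_A y)`; `IsBibalanced.comp_right` is the same for `(z
⊗_B w) ⊗_A y`. Both iterated products thus have one universal property, which gives associativity.
-/
lemma IsBibalanced.comp_left (H : IsBibalanced f h z w y φ) :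
    (z.X ◁ relπ f w y ≫ relπ h z (relTensor f w y)) ≫
      (relι h z (relTensor f w y) ≫ z.X ◁ relι f w y) ≫ φ = φ := by
  have e : IsBalanced h z (relTensor f w y) (z.X ◁ relι f w y ≫ φ) := by
    rw [IsBalanced, ← whisker_exchange_assoc, H.left,
      ← MonoidalCategory.whiskerLeft_comp_assoc, relι_linear]
    simp
  simp only [assoc]
  rw [e.relπ_relι_comp, ← MonoidalCategory.whiskerLeft_comp_assoc, relπ_relι, H.right_comp]

lemma IsBibalanced.comp_right (H : IsBibalanced f h z w y φ) :
    (relπ h z w ▷ y.X ≫ relπ (f ≫ h) (relTensor h z w) y) ≫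
      (relι (f ≫ h) (relTensor h z w) y ≫ relι h z w ▷ y.X) ≫ (α_ z.X w.X y.X).hom ≫ φ =
        (α_ z.X w.X y.X).hom ≫ φ := by
  have e' := H.right
  -- The action of `A` on `z ⊗_B w` is known only after projecting from `z ⊗ w`. The projection
  -- stays a split epimorphism after tensoring, so balancedness may be tested there.
  have : IsSplitEpi (relπ h z w ▷ A ▷ y.X) :=
    inferInstanceAs (IsSplitEpi ((tensorRight A ⋙ tensorRight y.X).map (relπ h z w)))
  have e : IsBalanced (f ≫ h) (relTensor h z w) y
      (relι h z w ▷ y.X ≫ (α_ z.X w.X y.X).hom ≫ φ) := by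
    rw [IsBalanced, ← cancel_epi (relπ h z w ▷ A ▷ y.X), ← comp_whiskerRight_assoc,
      fract_relTensor, associator_naturality_left_assoc, ← whisker_exchange_assoc,
      ← comp_whiskerRight_assoc, ← comp_whiskerRight_assoc, relπ_relι, assoc, assoc, relπ_relι,
      H.left_comp]
    simp only [comp_whiskerRight, assoc]
    rw [H.left_comp]
    simp [e']
  simp only [assoc]
  rw [e.relπ_relι_comp, ← comp_whiskerRight_assoc, relπ_relι, H.left_comp]

variable (f h z w y)

lemma isBibalanced_left :
    IsBibalanced f h z w y (z.X ◁ relπ f w y ≫ relπ h z (relTensor f w y)) where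
  left := by
    have e := isBalanced_relπ h z (relTensor f w y)
    rw [IsBalanced] at e
    rw [← whisker_exchange_assoc, e, associator_naturality_right_assoc,
      ← MonoidalCategory.whiskerLeft_comp_assoc, ← relπ_linear]
    simp
  right := by
    simp only [← MonoidalCategory.whiskerLeft_comp_assoc]
    rw [isBalanced_relπ f w y, assoc]

lemma isBibalanced_right :
    IsBibalanced f h z w y
      ((α_ z.X w.X y.X).inv ≫ relπ h z w ▷ y.X ≫ relπ (f ≫ h) (relTensor h z w) y) where
  left := by
    have e := isBalanced_relπ h z w
    rw [IsBalanced] at e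
    rw [associator_inv_naturality_left_assoc, ← comp_whiskerRight_assoc, e]
    simp
  right := by
    have e := isBalanced_relπ (f ≫ h) (relTensor h z w) y
    rw [IsBalanced] at e
    have e₁ : z.X ◁ (fract f w ▷ y.X) ≫ (α_ z.X w.X y.X).inv ≫ relπ h z w ▷ y.X =
        (α_ z.X (w.X ⊗ A) y.X).inv ≫ ((α_ z.X w.X A).inv ≫ relπ h z w ▷ A ≫
          fract (f ≫ h) (relTensor h z w)) ▷ y.X := by
      rw [fract_relTensor]
      simp
    rw [reassoc_of% e₁]
    simp only [comp_whiskerRight, assoc]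
    rw [e, associator_naturality_left_assoc, ← whisker_exchange_assoc]
    simp

/-- Associativity of the relative tensor product. -/
def relAssoc : relTensor h z (relTensor f w y) ≅ relTensor (f ≫ h) (relTensor h z w) y :=
  mkIso
    { hom := (relι h z (relTensor f w y) ≫ z.X ◁ relι f w y) ≫ (α_ z.X w.X y.X).inv ≫
        relπ h z w ▷ y.X ≫ relπ (f ≫ h) (relTensor h z w) y
      inv := (relι (f ≫ h) (relTensor h z w) y ≫ relι h z w ▷ y.X) ≫ (α_ z.X w.X y.X).hom ≫
        z.X ◁ relπ f w y ≫ relπ h z (relTensor f w y)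
      hom_inv_id := by
        -- Each iterated projection is bibalanced, so it factors through the projection onto the
        -- other product; the two factorizations are mutually inverse.
        have e := (isBibalanced_left f h z w y).comp_right
        simp only [assoc] at e ⊢
        rw [e, Iso.inv_hom_id_assoc, ← MonoidalCategory.whiskerLeft_comp_assoc, relι_relπ]
        simp
      inv_hom_id := by
        have e := (isBibalanced_right f h z w y).comp_left
        simp only [assoc] at e ⊢
        rw [e, Iso.hom_inv_id_assoc, ← comp_whiskerRight_assoc, relι_relπ]
        simp }
    (by
      change act _ ≫ (relι h z (relTensor f w y) ≫ z.X ◁ relι f w y) ≫ (α_ z.X w.X y.X).inv ≫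
        relπ h z w ▷ y.X ≫ relπ (f ≫ h) (relTensor h z w) y = D ◁ ((relι h z (relTensor f w y) ≫
        z.X ◁ relι f w y) ≫ (α_ z.X w.X y.X).inv ≫ relπ h z w ▷ y.X ≫
        relπ (f ≫ h) (relTensor h z w) y) ≫ act _
      simp only [MonoidalCategory.whiskerLeft_comp, assoc]
      rw [reassoc_of% (@relι_linear), ← relπ_linear, ← whisker_exchange_assoc,
        associator_inv_naturality_left_assoc, ← comp_whiskerRight_assoc,
        associator_inv_naturality_middle_assoc, ← comp_whiskerRight_assoc, ← relπ_linear]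
      simp)

end

end RelativeTensorIsos

/-! ### Retracts of extended modules, and extension along the unit. -/

section RelativeTensorRetracts

variable {K : Type u} [Category.{v} K] [MonoidalCategory K] [SymmetricCategory K]
  {A B : K} [MonObj A] [MonObj B] [IsSeparableMon A] [IsCommMonObj B]
  [IsIdempotentComplete K] (f : A ⟶ B) [IsMonHom f]

/-- `z ⊗_A -` commutes with tensoring with objects of `K`. -/
def relTens [IsCommMonObj A] (z : Mod K B) (y : Mod K A) (k : K) :
    relTensor f z (tens y k) ≅ tens (relTensor f z y) k :=
  relIsoOf f z (tens y k) (tens (relTensor f z y) k) ((α_ z.X y.X k).inv ≫ relπ f z y ▷ k)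
    (by
      have e := isBalanced_relπ f z y
      rw [IsBalanced] at e
      change fract f z ▷ (y.X ⊗ k) ≫ (α_ z.X y.X k).inv ≫ relπ f z y ▷ k =
        (α_ z.X A (y.X ⊗ k)).hom ≫ z.X ◁ ((α_ A y.X k).inv ≫ act y ▷ k) ≫
          (α_ z.X y.X k).inv ≫ relπ f z y ▷ k
      rw [associator_inv_naturality_left_assoc, ← comp_whiskerRight, e]
      simp)
    (relι f z y ▷ k ≫ (α_ z.X y.X k).hom)
    (by
      change (relι f z y ▷ k ≫ (α_ z.X y.X k).hom) ≫ (α_ z.X y.X k).inv ≫ relπ f z y ▷ k =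
        𝟙 ((relTensor f z y).X ⊗ k)
      rw [assoc, Iso.hom_inv_id_assoc, ← comp_whiskerRight, relι_relπ]
      simp)
    (by
      have e : z.X ◁ sec y ▷ k ≫ z.X ◁ act y ▷ k = 𝟙 _ := by
        rw [← MonoidalCategory.whiskerLeft_comp, ← comp_whiskerRight, sec_act]
        simp
      have key {T : K} (φ : z.X ⊗ (y.X ⊗ k) ⟶ T) (h : fract f z ▷ (y.X ⊗ k) ≫ φ =
          (α_ z.X A (y.X ⊗ k)).hom ≫ z.X ◁ ((α_ A y.X k).inv ≫ act y ▷ k) ≫ φ) :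
          ((α_ z.X y.X k).inv ≫ relπ f z y ▷ k) ≫ (relι f z y ▷ k ≫ (α_ z.X y.X k).hom) ≫ φ =
            φ := by
        simp only [assoc]
        rw [← comp_whiskerRight_assoc, relπ_relι, balancing]
        simp only [comp_whiskerRight, assoc]
        rw [associator_naturality_left_assoc, h]
        simp [reassoc_of% e]
      exact key _ (isBalanced_relπ f z (tens y k)))
    (by
      change (α_ B z.X (y.X ⊗ k)).inv ≫ act z ▷ (y.X ⊗ k) ≫ (α_ z.X y.X k).inv ≫
        relπ f z y ▷ k = B ◁ ((α_ z.X y.X k).inv ≫ relπ f z y ▷ k) ≫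
          (α_ B (relTensor f z y).X k).inv ≫ act (relTensor f z y) ▷ k
      rw [associator_inv_naturality_left_assoc, ← comp_whiskerRight,
        MonoidalCategory.whiskerLeft_comp_assoc, associator_inv_naturality_middle_assoc,
        ← comp_whiskerRight, ← relπ_linear]
      simp)

/-- Linear retracts of `z ⊗ k`, one of which absorbs the idempotent of the other. -/
def retractOfTens {z m m' : Mod K B} {k : K} {i : m.X ⟶ z.X ⊗ k} {p : z.X ⊗ k ⟶ m.X}
    {i' : m'.X ⟶ z.X ⊗ k} {p' : z.X ⊗ k ⟶ m'.X} (hip : i ≫ p = 𝟙 _)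
    (hi : act m ≫ i = B ◁ i ≫ (α_ B z.X k).inv ≫ act z ▷ k)
    (hp : (α_ B z.X k).inv ≫ act z ▷ k ≫ p = B ◁ p ≫ act m)
    (hi' : act m' ≫ i' = B ◁ i' ≫ (α_ B z.X k).inv ≫ act z ▷ k)
    (hp' : (α_ B z.X k).inv ≫ act z ▷ k ≫ p' = B ◁ p' ≫ act m')
    (h : p' ≫ i' ≫ p = p) : Retract m m' where
  i := mkHom (i ≫ p') (by
    rw [reassoc_of% hi, hp', MonoidalCategory.whiskerLeft_comp_assoc])
  r := mkHom (i' ≫ p) (by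
    rw [reassoc_of% hi', hp, MonoidalCategory.whiskerLeft_comp_assoc])
  retract := Mod.hom_ext _ _ (by
    change (i ≫ p') ≫ i' ≫ p = 𝟙 _
    rw [assoc, h, hip])

/-- The tensor product over `B` is a retract of the tensor product over `A`. -/
def relRetract [IsSeparableMon B] (z w : Mod K B) :
    Retract (relTensor (𝟙 B) z w) (relTensor f z (res f w)) :=
  retractOfTens (relι_relπ (𝟙 B) z w) (relι_linear _ z w) (relπ_linear _ z w)
    (relι_linear f z (res f w)) (relπ_linear f z (res f w)) (by
      have e : IsBalanced f z (res f w) (relπ (𝟙 B) z w) := by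
        have h := isBalanced_relπ (𝟙 B) z w
        rw [IsBalanced, fract_id] at h
        change fract f z ▷ w.X ≫ relπ (𝟙 B) z w =
          (α_ z.X A w.X).hom ≫ z.X ◁ (f ▷ w.X ≫ act w) ≫ relπ (𝟙 B) z w
        rw [fract, comp_whiskerRight_assoc, h]
        simp
      exact e.relπ_relι_comp)

/-- The module `w ≅ B ⊗_B w` imposes on `B ⊗ w` more relations than `B ⊗_A w` does; since both
quotients are split by linear maps, the smaller one is a summand of the larger. -/
lemma nonempty_retract_ext_res [IsSeparableMon B] (w : Mod K B) :
    Nonempty (Retract w (ext f (res f w))) := by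
  obtain ⟨e⟩ := nonempty_relTensor_swap (Mod.regular B) w
  exact ⟨(Retract.ofIso (e ≪≫ relRegular (𝟙 B) w).symm).trans (relRetract f (Mod.regular B) w)⟩

lemma ract_regular : ract (Mod.regular B) = (μ : B ⊗ B ⟶ B) := IsCommMonObj.mul_comm B

instance : IsSeparableMon (𝟙_ K) where
  exists_section := ⟨(λ_ (𝟙_ K)).inv, by
    change (λ_ (𝟙_ K)).inv ≫ (λ_ (𝟙_ K)).hom = _ ∧ _ ≫ _ ≫ _ ◁ (λ_ (𝟙_ K)).hom =
      (λ_ (𝟙_ K)).hom ≫ _ ∧ _ ≫ _ ≫ (λ_ (𝟙_ K)).hom ▷ _ = (λ_ (𝟙_ K)).hom ≫ _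
    refine ⟨by simp, ?_, ?_⟩
    · monoidal
    · monoidal⟩

instance : IsMonHom (η : 𝟙_ K ⟶ B) where
  one_hom := by
    change 𝟙 _ ≫ η = η
    simp
  mul_hom := by
    change (λ_ (𝟙_ K)).hom ≫ η = (η ⊗ₘ η) ≫ μ
    rw [MonoidalCategory.tensorHom_def', assoc, MonObj.one_mul]
    simp

/-- Extension of scalars along the unit. -/
def extUnit (w : Mod K (𝟙_ K)) :
    ext (η : 𝟙_ K ⟶ B) w ≅ (extScalars B).obj w.X :=
  relIsoOf η (Mod.regular B) w ((extScalars B).obj w.X) (𝟙 (B ⊗ w.X))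
    (by
      have e₁ : act w = (λ_ w.X).hom := by
        have h := one_act w
        change 𝟙 (𝟙_ K) ▷ w.X ≫ act w = _ at h
        simpa using h
      have e₂ : fract (η : 𝟙_ K ⟶ B) (Mod.regular B) = (ρ_ B).hom := by
        have h := fract_one (η : 𝟙_ K ⟶ B) (Mod.regular B)
        change B ◁ 𝟙 (𝟙_ K) ≫ (fract η (Mod.regular B) : B ⊗ 𝟙_ K ⟶ B) = (ρ_ B).hom at h
        rw [MonoidalCategory.whiskerLeft_id] at h
        exact (Category.id_comp _).symm.trans h
      change (fract η (Mod.regular B) : B ⊗ 𝟙_ K ⟶ B) ▷ w.X ≫ 𝟙 (B ⊗ w.X) =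
        (α_ B (𝟙_ K) w.X).hom ≫ B ◁ act w ≫ 𝟙 (B ⊗ w.X)
      rw [e₁, e₂]
      exact (Category.comp_id _).trans (by simp; rfl))
    (𝟙 (B ⊗ w.X)) (Category.id_comp (𝟙 (B ⊗ w.X)))
    ((Category.id_comp _).trans (Category.id_comp _))
    (by
      change (α_ B B w.X).inv ≫ μ ▷ w.X ≫ 𝟙 _ = B ◁ 𝟙 (B ⊗ w.X) ≫ (α_ B B w.X).inv ≫ μ ▷ w.X
      simp)

end RelativeTensorRetracts

/-! ### Retracts of distinguished triangles. -/

section RetractTriangle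

variable {K : Type u} [Category.{v} K] [Preadditive K] [HasZeroObject K] [HasShift K ℤ]
  [∀ n : ℤ, (shiftFunctor K n).Additive] [Pretriangulated K]

lemma isIso_of_comp_isIso {C : Type u'} [Category.{v'} C] {X Y : C} (θ : X ⟶ Y) (κ : Y ⟶ X)
    (h₁ : IsIso (θ ≫ κ)) (h₂ : IsIso (κ ≫ θ)) : IsIso θ := by
  have : Mono θ := mono_of_mono θ κ
  have : IsSplitEpi θ := ⟨⟨inv (κ ≫ θ) ≫ κ, by simp⟩⟩
  exact isIso_of_mono_of_isSplitEpi θ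

/-- A retract of a distinguished triangle is distinguished. -/
lemma distinguished_of_retract {T T' : Triangle K} (hT' : T' ∈ distTriang K) (i : T ⟶ T')
    (p : T' ⟶ T) (h₁ : i.hom₁ ≫ p.hom₁ = 𝟙 _) (h₂ : i.hom₂ ≫ p.hom₂ = 𝟙 _)
    (h₃ : i.hom₃ ≫ p.hom₃ = 𝟙 _) : T ∈ distTriang K := by
  obtain ⟨Z, g, h, hD⟩ := distinguished_cocone_triangle T.mor₁
  -- The cone `Z` of the first morphism is compared with `T.obj₃` through the given triangle: `c ≫
  -- p.hom₃` goes one way and `i.hom₃ ≫ d` goes back. The composites need not be identities, but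
  -- both turn out to be isomorphisms.
  obtain ⟨c, hc, hc'⟩ := complete_distinguished_triangle_morphism _ _ hD hT' i.hom₁ i.hom₂ i.comm₁
  obtain ⟨d, hd, hd'⟩ := complete_distinguished_triangle_morphism _ _ hT' hD p.hom₁ p.hom₂ p.comm₁
  change Z ⟶ T'.obj₃ at c
  change T'.obj₃ ⟶ Z at d
  change g ≫ c = i.hom₂ ≫ T'.mor₂ at hc
  change h ≫ i.hom₁⟦(1 : ℤ)⟧' = c ≫ T'.mor₃ at hc'
  change T'.mor₂ ≫ d = p.hom₂ ≫ g at hd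
  change T'.mor₃ ≫ p.hom₁⟦(1 : ℤ)⟧' = d ≫ h at hd'
  have a₂ : g ≫ c ≫ p.hom₃ = T.mor₂ := by
    rw [reassoc_of% hc, p.comm₂, reassoc_of% h₂]
  have a₃ : (c ≫ p.hom₃) ≫ T.mor₃ = h := by
    rw [assoc, ← p.comm₃, ← reassoc_of% hc', ← Functor.map_comp, h₁]
    simp
  have b₂ : T.mor₂ ≫ i.hom₃ ≫ d = g := by
    rw [i.comm₂_assoc, hd, reassoc_of% h₂]
  have b₃ : (i.hom₃ ≫ d) ≫ h = T.mor₃ := by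
    rw [assoc, ← hd', ← i.comm₃_assoc, ← Functor.map_comp, h₁]
    simp
  -- On `Z` the composite extends two identities to an endomorphism of a distinguished triangle.
  have h₄ : IsIso ((c ≫ p.hom₃) ≫ i.hom₃ ≫ d) := by
    let φ : Triangle.mk T.mor₁ g h ⟶ Triangle.mk T.mor₁ g h :=
      { hom₁ := 𝟙 _
        hom₂ := 𝟙 _
        hom₃ := (c ≫ p.hom₃) ≫ i.hom₃ ≫ d
        comm₁ := (comp_id _).trans (id_comp _).symm
        comm₂ := by
          have e : g ≫ (c ≫ p.hom₃) ≫ i.hom₃ ≫ d = g := by rw [assoc, reassoc_of% a₂, b₂]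
          exact e.trans (id_comp _).symm
        comm₃ := by
          have e : h ≫ (𝟙 T.obj₁)⟦(1 : ℤ)⟧' = ((c ≫ p.hom₃) ≫ i.hom₃ ≫ d) ≫ h := by
            rw [assoc, b₃, a₃, CategoryTheory.Functor.map_id, comp_id]
          exact e }
    exact isIso₃_of_isIso₁₂ φ hD hD (inferInstanceAs (IsIso (𝟙 _)))
      (inferInstanceAs (IsIso (𝟙 _)))
  -- `T` is not yet known to be distinguished, so exactness is borrowed from `T'`. The deviation `N`
  -- from the identity vanishes after `T.mor₂`, hence factors through `T.mor₃`; it also vanishes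
  -- before `T.mor₃`. So `N` squares to zero and `𝟙 + N` is invertible.
  have h₅ : IsIso ((i.hom₃ ≫ d) ≫ c ≫ p.hom₃) := by
    set N := (i.hom₃ ≫ d) ≫ c ≫ p.hom₃ - 𝟙 _ with hN
    have n₁ : T.mor₂ ≫ N = 0 := by
      rw [hN, Preadditive.comp_sub, assoc, reassoc_of% b₂, a₂, comp_id, sub_self]
    have n₂ : N ≫ T.mor₃ = 0 := by
      rw [hN, Preadditive.sub_comp, assoc, a₃, b₃, id_comp, sub_self]
    obtain ⟨n, hn⟩ := Triangle.yoneda_exact₃ T' hT' (p.hom₃ ≫ N) (by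
      rw [p.comm₂_assoc, n₁, comp_zero])
    have n₃ : N = T.mor₃ ≫ i.hom₁⟦(1 : ℤ)⟧' ≫ n := by
      rw [i.comm₃_assoc, ← hn, reassoc_of% h₃]
    have n₄ : N ≫ N = 0 := by
      conv_lhs => enter [2]; rw [n₃]
      rw [reassoc_of% n₂, zero_comp]
    have n₅ : (i.hom₃ ≫ d) ≫ c ≫ p.hom₃ = 𝟙 _ + N := by rw [hN]; abel
    rw [n₅]
    exact ⟨𝟙 _ - N, by simp [n₄], by simp [n₄]⟩
  have := isIso_of_comp_isIso _ _ h₄ h₅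
  refine isomorphic_distinguished _ hD _ (Triangle.isoMk T (Triangle.mk T.mor₁ g h)
    (Iso.refl _) (Iso.refl _) (asIso (c ≫ p.hom₃)).symm ?_ ?_ ?_)
  · exact (comp_id _).trans (id_comp _).symm
  · have e : T.mor₂ ≫ inv (c ≫ p.hom₃) = g := by
      rw [← a₂, assoc, assoc, ← assoc c, IsIso.hom_inv_id, comp_id]
    exact e.trans (id_comp _).symm
  · have e : T.mor₃ ≫ (𝟙 T.obj₁)⟦(1 : ℤ)⟧' = inv (c ≫ p.hom₃) ≫ h := by
      rw [CategoryTheory.Functor.map_id, comp_id, ← a₃, IsIso.inv_hom_id_assoc]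
    exact e

/-- The image of an idempotent endomorphism of a distinguished triangle is distinguished. -/
lemma distinguished_of_splittings {X₁ X₂ X₃ M₁ M₂ M₃ : K} {a : X₁ ⟶ X₂} {b : X₂ ⟶ X₃}
    {c : X₃ ⟶ X₁⟦(1 : ℤ)⟧} (hT : Triangle.mk a b c ∈ distTriang K)
    {i₁ : M₁ ⟶ X₁} {p₁ : X₁ ⟶ M₁} (h₁ : i₁ ≫ p₁ = 𝟙 _)
    {i₂ : M₂ ⟶ X₂} {p₂ : X₂ ⟶ M₂} (h₂ : i₂ ≫ p₂ = 𝟙 _)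
    {i₃ : M₃ ⟶ X₃} {p₃ : X₃ ⟶ M₃} (h₃ : i₃ ≫ p₃ = 𝟙 _)
    (ha : a ≫ p₂ ≫ i₂ = p₁ ≫ i₁ ≫ a) (hb : b ≫ p₃ ≫ i₃ = p₂ ≫ i₂ ≫ b)
    (hc : c ≫ p₁⟦1⟧' ≫ i₁⟦1⟧' = p₃ ≫ i₃ ≫ c) :
    Triangle.mk (i₁ ≫ a ≫ p₂) (i₂ ≫ b ≫ p₃) (i₃ ≫ c ≫ p₁⟦1⟧') ∈ distTriang K := by
  have hp₁ : p₁⟦(1 : ℤ)⟧' ≫ i₁⟦(1 : ℤ)⟧' ≫ p₁⟦(1 : ℤ)⟧' = p₁⟦(1 : ℤ)⟧' := by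
    simp only [← Functor.map_comp, h₁, comp_id]
  refine distinguished_of_retract (T := Triangle.mk (i₁ ≫ a ≫ p₂) (i₂ ≫ b ≫ p₃)
    (i₃ ≫ c ≫ p₁⟦1⟧')) (T' := Triangle.mk a b c) hT
    { hom₁ := i₁
      hom₂ := i₂
      hom₃ := i₃
      comm₁ := ?_
      comm₂ := ?_
      comm₃ := ?_ }
    { hom₁ := p₁
      hom₂ := p₂
      hom₃ := p₃
      comm₁ := ?_
      comm₂ := ?_
      comm₃ := ?_ } h₁ h₂ h₃
  · change (i₁ ≫ a ≫ p₂) ≫ i₂ = i₁ ≫ a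
    rw [assoc, assoc, ha, reassoc_of% h₁]
  · change (i₂ ≫ b ≫ p₃) ≫ i₃ = i₂ ≫ b
    rw [assoc, assoc, hb, reassoc_of% h₂]
  · change (i₃ ≫ c ≫ p₁⟦(1 : ℤ)⟧') ≫ i₁⟦(1 : ℤ)⟧' = i₃ ≫ c
    rw [assoc, assoc, hc, reassoc_of% h₃]
  · change a ≫ p₂ = p₁ ≫ i₁ ≫ a ≫ p₂
    rw [← reassoc_of% ha, h₂, comp_id]
  · change b ≫ p₃ = p₂ ≫ i₂ ≫ b ≫ p₃
    rw [← reassoc_of% hb, h₃, comp_id]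
  · change c ≫ p₁⟦(1 : ℤ)⟧' = p₃ ≫ i₃ ≫ c ≫ p₁⟦(1 : ℤ)⟧'
    rw [← reassoc_of% hc, hp₁]

lemma comp_absorb {C : Type u'} [Category.{v'} C] {X Y Z W V U : C} {p : Z ⟶ W} {i : W ⟶ V}
    {φ : V ⟶ U} {ψ : Z ⟶ U} (h : p ≫ i ≫ φ = ψ) (a : X ⟶ Y) (b : Y ⟶ Z) :
    (a ≫ b ≫ p) ≫ i ≫ φ = a ≫ b ≫ ψ := by
  simp only [assoc, h]

end RetractTriangle

/-! ### Tensor-ideals of modules and exactness of the relative tensor product. -/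

section Ideals

variable {K : Type u} [Category.{v} K] [Preadditive K] [HasZeroObject K] [HasShift K ℤ]
  [∀ n : ℤ, (shiftFunctor K n).Additive] [Pretriangulated K] [MonoidalCategory K]
  [SymmetricCategory K] [TensorTriangulated K] [IsIdempotentComplete K]
  {A B : K} [MonObj A] [MonObj B] [IsCommMonObj A] [IsCommMonObj B] [IsSeparableMon A]
  [IsSeparableMon B]

/-- Thick tensor-ideals of modules. -/
abbrev IsIdeal (P : ObjectProperty (Mod K A)) : Prop :=
  IsThickTensorIdeal (modDist A) (tensorOver A) P

lemma IsIdeal.relTensor_right {P : ObjectProperty (Mod K A)} (hP : IsIdeal P) (x : Mod K A)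
    {y : Mod K A} (hy : P y) : P (relTensor (𝟙 A) x y) :=
  hP.of_iso (nonempty_tensorOver_iso x y).some.symm (hP.tensor x hy)

lemma IsIdeal.relTensor_left {P : ObjectProperty (Mod K A)} (hP : IsIdeal P) {x : Mod K A}
    (hx : P x) (y : Mod K A) : P (relTensor (𝟙 A) x y) :=
  hP.of_iso (nonempty_relTensor_swap y x).some (IsIdeal.relTensor_right hP y hx)

lemma IsIdeal.tens {P : ObjectProperty (Mod K A)} (hP : IsIdeal P) {x : Mod K A}
    (hx : P x) (k : K) : P (tens x k) :=
  hP.of_iso (relFree (𝟙 A) x k) (IsIdeal.relTensor_left hP hx _)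

/-- `x ⊗_A y` is a retract of `x ⊗ y`, as an `A`-module through `x`. -/
def relTensorRetract (f : A ⟶ B) [IsMonHom f] (z : Mod K B) (y : Mod K A) :
    Retract (relTensor f z y) (tens z y.X) where
  i := mkHom (x := relTensor f z y) (y := tens z y.X) (relι f z y) (relι_linear f z y)
  r := mkHom (x := tens z y.X) (y := relTensor f z y) (relπ f z y) (by
    change ((α_ B z.X y.X).inv ≫ act z ▷ y.X) ≫ relπ f z y = _
    rw [assoc]
    exact relπ_linear f z y)
  retract := Mod.hom_ext _ _ (relι_relπ f z y)

/-- Thick subcategories of modules which are closed under tensoring with objects of `K` are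
tensor-ideals. -/
lemma isIdeal_of_tens {P : ObjectProperty (Mod K A)} (zero : ∃ z, IsZero z ∧ P z)
    (shift : ∀ (n : ℤ) {x : Mod K A}, P x → P (x⟦n⟧))
    (ext₁ : ∀ {T : Triangle (Mod K A)}, T ∈ modDist A → P T.obj₂ → P T.obj₃ → P T.obj₁)
    (ext₂ : ∀ {T : Triangle (Mod K A)}, T ∈ modDist A → P T.obj₁ → P T.obj₃ → P T.obj₂)
    (ext₃ : ∀ {T : Triangle (Mod K A)}, T ∈ modDist A → P T.obj₁ → P T.obj₂ → P T.obj₃)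
    (summand : ∀ {x y : Mod K A}, Retract x y → P y → P x)
    (tens : ∀ {x : Mod K A}, P x → ∀ k, P (tens x k)) : IsIdeal P where
  zero := zero
  shift := shift
  ext₁ := ext₁
  ext₂ := ext₂
  ext₃ := ext₃
  summand := summand
  tensor x y hy := by
    obtain ⟨e⟩ := nonempty_tensorOver_iso x y
    obtain ⟨e'⟩ := nonempty_relTensor_swap x y
    -- The factors are swapped first, so that `y`, the one known to lie in `P`, is the factor
    -- carrying the module structure in `y ⊗ x.X`.
    exact summand ((Retract.ofIso (e.symm ≪≫ e')).trans (relTensorRetract (𝟙 A) y x)) (tens hy x.X)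

variable (f : A ⟶ B) [IsMonHom f]

lemma tensorShift_assoc_inv (x y : K) (n : ℤ) (z : K) :
    (tensorShift x n (y ⊗ z)).hom ≫ (α_ x y z).inv⟦n⟧' =
      x ◁ (tensorShift y n z).inv ≫ (α_ x y (z⟦n⟧)).inv ≫ (tensorShift (x ⊗ y) n z).hom := by
  have h := tensorShift_assoc x y n z
  rw [← cancel_mono ((α_ x y z).hom⟦n⟧')]
  simp only [assoc]
  rw [← h, ← Functor.map_comp, Iso.inv_hom_id_assoc, ← MonoidalCategory.whiskerLeft_comp_assoc]
  simp

/-- The section of the action on a shifted module. -/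
def secShift (y : Mod K A) (n : ℤ) : y.X⟦n⟧ ⟶ A ⊗ y.X⟦n⟧ := sec (y⟦n⟧)

/-- The section comes from a map `𝟙 ⟶ A ⊗ A`, and the shift isomorphisms respect the unit,
associativity and naturality in the left variable. So the section of a shifted module is the shift
of the section. -/
lemma sec_shift (y : Mod K A) (n : ℤ) :
    secShift y n ≫ (tensorShift A n y.X).hom = (sec y)⟦n⟧' := by
  have h : (λ_ (y.X⟦n⟧)).inv ≫ (tensorShift (𝟙_ K) n y.X).hom = (λ_ y.X).inv⟦n⟧' := by
    rw [Iso.inv_comp_eq, ← tensorShift_unit, assoc, ← Functor.map_comp]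
    simp
  change ((λ_ (y.X⟦n⟧)).inv ≫ sepElement A ▷ (y.X⟦n⟧) ≫ (α_ A A (y.X⟦n⟧)).hom ≫
    A ◁ ((tensorShift A n y.X).hom ≫ (act y)⟦n⟧')) ≫ (tensorShift A n y.X).hom = _
  simp only [assoc, MonoidalCategory.whiskerLeft_comp]
  rw [tensorShift_natural_right, reassoc_of% (@tensorShift_assoc),
    reassoc_of% (@tensorShift_natural), reassoc_of% h, sec]
  simp only [← Functor.map_comp]

variable (f : A ⟶ B)

/-- The idempotent `balancing` for a shifted module. -/
def balancingShift (z : Mod K B) (y : Mod K A) (n : ℤ) : z.X ⊗ y.X⟦n⟧ ⟶ z.X ⊗ y.X⟦n⟧ :=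
  balancing f z (y⟦n⟧)

/-- By `sec_shift` the shift isomorphism matches the idempotents of `z ⊗ y⟦n⟧` and `(z ⊗ y)⟦n⟧`; it
therefore descends to their images. -/
lemma tensorShift_balancing (z : Mod K B) (y : Mod K A) (n : ℤ) :
    (tensorShift z.X n y.X).hom ≫ (balancing f z y)⟦n⟧' =
      balancingShift f z y n ≫ (tensorShift z.X n y.X).hom := by
  change _ = (z.X ◁ secShift y n ≫ (α_ z.X A (y.X⟦n⟧)).inv ≫
    fract f z ▷ (y.X⟦n⟧)) ≫ (tensorShift z.X n y.X).hom
  rw [balancing]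
  simp only [Functor.map_comp, assoc]
  rw [tensorShift_natural, ← reassoc_of% (@tensorShift_natural_right),
    reassoc_of% (@tensorShift_assoc_inv), ← sec_shift]
  simp

variable [IsMonHom f]

lemma isBalanced_tensorShift (z : Mod K B) (y : Mod K A) (n : ℤ) :
    IsBalanced f z (y⟦n⟧) ((tensorShift z.X n y.X).hom ≫ (relπ f z y)⟦n⟧') := by
  have e := isBalanced_relπ f z y
  rw [IsBalanced] at e
  change fract f z ▷ (y.X⟦n⟧) ≫ (tensorShift z.X n y.X).hom ≫ (relπ f z y)⟦n⟧' =
    (α_ z.X A (y.X⟦n⟧)).hom ≫ z.X ◁ ((tensorShift A n y.X).hom ≫ (act y)⟦n⟧') ≫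
      (tensorShift z.X n y.X).hom ≫ (relπ f z y)⟦n⟧'
  rw [reassoc_of% (@tensorShift_natural), ← Functor.map_comp, e]
  simp only [Functor.map_comp, MonoidalCategory.whiskerLeft_comp, assoc]
  rw [reassoc_of% (@tensorShift_natural_right), reassoc_of% (@tensorShift_assoc)]

/-- `z ⊗_A -` commutes with shifts. -/
def relShift (z : Mod K B) (y : Mod K A) (n : ℤ) :
    relTensor f z (y⟦n⟧) ≅ (relTensor f z y)⟦n⟧ :=
  relIsoOf f z (y⟦n⟧) ((relTensor f z y)⟦n⟧) ((tensorShift z.X n y.X).hom ≫ (relπ f z y)⟦n⟧')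
    (isBalanced_tensorShift f z y n) ((relι f z y)⟦n⟧' ≫ (tensorShift z.X n y.X).inv)
    (by
      change ((relι f z y)⟦n⟧' ≫ (tensorShift z.X n y.X).inv) ≫
        (tensorShift z.X n y.X).hom ≫ (relπ f z y)⟦n⟧' = 𝟙 ((relTensor f z y).X⟦n⟧)
      rw [assoc, Iso.inv_hom_id_assoc, ← Functor.map_comp, relι_relπ,
        CategoryTheory.Functor.map_id])
    (by
      have key {T : K} (φ : z.X ⊗ (y.X⟦n⟧) ⟶ T) (h : IsBalanced f z (y⟦n⟧) φ) :
          ((tensorShift z.X n y.X).hom ≫ (relπ f z y)⟦n⟧') ≫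
            ((relι f z y)⟦n⟧' ≫ (tensorShift z.X n y.X).inv) ≫ φ = φ := by
        simp only [assoc]
        rw [← Functor.map_comp_assoc, relπ_relι, reassoc_of% (@tensorShift_balancing),
          Iso.hom_inv_id_assoc]
        exact h.balancing_comp
      exact key _ (isBalanced_relπ f z (y⟦n⟧)))
    (by
      have e := relπ_linear f z y
      have e' := tensorShift_assoc B z.X n y.X
      rw [← Iso.eq_inv_comp] at e'
      change (α_ B z.X (y.X⟦n⟧)).inv ≫ act z ▷ (y.X⟦n⟧) ≫ (tensorShift z.X n y.X).hom ≫
        (relπ f z y)⟦n⟧' = B ◁ ((tensorShift z.X n y.X).hom ≫ (relπ f z y)⟦n⟧') ≫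
          (tensorShift B n _).hom ≫ (act (relTensor f z y))⟦n⟧'
      rw [reassoc_of% (@tensorShift_natural), MonoidalCategory.whiskerLeft_comp_assoc,
        reassoc_of% (@tensorShift_natural_right), reassoc_of% e']
      simp only [← Functor.map_comp]
      rw [← e, Iso.hom_inv_id_assoc])

/-- `z ⊗_A -` is exact. -/
lemma exists_relTensor_triangle (z : Mod K B) {T : Triangle (Mod K A)} (hT : T ∈ modDist A) :
    ∃ T' : Triangle (Mod K B), T' ∈ modDist B ∧ T'.obj₁ = relTensor f z T.obj₁ ∧
      T'.obj₂ = relTensor f z T.obj₂ ∧ T'.obj₃ = relTensor f z T.obj₃ := by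
  refine ⟨Triangle.mk ((relFunctor f z).map T.mor₁) ((relFunctor f z).map T.mor₂)
    ((relFunctor f z).map T.mor₃ ≫ (relShift f z T.obj₁ 1).hom), ?_, rfl, rfl, rfl⟩
  have hU := (tensorLeft z.X).map_distinguished _ hT
  -- The idempotents are natural, so together with `nat₃` they form an endomorphism of the triangle
  -- obtained by tensoring with `z.X`. The required triangle is the image of that endomorphism.
  have nat {y y' : Mod K A} (φ : y ⟶ y') : z.X ◁ φ.hom ≫ relπ f z y' ≫ relι f z y' =
      relπ f z y ≫ relι f z y ≫ z.X ◁ φ.hom := by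
    rw [relπ_relι, balancing_natural_right, relπ_relι_assoc]
  let m₃ : T.obj₃.X ⟶ T.obj₁.X⟦(1 : ℤ)⟧ := T.mor₃.hom
  let tS := (tensorShift z.X 1 T.obj₁.X).hom
  have hU' : Triangle.mk (z.X ◁ T.mor₁.hom) (z.X ◁ T.mor₂.hom) (z.X ◁ m₃ ≫ tS) ∈ distTriang K := by
    refine isomorphic_distinguished _ hU _
      (Triangle.isoMk _ _ (Iso.refl _) (Iso.refl _) (Iso.refl _) ?_ ?_ ?_)
    · exact (comp_id _).trans (id_comp _).symm
    · exact (comp_id _).trans (id_comp _).symm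
    · have e : (z.X ◁ m₃ ≫ tS) ≫ (𝟙 (z.X ⊗ T.obj₁.X))⟦(1 : ℤ)⟧' =
        𝟙 _ ≫ z.X ◁ (m₃ ≫ 𝟙 _) ≫ tS := by simp
      exact e
  have nat₃ : (z.X ◁ m₃ ≫ tS) ≫ (relπ f z T.obj₁)⟦(1 : ℤ)⟧' ≫ (relι f z T.obj₁)⟦(1 : ℤ)⟧' =
      relπ f z T.obj₃ ≫ relι f z T.obj₃ ≫ z.X ◁ m₃ ≫ tS := by
    have e : z.X ◁ m₃ ≫ balancingShift f z T.obj₁ 1 =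
      balancing f z T.obj₃ ≫ z.X ◁ m₃ := balancing_natural_right f z T.mor₃
    rw [← Functor.map_comp, relπ_relι, relπ_relι_assoc, assoc, tensorShift_balancing,
      reassoc_of% e]
  have hD := distinguished_of_splittings hU' (relι_relπ f z _) (relι_relπ f z _)
    (relι_relπ f z _) (nat _) (nat _) nat₃
  refine isomorphic_distinguished _ hD _
    (Triangle.isoMk _ _ (Iso.refl _) (Iso.refl _) (Iso.refl _) ?_ ?_ ?_)
  · exact (comp_id _).trans (id_comp _).symm
  · exact (comp_id _).trans (id_comp _).symm
  · have e := comp_absorb (isBalanced_tensorShift f z T.obj₁ 1).relπ_relι_comp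
      (relι f z T.obj₃) (z.X ◁ m₃)
    have e' {X Y Z W : K} {a : X ⟶ Y} {b : Y ⟶ Z⟦(1 : ℤ)⟧} {c : X ⟶ Z⟦(1 : ℤ)⟧}
      (h : a ≫ b = c) : (((a ≫ b) ≫ 𝟙 _) ≫ (𝟙 Z)⟦(1 : ℤ)⟧') = 𝟙 _ ≫ c := by simp [h]
    refine (e' (W := z.X) e).trans ?_
    rw [assoc]
    rfl

/-- `z ⊗_A -` is exact and commutes with tensoring by objects of `K`. With `f` an identity this
gives the ideal quotients used in the Zorn argument; with `z` the regular module it gives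
contraction along extension of scalars. -/
lemma IsIdeal.relTensor_comap {P : ObjectProperty (Mod K B)} (hP : IsIdeal P) (z : Mod K B) :
    IsIdeal fun y : Mod K A => P (relTensor f z y) := by
  refine isIdeal_of_tens ?_ ?_ ?_ ?_ ?_ ?_ ?_
  · obtain ⟨y, hy⟩ := HasZeroObject.zero (C := Mod K A)
    obtain ⟨w, hw, hw'⟩ := hP.zero
    have h : IsZero (relTensor f z y) := isZero_mod (by
      rw [IsZero.iff_id_eq_zero, ← relι_relπ,
        (isZero_tensor z.X (isZero_X hy)).eq_of_tgt (relι f z y) 0, zero_comp])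
    exact ⟨y, hy, hP.of_iso (hw.iso h) hw'⟩
  · exact fun n {x} hx => hP.of_iso (relShift f z x n).symm (hP.shift n hx)
  · intro T hT h₂ h₃
    obtain ⟨T', hT', e₁, e₂, e₃⟩ := exists_relTensor_triangle f z hT
    rw [← e₂] at h₂
    rw [← e₃] at h₃
    rw [← e₁]
    exact hP.ext₁ hT' h₂ h₃
  · intro T hT h₁ h₃
    obtain ⟨T', hT', e₁, e₂, e₃⟩ := exists_relTensor_triangle f z hT
    rw [← e₁] at h₁
    rw [← e₃] at h₃
    rw [← e₂]
    exact hP.ext₂ hT' h₁ h₃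
  · intro T hT h₁ h₂
    obtain ⟨T', hT', e₁, e₂, e₃⟩ := exists_relTensor_triangle f z hT
    rw [← e₁] at h₁
    rw [← e₂] at h₂
    rw [← e₃]
    exact hP.ext₃ hT' h₁ h₂
  · exact fun r hy => hP.summand (r.map (relFunctor f z)) hy
  · exact fun {x} hx k => hP.of_iso (relTens f z x k).symm (hP.tens hx k)

end Ideals

/-! ### Ideals pulled back along restriction and forgetful functors; direct sums. -/

section IdealComaps

variable {K : Type u} [Category.{v} K] [Preadditive K] [HasZeroObject K] [HasShift K ℤ]
  [∀ n : ℤ, (shiftFunctor K n).Additive] [Pretriangulated K] [MonoidalCategory K]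
  [SymmetricCategory K] [TensorTriangulated K] [IsIdempotentComplete K]
  {A B : K} [MonObj A] [MonObj B] [IsCommMonObj A] [IsCommMonObj B] [IsSeparableMon A]
  [IsSeparableMon B] (f : A ⟶ B) [IsMonHom f]

/-- Restriction of scalars commutes with shifts. -/
def resShift (z : Mod K B) (n : ℤ) : res f (z⟦n⟧) ≅ (res f z)⟦n⟧ :=
  mkIso (x := res f (z⟦n⟧)) (y := (res f z)⟦n⟧) (Iso.refl (z.X⟦n⟧)) (by
    change (f ▷ (z.X⟦n⟧) ≫ (tensorShift B n z.X).hom ≫ (act z)⟦n⟧') ≫ 𝟙 (z.X⟦n⟧) =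
      A ◁ 𝟙 (z.X⟦n⟧) ≫ (tensorShift A n z.X).hom ≫ (f ▷ z.X ≫ act z)⟦n⟧'
    rw [reassoc_of% (@tensorShift_natural)]
    simp)

/-- The restriction of scalars of a triangle. -/
def resTriangle (T : Triangle (Mod K B)) : Triangle (Mod K A) :=
  Triangle.mk (resMap f T.mor₁) (resMap f T.mor₂) (resMap f T.mor₃ ≫ (resShift f T.obj₁ 1).hom)

lemma resTriangle_mem {T : Triangle (Mod K B)} (hT : T ∈ modDist B) :
    resTriangle f T ∈ modDist A := by
  refine isomorphic_distinguished _ hT _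
    (Triangle.isoMk _ _ (Iso.refl _) (Iso.refl _) (Iso.refl _) ?_ ?_ ?_)
  · exact (comp_id _).trans (id_comp _).symm
  · exact (comp_id _).trans (id_comp _).symm
  · have e {X Z : K} (a : X ⟶ Z⟦(1 : ℤ)⟧) :
      ((((a ≫ 𝟙 _) ≫ 𝟙 _) ≫ (𝟙 Z)⟦(1 : ℤ)⟧') = 𝟙 _ ≫ (a ≫ 𝟙 _)) := by simp
    exact e (Z := T.obj₁.X) T.mor₃.hom

/-- Restriction is exact and compatible with the action of `K`, though not monoidal;
`isIdeal_of_tens` asks for no more. These ideals are the starting point for lying over. -/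
lemma IsIdeal.res_comap {P : ObjectProperty (Mod K A)} (hP : IsIdeal P) :
    IsIdeal fun z : Mod K B => P (res f z) := by
  refine isIdeal_of_tens ?_ ?_ ?_ ?_ ?_ ?_ ?_
  · obtain ⟨y, hy⟩ := HasZeroObject.zero (C := Mod K B)
    obtain ⟨w, hw, hw'⟩ := hP.zero
    have h : IsZero (res f y) := isZero_mod (isZero_X hy : IsZero y.X)
    exact ⟨y, hy, hP.of_iso (hw.iso h) hw'⟩
  · exact fun n {x} hx => hP.of_iso (resShift f x n).symm (hP.shift n hx)
  · exact fun hT h₂ h₃ => hP.ext₁ (resTriangle_mem f hT) h₂ h₃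
  · exact fun hT h₁ h₃ => hP.ext₂ (resTriangle_mem f hT) h₁ h₃
  · exact fun hT h₁ h₂ => hP.ext₃ (resTriangle_mem f hT) h₁ h₂
  · exact fun {x y} r hy => hP.summand (x := res f x) (y := res f y)
      { i := resMap f r.i
        r := resMap f r.r
        retract := Mod.hom_ext _ _ ((hom_comp_id r.retract : r.i.hom ≫ r.r.hom = 𝟙 x.X)) } hy
  · intro x hx k
    refine hP.of_iso (mkIso (x := TTGeom.tens (res f x) k) (y := res f (TTGeom.tens x k)) (Iso.refl (x.X ⊗ k)) ?_)
      (hP.tens hx k)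
    change ((α_ A x.X k).inv ≫ (f ▷ x.X ≫ act x) ▷ k) ≫ 𝟙 (x.X ⊗ k) =
      A ◁ 𝟙 (x.X ⊗ k) ≫ f ▷ (x.X ⊗ k) ≫ (α_ B x.X k).inv ≫ act x ▷ k
    simp

variable (B) in
lemma isIdeal_forget {Q : ObjectProperty K}
    (hQ : IsThickTensorIdeal (distTriang K) (fun x y : K => x ⊗ y) Q) :
    IsIdeal fun z : Mod K B => Q z.X := by
  refine isIdeal_of_tens ?_ ?_ ?_ ?_ ?_ ?_ ?_
  · obtain ⟨y, hy⟩ := HasZeroObject.zero (C := Mod K B)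
    obtain ⟨w, hw, hw'⟩ := hQ.zero
    exact ⟨y, hy, hQ.of_iso (hw.iso (isZero_X hy)) hw'⟩
  · exact fun n {x} hx => hQ.shift n hx
  · exact fun hT h₂ h₃ => hQ.ext₁ hT h₂ h₃
  · exact fun hT h₁ h₃ => hQ.ext₂ hT h₁ h₃
  · exact fun hT h₁ h₂ => hQ.ext₃ hT h₁ h₂
  · exact fun {x y} r hy => hQ.summand (r.map (Mod.forget B)) hy
  · exact fun {x} hx k => hQ.of_iso (β_ k x.X) (hQ.tensor k hx)

/-- A module is in a tensor-ideal as soon as its identity is a sum of two morphisms which factor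
through modules in the tensor-ideal. -/
lemma IsIdeal.of_add {P : ObjectProperty (Mod K A)} (hP : IsIdeal P) {x y e : Mod K A}
    (hx : P x) (hy : P y) (b₁ : e ⟶ x) (a₁ : x ⟶ e) (b₂ : e ⟶ y) (a₂ : y ⟶ e)
    (h : b₁.hom ≫ a₁.hom + b₂.hom ≫ a₂.hom = 𝟙 e.X) : P e := by
  have add {X Y : K} (a b : X ⟶ Y) : A ◁ (a + b) = A ◁ a + A ◁ b := (tensorLeft A).map_add
  have zero {X Y : K} : A ◁ (0 : X ⟶ Y) = 0 := (tensorLeft A).map_zero _ _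
  -- The componentwise action makes `x.X ⊞ y.X` a module `s`. The split triangle places `s` in `P`,
  -- and the hypothesis on the identity says that `e` is a summand of `s`.
  let ρ : A ⊗ (x.X ⊞ y.X) ⟶ x.X ⊞ y.X :=
    biprod.lift (A ◁ biprod.fst ≫ act x) (A ◁ biprod.snd ≫ act y)
  let s : Mod K A := mkMod (x.X ⊞ y.X) ρ
    (by
      apply biprod.hom_ext
      · simp only [ρ, assoc, biprod.lift_fst]
        rw [← whisker_exchange_assoc, one_act]
        simp
      · simp only [ρ, assoc, biprod.lift_snd]
        rw [← whisker_exchange_assoc, one_act]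
        simp)
    (by
      apply biprod.hom_ext
      · simp only [ρ, assoc, biprod.lift_fst]
        rw [← whisker_exchange_assoc, mul_act, ← MonoidalCategory.whiskerLeft_comp_assoc,
          biprod.lift_fst]
        simp
      · simp only [ρ, assoc, biprod.lift_snd]
        rw [← whisker_exchange_assoc, mul_act, ← MonoidalCategory.whiskerLeft_comp_assoc,
          biprod.lift_snd]
        simp)
  let il : x ⟶ s := mkHom (x := x) (y := s) (biprod.inl : x.X ⟶ x.X ⊞ y.X) (by
    change act x ≫ biprod.inl = A ◁ biprod.inl ≫ ρ
    apply biprod.hom_ext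
    · simp only [ρ, assoc, biprod.lift_fst]
      rw [← MonoidalCategory.whiskerLeft_comp_assoc]
      simp
    · simp only [ρ, assoc, biprod.lift_snd]
      rw [← MonoidalCategory.whiskerLeft_comp_assoc]
      simp [zero])
  let pr : s ⟶ y := mkHom (x := s) (y := y) (biprod.snd : x.X ⊞ y.X ⟶ y.X) (by
    change ρ ≫ biprod.snd = A ◁ biprod.snd ≫ act y
    simp [ρ])
  let z : y ⟶ x⟦(1 : ℤ)⟧ := mkHom (x := y) (y := x⟦(1 : ℤ)⟧) (0 : y.X ⟶ x.X⟦(1 : ℤ)⟧) (by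
    change act y ≫ (0 : y.X ⟶ x.X⟦(1 : ℤ)⟧) = A ◁ (0 : y.X ⟶ x.X⟦(1 : ℤ)⟧) ≫
      (tensorShift A 1 x.X).hom ≫ (act x)⟦(1 : ℤ)⟧'
    simp [zero])
  have hs : P s := by
    refine hP.ext₂ (T := Triangle.mk il pr z) ?_ hx hy
    refine isomorphic_distinguished _ (binaryBiproductTriangle_distinguished x.X y.X) _
      (Triangle.isoMk _ _ (Iso.refl _) (Iso.refl _) (Iso.refl _) ?_ ?_ ?_)
    · exact (comp_id _).trans (id_comp _).symm
    · exact (comp_id _).trans (id_comp _).symm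
    · have e : ((0 : y.X ⟶ x.X⟦(1 : ℤ)⟧) ≫ 𝟙 _) ≫ (𝟙 x.X)⟦(1 : ℤ)⟧' =
        𝟙 _ ≫ (0 : y.X ⟶ x.X⟦(1 : ℤ)⟧) := by simp
      exact e
  refine hP.summand (y := s) ⟨mkHom (x := e) (y := s) (biprod.lift b₁.hom b₂.hom) ?_,
    mkHom (x := s) (y := e) (biprod.desc a₁.hom a₂.hom) ?_, Mod.hom_ext _ _ ?_⟩ hs
  · change act e ≫ biprod.lift b₁.hom b₂.hom = A ◁ biprod.lift b₁.hom b₂.hom ≫ ρ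
    apply biprod.hom_ext
    · simp only [ρ, assoc, biprod.lift_fst]
      rw [← MonoidalCategory.whiskerLeft_comp_assoc, biprod.lift_fst, act_hom]
    · simp only [ρ, assoc, biprod.lift_snd]
      rw [← MonoidalCategory.whiskerLeft_comp_assoc, biprod.lift_snd, act_hom]
  · change ρ ≫ biprod.desc a₁.hom a₂.hom = A ◁ biprod.desc a₁.hom a₂.hom ≫ act e
    rw [biprod.lift_desc, biprod.desc_eq, add, Preadditive.add_comp]
    simp only [MonoidalCategory.whiskerLeft_comp, assoc, act_hom]
  · change biprod.lift b₁.hom b₂.hom ≫ biprod.desc a₁.hom a₂.hom = 𝟙 e.X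
    rw [biprod.lift_desc, h]

end IdealComaps

/-! ### The two algebra structures on a monoid under `A ⊗ A`. -/

section TensorSquare

variable {K : Type u} [Category.{v} K] [MonoidalCategory K] [SymmetricCategory K]
  {A D : K} [MonObj A] [MonObj D]

instance isMonHom_mul [IsCommMonObj A] : IsMonHom (μ : A ⊗ A ⟶ A) where
  one_hom := by
    rw [MonObj.tensorObj.one_def, assoc, MonoidalCategory.tensorHom_def, assoc, MonObj.mul_one,
      rightUnitor_naturality, ← unitors_equal, Iso.inv_hom_id_assoc]
  mul_hom := by
    rw [MonObj.tensorObj.mul_def, assoc]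
    exact MonObj.mul_mul_mul_comm A

/-- The first inclusion of `A` into a monoid under `A ⊗ A`. -/
def inclL (p : A ⊗ A ⟶ D) : A ⟶ D := (ρ_ A).inv ≫ A ◁ η ≫ p

/-- The second inclusion of `A` into a monoid under `A ⊗ A`. -/
def inclR (p : A ⊗ A ⟶ D) : A ⟶ D := (λ_ A).inv ≫ η ▷ A ≫ p

variable (p : A ⊗ A ⟶ D) [IsMonHom p]

instance : IsMonHom (inclL p) := by unfold inclL; infer_instance

instance : IsMonHom (inclR p) := by unfold inclR; infer_instance

/-- This is multiplicativity of `p` on `(a ⊗ 1)(b ⊗ c) = ab ⊗ c`; its companion `mul_right_inclR`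
uses `(b ⊗ c)(1 ⊗ a) = b ⊗ ca`. -/
lemma mul_left_inclL : (α_ A A A).inv ≫ μ ▷ A ≫ p = A ◁ p ≫ inclL p ▷ D ≫ μ := by
  have h : A ◁ p ≫ inclL p ▷ D ≫ μ =
      ((ρ_ A).inv ≫ A ◁ (η : 𝟙_ K ⟶ A)) ▷ (A ⊗ A) ≫ (p ⊗ₘ p) ≫ μ := by
    rw [inclL, whisker_exchange_assoc, MonoidalCategory.tensorHom_def]
    simp
  have e : ((λ_ (A ⊗ A)).inv ≫ (α_ (𝟙_ K) A A).inv ≫ (η : 𝟙_ K ⟶ A) ▷ A ▷ A) ≫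
      (β_ A A).hom ▷ A ≫ (α_ A A A).hom = A ◁ ((λ_ A).inv ≫ η ▷ A) := by
    simp only [assoc]
    rw [← comp_whiskerRight_assoc, BraidedCategory.braiding_naturality_left]
    simp
  have e' := congr_arg (fun φ => A ◁ φ) e
  simp only [MonoidalCategory.whiskerLeft_comp, assoc] at e'
  rw [h, ← IsMonHom.mul_hom, MonObj.tensorObj.mul_def]
  have e'' : A ◁ A ◁ (λ_ A).inv ≫ A ◁ A ◁ (η : 𝟙_ K ⟶ A) ▷ A ≫ A ◁ A ◁ μ = 𝟙 _ := by
    simp only [← MonoidalCategory.whiskerLeft_comp, MonObj.one_mul]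
    simp
  simp [tensorμ, reassoc_of% e', MonoidalCategory.tensorHom_def', reassoc_of% e'']

lemma mul_right_inclR : (α_ A A A).hom ≫ A ◁ μ ≫ p = p ▷ A ≫ D ◁ inclR p ≫ μ := by
  have h : p ▷ A ≫ D ◁ inclR p ≫ μ =
      (A ⊗ A) ◁ ((λ_ A).inv ≫ (η : 𝟙_ K ⟶ A) ▷ A) ≫ (p ⊗ₘ p) ≫ μ := by
    rw [inclR, ← whisker_exchange_assoc, MonoidalCategory.tensorHom_def']
    simp
  have e : A ◁ ((λ_ A).inv ≫ (η : 𝟙_ K ⟶ A) ▷ A) ≫ (α_ A A A).inv ≫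
      (β_ A A).hom ▷ A ≫ (α_ A A A).hom = (λ_ (A ⊗ A)).inv ≫ η ▷ (A ⊗ A) := by
    rw [MonoidalCategory.whiskerLeft_comp, assoc, associator_inv_naturality_middle_assoc,
      ← comp_whiskerRight_assoc, BraidedCategory.braiding_naturality_right]
    simp
  have e' := congr_arg (fun φ => A ◁ φ) e
  simp only [MonoidalCategory.whiskerLeft_comp, assoc] at e'
  rw [h, ← IsMonHom.mul_hom, MonObj.tensorObj.mul_def]
  have e'' : A ◁ (η : 𝟙_ K ⟶ A) ▷ (A ⊗ A) ≫ (α_ A A (A ⊗ A)).inv ≫ μ ▷ (A ⊗ A) =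
      A ◁ (λ_ (A ⊗ A)).hom := by
    rw [associator_inv_naturality_middle_assoc, ← comp_whiskerRight, MonObj.mul_one,
      triangle_assoc_comp_right]
  simp only [tensorμ, MonoidalCategory.whiskerLeft_comp, assoc, tensor_whiskerLeft]
  simp only [Iso.inv_hom_id_assoc]
  rw [reassoc_of% e', MonoidalCategory.tensorHom_def, assoc, reassoc_of% e'',
    ← MonoidalCategory.whiskerLeft_comp_assoc]
  simp

end TensorSquare

/-! ### Extension of a restricted module, and the action of `A ⊗ A` on it. -/

section ExtMaps

variable {K : Type u} [Category.{v} K] [MonoidalCategory K] [SymmetricCategory K]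
  {A B : K} [MonObj A] [MonObj B] [IsCommMonObj B] [IsSeparableMon A] [IsIdempotentComplete K]
  (f : A ⟶ B) [IsMonHom f]

/-- The projection `B ⊗ y ⟶ B ⊗_A y`. -/
def extπ (y : Mod K A) : B ⊗ y.X ⟶ (ext f y).X := relπ f (Mod.regular B) y

/-- The inclusion `B ⊗_A y ⟶ B ⊗ y`. -/
def extι (y : Mod K A) : (ext f y).X ⟶ B ⊗ y.X := relι f (Mod.regular B) y

lemma extι_extπ (y : Mod K A) : extι f y ≫ extπ f y = 𝟙 _ := relι_relπ _ _ _

lemma fract_regular : fract f (Mod.regular B) = (B ◁ f ≫ μ : B ⊗ A ⟶ B) := by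
  rw [fract]
  exact congr_arg (fun φ => B ◁ f ≫ φ) ract_regular

lemma extπ_balanced (y : Mod K A) :
    (B ◁ f ≫ μ) ▷ y.X ≫ extπ f y = (α_ B A y.X).hom ≫ B ◁ act y ≫ extπ f y := by
  rw [← fract_regular f]
  exact isBalanced_relπ f (Mod.regular B) y

lemma extπ_extι_comp {y : Mod K A} {T : K} {φ : B ⊗ y.X ⟶ T}
    (h : (B ◁ f ≫ μ) ▷ y.X ≫ φ = (α_ B A y.X).hom ≫ B ◁ act y ≫ φ) :
    extπ f y ≫ extι f y ≫ φ = φ := by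
  rw [← fract_regular f] at h
  exact IsBalanced.relπ_relι_comp (f := f) (z := Mod.regular B) (y := y) h

lemma extπ_linear (y : Mod K A) :
    (α_ B B y.X).inv ≫ μ ▷ y.X ≫ extπ f y = B ◁ extπ f y ≫ act (ext f y) :=
  relπ_linear f (Mod.regular B) y

lemma extι_linear (y : Mod K A) :
    act (ext f y) ≫ extι f y = B ◁ extι f y ≫ (α_ B B y.X).inv ≫ μ ▷ y.X :=
  relι_linear f (Mod.regular B) y

end ExtMaps

section SquareAction

variable {K : Type u} [Category.{v} K] [MonoidalCategory K] [SymmetricCategory K]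
  {R A : K} [MonObj R] [MonObj A] [IsCommMonObj A] (f : R ⟶ A) (x : Mod K A) {E : K}
  (φ : A ⊗ x.X ⟶ E)

/-- The map `(b ⊗ a) ⊗ v ↦ φ (b ⊗ a v)`. -/
def squareAct : (A ⊗ A) ⊗ x.X ⟶ E := (α_ A A x.X).hom ≫ A ◁ act x ≫ φ

lemma squareAct_one : ((ρ_ A).inv ≫ A ◁ η) ▷ x.X ≫ squareAct x φ = φ := by
  have h : A ◁ η ▷ x.X ≫ A ◁ act x = A ◁ (λ_ x.X).hom := by
    rw [← MonoidalCategory.whiskerLeft_comp, one_act]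
  rw [squareAct]
  simp [reassoc_of% h]

lemma squareAct_right : ((α_ A A A).hom ≫ A ◁ μ) ▷ x.X ≫ squareAct x φ =
    (α_ (A ⊗ A) A x.X).hom ≫ (A ⊗ A) ◁ act x ≫ squareAct x φ := by
  have h : A ◁ μ ▷ x.X ≫ A ◁ act x = A ◁ (α_ A A x.X).hom ≫ A ◁ A ◁ act x ≫ A ◁ act x := by
    simp only [← MonoidalCategory.whiskerLeft_comp, mul_act]
  rw [squareAct]
  simp [reassoc_of% h]

lemma squareAct_left {e : A ⊗ E ⟶ E} (h : (α_ A A x.X).inv ≫ μ ▷ x.X ≫ φ = A ◁ φ ≫ e) :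
    ((α_ A A A).inv ≫ μ ▷ A) ▷ x.X ≫ squareAct x φ =
      (α_ A (A ⊗ A) x.X).hom ≫ A ◁ squareAct x φ ≫ e := by
  rw [squareAct]
  simp only [MonoidalCategory.whiskerLeft_comp, assoc]
  rw [← h]
  rw [associator_inv_naturality_right_assoc, whisker_exchange_assoc]
  simp

/-- Write `b(c) = ∑ r ⊗ c'` with `∑ f(r) c' = c`. The braided form of `g` sends `c ⊗ a` to `∑ c' ⊗ a
f(r)`, and a map `φ` balanced over `R` sends `c' ⊗ a f(r) v` to the value at `c' f(r) ⊗ a v`. These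
add up to the value at `c ⊗ a v`, so the idempotent has no effect. -/
lemma squareAct_balanced (h : (A ◁ f ≫ μ) ▷ x.X ≫ φ =
      (α_ A R x.X).hom ≫ A ◁ (f ▷ x.X ≫ act x) ≫ φ) {g : A ⊗ A ⟶ A ⊗ A} {b : A ⟶ R ⊗ A}
    (hb : b ≫ f ▷ A ≫ μ = 𝟙 A)
    (hg : g = A ◁ b ≫ (α_ A R A).inv ≫ (A ◁ f ≫ μ) ▷ A) :
    ((β_ A A).hom ≫ g ≫ (β_ A A).hom) ▷ x.X ≫ squareAct x φ = squareAct x φ := by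
  -- This is the passage of scalars of `R` from the second copy of `A` to the first; `c₁` to `c₈`
  -- are the permutations of factors needed to apply it.
  have h₃ : ((α_ A R A).inv ≫ (A ◁ f ≫ μ) ▷ A) ▷ x.X ≫ squareAct x φ =
      (A ◁ (f ▷ A ≫ μ)) ▷ x.X ≫ squareAct x φ := by
    have e : A ◁ μ ▷ x.X ≫ A ◁ act x =
        A ◁ (α_ A A x.X).hom ≫ A ◁ A ◁ act x ≫ A ◁ act x := by
      simp only [← MonoidalCategory.whiskerLeft_comp, mul_act]
    have e' : (A ◁ f ≫ μ) ▷ (A ⊗ x.X) ≫ A ◁ act x ≫ φ =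
        (A ⊗ R) ◁ act x ≫ (A ◁ f ≫ μ) ▷ x.X ≫ φ := by
      rw [whisker_exchange_assoc]
    have e'' : A ◁ R ◁ act x ≫ A ◁ f ▷ x.X =  A ◁ f ▷ (A ⊗ x.X) ≫ A ◁ A ◁ act x := by
      simp only [← MonoidalCategory.whiskerLeft_comp, whisker_exchange]
    rw [squareAct, comp_whiskerRight, assoc, associator_naturality_left_assoc, e', h]
    simp [reassoc_of% e, reassoc_of% e'']
  have c₁ : A ◁ f ≫ μ = (β_ A R).hom ≫ f ▷ A ≫ μ := by
    rw [← BraidedCategory.braiding_naturality_right_assoc, IsCommMonObj.mul_comm]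
  have c₂ : (A ◁ f ≫ μ) ▷ A ≫ (β_ A A).hom =
      ((β_ (A ⊗ R) A).hom ≫ A ◁ (β_ A R).hom) ≫ A ◁ (f ▷ A ≫ μ) := by
    rw [BraidedCategory.braiding_naturality_left, c₁]
    simp
  have c₃ : ((β_ (A ⊗ R) A).hom ≫ A ◁ (β_ A R).hom) ≫ (α_ A R A).inv ≫ (A ◁ f ≫ μ) ▷ A =
      (α_ A R A).hom ≫ A ◁ (f ▷ A ≫ μ) ≫ (β_ A A).hom := by
    have c₄ : f ▷ A ≫ μ = (β_ R A).hom ≫ A ◁ f ≫ μ := by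
      rw [← BraidedCategory.braiding_naturality_left_assoc, IsCommMonObj.mul_comm]
    have yb := (α_ A R A).hom ≫= BraidedCategory.yang_baxter A R A
    rw [Iso.hom_inv_id_assoc] at yb
    rw [BraidedCategory.braiding_naturality_right, c₄, BraidedCategory.braiding_tensor_left_hom,
      BraidedCategory.braiding_tensor_right_hom]
    simp only [assoc, comp_whiskerRight]
    rw [← reassoc_of% yb]
    simp
  have c₅ : A ◁ b ≫ A ◁ (f ▷ A ≫ μ) = 𝟙 _ := by
    rw [← MonoidalCategory.whiskerLeft_comp, hb, MonoidalCategory.whiskerLeft_id]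
  have c₆ : ((β_ (A ⊗ R) A).hom ≫ A ◁ (β_ A R).hom) ▷ x.X ≫ (A ◁ (f ▷ A ≫ μ)) ▷ x.X ≫
      squareAct x φ = ((α_ A R A).hom ≫ A ◁ (f ▷ A ≫ μ) ≫ (β_ A A).hom) ▷ x.X ≫
        squareAct x φ := by
    rw [← h₃, ← c₃, comp_whiskerRight _ ((α_ A R A).inv ≫ _), assoc]
  have c₇ : (β_ A A).hom ≫ g ≫ (β_ A A).hom = ((β_ A A).hom ≫ A ◁ b ≫ (α_ A R A).inv) ≫
      ((β_ (A ⊗ R) A).hom ≫ A ◁ (β_ A R).hom) ≫ A ◁ (f ▷ A ≫ μ) := by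
    rw [← c₂, hg]
    simp only [assoc]
  have c₈ : ((β_ A A).hom ≫ A ◁ b ≫ (α_ A R A).inv) ≫
      (α_ A R A).hom ≫ A ◁ (f ▷ A ≫ μ) ≫ (β_ A A).hom = 𝟙 _ := by
    simp only [assoc, Iso.inv_hom_id_assoc]
    rw [reassoc_of% c₅, SymmetricCategory.symmetry]
  rw [c₇, comp_whiskerRight, comp_whiskerRight _ (A ◁ _), assoc, assoc, c₆,
    ← comp_whiskerRight_assoc, c₈]
  simp

end SquareAction

section ExtRes

variable {K : Type u} [Category.{v} K] [MonoidalCategory K] [SymmetricCategory K]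
  [IsIdempotentComplete K]
  {R A D : K} [MonObj R] [MonObj A] [MonObj D] [IsCommMonObj A] [IsCommMonObj D]
  [IsSeparableMon R] [IsSeparableMon A] (f : R ⟶ A) [IsMonHom f] (x : Mod K A)

/-- The projection of `A ⊗ x` onto `A ⊗_R x`. -/
def extResπ : A ⊗ x.X ⟶ (ext f (res f x)).X := extπ f (res f x)

/-- The inclusion of `A ⊗_R x` into `A ⊗ x`. -/
def extResι : (ext f (res f x)).X ⟶ A ⊗ x.X := extι f (res f x)

lemma extResι_extResπ : extResι f x ≫ extResπ f x = 𝟙 _ := extι_extπ f (res f x)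

lemma extResπ_balanced : (A ◁ f ≫ μ) ▷ x.X ≫ extResπ f x =
    (α_ A R x.X).hom ≫ A ◁ (f ▷ x.X ≫ act x) ≫ extResπ f x :=
  extπ_balanced f (res f x)

lemma extResπ_linear :
    (α_ A A x.X).inv ≫ μ ▷ x.X ≫ extResπ f x = A ◁ extResπ f x ≫ act (ext f (res f x)) :=
  extπ_linear f (res f x)

lemma extResι_linear :
    act (ext f (res f x)) ≫ extResι f x = A ◁ extResι f x ≫ (α_ A A x.X).inv ≫ μ ▷ x.X :=
  extι_linear f (res f x)

variable (p : A ⊗ A ⟶ D) [IsMonHom p]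

/-- The map `A ⊗_R x ⟶ D ⊗_A x` induced by an inclusion of `A` into `D`. -/
def extResTo : ext f (res f x) ⟶ res (inclL p) (ext (inclR p) x) :=
  mkHom (y := res (inclL p) (ext (inclR p) x))
    (extResι f x ≫ inclL p ▷ x.X ≫ extπ (inclR p) x) (by
      change act _ ≫ extResι f x ≫ inclL p ▷ x.X ≫ extπ (inclR p) x =
        A ◁ (extResι f x ≫ inclL p ▷ x.X ≫ extπ (inclR p) x) ≫
          inclL p ▷ (ext (inclR p) x).X ≫ act (ext (inclR p) x)
      rw [reassoc_of% (extResι_linear f x), ← comp_whiskerRight_assoc, IsMonHom.mul_hom]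
      simp only [MonoidalCategory.whiskerLeft_comp, assoc]
      rw [whisker_exchange_assoc, ← extπ_linear, MonoidalCategory.tensorHom_def']
      simp)

variable {p} {s : D ⟶ A ⊗ A} {e : A ⊗ A ⟶ A ⊗ A}

/-- `s` has to be right linear only up to the idempotent `e`, because `squareAct` absorbs `e`. The
same device gives left linearity in `squareAct_section_linear`. -/
lemma squareAct_section_balanced (he : e ▷ x.X ≫ squareAct x (extResπ f x) =
      squareAct x (extResπ f x))
    (hr : (s ▷ A ≫ (α_ A A A).hom ≫ A ◁ μ) ≫ e = (D ◁ inclR p ≫ μ ≫ s) ≫ e) :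
    (D ◁ inclR p ≫ μ) ▷ x.X ≫ s ▷ x.X ≫ squareAct x (extResπ f x) =
      (α_ D A x.X).hom ≫ D ◁ act x ≫ s ▷ x.X ≫ squareAct x (extResπ f x) := by
  have h := squareAct_right x (extResπ f x)
  conv_lhs => rw [← he]
  rw [← comp_whiskerRight_assoc, ← comp_whiskerRight_assoc, assoc, ← assoc _ _ e, assoc _ _ s, ← hr,
    comp_whiskerRight_assoc, he, comp_whiskerRight_assoc, h, whisker_exchange_assoc]
  simp

lemma squareAct_section_linear (he : e ▷ x.X ≫ squareAct x (extResπ f x) =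
      squareAct x (extResπ f x))
    (hl : (A ◁ s ≫ (α_ A A A).inv ≫ μ ▷ A) ≫ e = (inclL p ▷ D ≫ μ ≫ s) ≫ e) :
    (inclL p ▷ D ≫ μ ≫ s) ▷ x.X ≫ squareAct x (extResπ f x) =
      (α_ A D x.X).hom ≫ A ◁ s ▷ x.X ≫ A ◁ squareAct x (extResπ f x) ≫
        act (ext f (res f x)) := by
  have h := squareAct_left x (extResπ f x) (extResπ_linear f x)
  conv_lhs => rw [← he]
  rw [← comp_whiskerRight_assoc, ← hl,
    comp_whiskerRight_assoc, he, comp_whiskerRight_assoc, h]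
  simp

variable (p)

/-- The map `D ⊗_A x ⟶ A ⊗_R x` induced by a bilinear map `s : D ⟶ A ⊗ A`. -/
def extResFrom (he : e ▷ x.X ≫ squareAct x (extResπ f x) = squareAct x (extResπ f x))
    (hl : (A ◁ s ≫ (α_ A A A).inv ≫ μ ▷ A) ≫ e = (inclL p ▷ D ≫ μ ≫ s) ≫ e) :
    res (inclL p) (ext (inclR p) x) ⟶ ext f (res f x) :=
  mkHom (x := res (inclL p) (ext (inclR p) x))
    (extι (inclR p) x ≫ s ▷ x.X ≫ squareAct x (extResπ f x)) (by
      change (inclL p ▷ (ext (inclR p) x).X ≫ act (ext (inclR p) x)) ≫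
          extι (inclR p) x ≫ s ▷ x.X ≫ squareAct x (extResπ f x) =
        A ◁ (extι (inclR p) x ≫ s ▷ x.X ≫ squareAct x (extResπ f x)) ≫ act _
      have h := squareAct_section_linear f x he hl
      simp only [comp_whiskerRight, assoc] at h
      rw [assoc, reassoc_of% (extι_linear (inclR p) x), ← whisker_exchange_assoc]
      simp only [MonoidalCategory.whiskerLeft_comp, assoc]
      rw [← Iso.inv_comp_eq] at h
      rw [← h]
      simp)

/-- Passing through `D ⊗_A x` amounts to replacing `a ⊗ 1` by its component `s(p(a ⊗ 1))`. Such
components are then summed to recover the identity. -/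
lemma extResTo_extResFrom (he : e ▷ x.X ≫ squareAct x (extResπ f x) =
      squareAct x (extResπ f x))
    (hr : (s ▷ A ≫ (α_ A A A).hom ≫ A ◁ μ) ≫ e = (D ◁ inclR p ≫ μ ≫ s) ≫ e)
    (hl : (A ◁ s ≫ (α_ A A A).inv ≫ μ ▷ A) ≫ e = (inclL p ▷ D ≫ μ ≫ s) ≫ e) :
    (extResTo f x p).hom ≫ (extResFrom f x p he hl).hom =
      extResι f x ≫ (inclL p ≫ s) ▷ x.X ≫ squareAct x (extResπ f x) := by
  have h := extπ_extι_comp (inclR p) (squareAct_section_balanced f x he hr)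
  change (extResι f x ≫ inclL p ▷ x.X ≫ extπ (inclR p) x) ≫
    extι (inclR p) x ≫ s ▷ x.X ≫ squareAct x (extResπ f x) = _
  rw [assoc, assoc, h]
  simp

end ExtRes

/-! ### Decomposing `A ⊗_R x` by means of `A ⊗_R A ≅ A × C`. -/

section SquareDecomposition

variable {K : Type u} [Category.{v} K] [Preadditive K] [HasZeroObject K] [HasShift K ℤ]
  [∀ n : ℤ, (shiftFunctor K n).Additive] [Pretriangulated K] [MonoidalCategory K]
  [SymmetricCategory K] [TensorTriangulated K] [IsIdempotentComplete K]
  {R A C : K} [MonObj R] [MonObj A] [MonObj C] [IsCommMonObj R] [IsCommMonObj A] [IsCommMonObj C]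
  [IsSeparableMon R] [IsSeparableMon A] [IsSeparableMon C]

lemma add_whiskerRight' {X Y : K} (a b : X ⟶ Y) (Z : K) : (a + b) ▷ Z = a ▷ Z + b ▷ Z := by
  have h : Z ◁ (a + b) = Z ◁ a + Z ◁ b := (tensorLeft Z).map_add
  rw [← cancel_mono (β_ Y Z).hom, Preadditive.add_comp]
  simp [BraidedCategory.braiding_naturality_left, h]

lemma add_absorb {Y Z W V : K} {p : Y ⟶ Z} {q : Y ⟶ W} {s : Z ⟶ Y} {t : W ⟶ Y}
    {u v : V ⟶ Y} (h₁ : u ≫ p = v ≫ p) (h₂ : u ≫ q = v ≫ q) :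
    u ≫ (p ≫ s + q ≫ t) = v ≫ (p ≫ s + q ≫ t) := by
  simp only [Preadditive.comp_add, reassoc_of% h₁, reassoc_of% h₂]

lemma zero_whiskerLeft (X : K) {Y Z : K} : X ◁ (0 : Y ⟶ Z) = 0 := (tensorLeft X).map_zero _ _

lemma zero_whiskerRight' (X : K) {Y Z : K} : (0 : Y ⟶ Z) ▷ X = 0 := by
  rw [← cancel_mono (β_ Z X).hom]
  simp [BraidedCategory.braiding_naturality_left, zero_whiskerLeft]

/-- Linearity of `s` is tested after `p`, where `s` is a section and `p` is linear, and after `q`,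
where both sides vanish; by `add_absorb` this suffices modulo the idempotent `p ≫ s + q ≫ t`. -/
lemma section_right {D D' : K} [MonObj D] [MonObj D'] (p : A ⊗ A ⟶ D) (q : A ⊗ A ⟶ D')
    [IsMonHom p] [IsMonHom q] {s : D ⟶ A ⊗ A} (t : D' ⟶ A ⊗ A) (hp : s ≫ p = 𝟙 D)
    (hq : s ≫ q = 0) :
    (s ▷ A ≫ (α_ A A A).hom ≫ A ◁ μ) ≫ (p ≫ s + q ≫ t) =
      (D ◁ inclR p ≫ μ ≫ s) ≫ (p ≫ s + q ≫ t) := by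
  refine add_absorb ?_ ?_
  · simp only [assoc]
    rw [mul_right_inclR, ← comp_whiskerRight_assoc, hp]
    simp
  · simp only [assoc]
    rw [mul_right_inclR, ← comp_whiskerRight_assoc, hq, zero_whiskerRight']
    simp

lemma section_left {D D' : K} [MonObj D] [MonObj D'] (p : A ⊗ A ⟶ D) (q : A ⊗ A ⟶ D')
    [IsMonHom p] [IsMonHom q] {s : D ⟶ A ⊗ A} (t : D' ⟶ A ⊗ A) (hp : s ≫ p = 𝟙 D)
    (hq : s ≫ q = 0) :
    (A ◁ s ≫ (α_ A A A).inv ≫ μ ▷ A) ≫ (p ≫ s + q ≫ t) =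
      (inclL p ▷ D ≫ μ ≫ s) ≫ (p ≫ s + q ≫ t) := by
  refine add_absorb ?_ ?_
  · simp only [assoc]
    rw [mul_left_inclL, ← MonoidalCategory.whiskerLeft_comp_assoc, hp]
    simp
  · simp only [assoc]
    rw [mul_left_inclL, ← MonoidalCategory.whiskerLeft_comp_assoc, hq, zero_whiskerLeft]
    simp

/-- The maps through `D ⊗_A x` and `D' ⊗_A x` add up to the action of `p ≫ s + q ≫ t` on `A ⊗_R x`,
which is the identity by `he`. So `IsIdeal.of_add` applies. -/
lemma IsIdeal.ext_res_of_decomposition {P : ObjectProperty (Mod K A)} (hP : IsIdeal P)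
    (f : R ⟶ A) [IsMonHom f] (x : Mod K A) {D D' : K} [MonObj D] [MonObj D'] [IsCommMonObj D]
    [IsCommMonObj D'] (p : A ⊗ A ⟶ D) (q : A ⊗ A ⟶ D')
    [IsMonHom p] [IsMonHom q] (s : D ⟶ A ⊗ A) (t : D' ⟶ A ⊗ A) (hps : s ≫ p = 𝟙 D)
    (hqs : s ≫ q = 0) (hpt : t ≫ p = 0) (hqt : t ≫ q = 𝟙 D')
    (he : (p ≫ s + q ≫ t) ▷ x.X ≫ squareAct x (extResπ f x) = squareAct x (extResπ f x))
    (h₁ : P (res (inclL p) (ext (inclR p) x))) (h₂ : P (res (inclL q) (ext (inclR q) x))) :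
    P (ext f (res f x)) := by
  have hr := section_right q p s hqt hpt
  have hl := section_left q p s hqt hpt
  rw [add_comm] at hr hl
  refine hP.of_add h₁ h₂ (extResTo f x p) (extResFrom f x p he (section_left p q t hps hqs))
    (extResTo f x q) (extResFrom f x q he hl) ?_
  rw [extResTo_extResFrom f x p he (section_right p q t hps hqs),
    extResTo_extResFrom f x q he hr, ← Preadditive.comp_add, ← Preadditive.add_comp,
    ← add_whiskerRight']
  have h : inclL p ≫ s + inclL q ≫ t = ((ρ_ A).inv ≫ A ◁ η) ≫ (p ≫ s + q ≫ t) := by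
    simp [inclL]
  rw [h, comp_whiskerRight_assoc, he, squareAct_one, extResι_extResπ]

/-- Separability of `R` makes the coequalizer split: the balancing idempotent `e` of `A ⊗ A`
descends to a section `σ` of `(μ, g)`, and `s`, `t` are its two components. The explicit formula for
`e` is kept because `squareAct_balanced` depends on it. -/
lemma exists_sections (f : R ⟶ A) [IsMonHom f] (g : A ⊗ A ⟶ C)
    {w : (A ◁ f ≫ μ) ▷ A ≫ biprod.lift μ g =
      ((α_ A R A).hom ≫ A ◁ (f ▷ A ≫ μ)) ≫ biprod.lift μ g}
    (hw : IsColimit (Cofork.ofπ (biprod.lift μ g) w)) :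
    ∃ (s : A ⟶ A ⊗ A) (t : C ⟶ A ⊗ A), s ≫ μ = 𝟙 A ∧ s ≫ g = 0 ∧ t ≫ μ = 0 ∧ t ≫ g = 𝟙 C ∧
      ∃ b : A ⟶ R ⊗ A, b ≫ f ▷ A ≫ μ = 𝟙 A ∧
        μ ≫ s + g ≫ t = A ◁ b ≫ (α_ A R A).inv ≫ (A ◁ f ≫ μ) ▷ A := by
  let b : A ⟶ R ⊗ A := sec (res f (Mod.regular A))
  have hb : b ≫ f ▷ A ≫ μ = 𝟙 A := sec_act (res f (Mod.regular A))
  let e : A ⊗ A ⟶ A ⊗ A := A ◁ b ≫ (α_ A R A).inv ≫ (A ◁ f ≫ μ) ▷ A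
  have he : (A ◁ f ≫ μ) ▷ A ≫ e = ((α_ A R A).hom ≫ A ◁ (f ▷ A ≫ μ)) ≫ e := by
    have h := isBalanced_balancing f (Mod.regular A) (res f (Mod.regular A))
    rw [IsBalanced, balancing] at h
    change fract f (Mod.regular A) ▷ A ≫ A ◁ b ≫ (α_ A R A).inv ≫ fract f (Mod.regular A) ▷ A =
      (α_ A R A).hom ≫ A ◁ (f ▷ A ≫ μ) ≫ A ◁ b ≫ (α_ A R A).inv ≫
        fract f (Mod.regular A) ▷ A at h
    rw [fract_regular] at h
    rw [assoc]
    exact h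
  have hc : A ◁ b ≫ A ◁ (f ▷ A ≫ μ) = 𝟙 _ := by
    rw [← MonoidalCategory.whiskerLeft_comp, hb, MonoidalCategory.whiskerLeft_id]
  have heq : e ≫ biprod.lift μ g = biprod.lift μ g := by
    simp only [e, assoc]
    rw [w, assoc, Iso.inv_hom_id_assoc, reassoc_of% hc]
  let σ : A ⊞ C ⟶ A ⊗ A := Cofork.IsColimit.desc hw e he
  have hσ : biprod.lift μ g ≫ σ = e := Cofork.IsColimit.π_desc' hw e he
  have hσ' : σ ≫ biprod.lift μ g = 𝟙 _ := by
    apply Cofork.IsColimit.hom_ext hw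
    change biprod.lift μ g ≫ σ ≫ biprod.lift μ g = biprod.lift μ g ≫ 𝟙 _
    rw [reassoc_of% hσ, heq, comp_id]
  have h₁ : σ ≫ μ = biprod.fst := by
    have := hσ' =≫ biprod.fst
    simpa using this
  have h₂ : σ ≫ g = biprod.snd := by
    have := hσ' =≫ biprod.snd
    simpa using this
  refine ⟨biprod.inl ≫ σ, biprod.inr ≫ σ, by simp [h₁], by simp [h₂], by simp [h₁],
    by simp [h₂], b, hb, ?_⟩
  rw [← assoc, ← assoc, ← Preadditive.add_comp, ← biprod.lift_eq, hσ]

lemma res_ext_congr {P : ObjectProperty (Mod K A)} {D : K} [MonObj D]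
    [IsCommMonObj D] {h h' j j' : A ⟶ D} [IsMonHom h] [IsMonHom h'] [IsMonHom j] [IsMonHom j']
    (eh : h = h') (ej : j = j') {x : Mod K A} (H : P (res j (ext h x))) :
    P (res j' (ext h' x)) := by
  subst eh ej
  exact H

lemma nonempty_res_ext_id (x : Mod K A) : Nonempty (x ≅ res (𝟙 A) (ext (𝟙 A) x)) := by
  obtain ⟨e⟩ := nonempty_relTensor_swap x (Mod.regular A)
  refine ⟨(relRegular (𝟙 A) x).symm ≪≫ e ≪≫ (mkIso (x := res (𝟙 A) (ext (𝟙 A) x))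
    (y := ext (𝟙 A) x) (Iso.refl (ext (𝟙 A) x).X) ?_).symm⟩
  change (𝟙 A ▷ (ext (𝟙 A) x).X ≫ act (ext (𝟙 A) x)) ≫ 𝟙 (ext (𝟙 A) x).X =
    A ◁ 𝟙 (ext (𝟙 A) x).X ≫ act (ext (𝟙 A) x)
  simp

/-- If `A ⊗_R A ≅ A × C`, then `A ⊗_R x` is in the tensor-ideal generated by `x` and
`C ⊗_A x`. -/
lemma IsIdeal.ext_res {P : ObjectProperty (Mod K A)} (hP : IsIdeal P)
    (f : R ⟶ A) [IsMonHom f] (g : A ⊗ A ⟶ C) [IsMonHom g]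
    {w : (A ◁ f ≫ μ) ▷ A ≫ biprod.lift μ g =
      ((α_ A R A).hom ≫ A ◁ (f ▷ A ≫ μ)) ≫ biprod.lift μ g}
    (hw : IsColimit (Cofork.ofπ (biprod.lift μ g) w)) {x : Mod K A} (hx : P x)
    (hx' : P (res (inclR g) (ext (inclL g) x))) : P (ext f (res f x)) := by
  obtain ⟨s, t, h₁, h₂, h₃, h₄, b, hb, he⟩ := exists_sections f g hw
  -- `A ⊗_R x` extends along the right inclusion and restricts along the left one, whereas the
  -- algebra structure of the splitting tower is `inclL g`. The braiding exchanges the inclusions;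
  -- for `μ` both are the identity, so that summand contributes `x` itself.
  have e₁ : inclL ((β_ A A).hom ≫ μ) = 𝟙 A := by simp [inclL]
  have e₂ : inclR ((β_ A A).hom ≫ μ) = 𝟙 A := by simp [inclR]
  have e₃ : inclL ((β_ A A).hom ≫ g) = inclR g := by
    rw [inclL, inclR, BraidedCategory.braiding_naturality_right_assoc]
    simp
  have e₄ : inclR ((β_ A A).hom ≫ g) = inclL g := by
    rw [inclL, inclR, BraidedCategory.braiding_naturality_left_assoc]
    simp
  refine hP.ext_res_of_decomposition f x ((β_ A A).hom ≫ μ) ((β_ A A).hom ≫ g)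
    (s ≫ (β_ A A).hom) (t ≫ (β_ A A).hom) ?_ ?_ ?_ ?_ ?_ ?_ ?_
  · rw [assoc, SymmetricCategory.symmetry_assoc, h₁]
  · rw [assoc, SymmetricCategory.symmetry_assoc, h₂]
  · rw [assoc, SymmetricCategory.symmetry_assoc, h₃]
  · rw [assoc, SymmetricCategory.symmetry_assoc, h₄]
  · have h := squareAct_balanced f x (extResπ f x) (extResπ_balanced f x) hb he
    convert h using 2
    simp
  · exact res_ext_congr e₂.symm e₁.symm
      (hP.of_iso (nonempty_res_ext_id x).some hx)
  · exact res_ext_congr e₄.symm e₃.symm hx'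

end SquareDecomposition

/-! ### Projection formula, transitivity and monoidality of extension of scalars. -/

section RelativeTensorIsos

variable {K : Type u} [Category.{v} K] [MonoidalCategory K] [SymmetricCategory K]
  [IsIdempotentComplete K]
  {A B D : K} [MonObj A] [MonObj B] [MonObj D] [IsCommMonObj A] [IsCommMonObj B] [IsCommMonObj D]
  [IsSeparableMon A] [IsSeparableMon B] [IsSeparableMon D]

lemma nonempty_relTensor_congr {f f' : A ⟶ B} [IsMonHom f] [IsMonHom f'] (h : f = f')
    {z z' : Mod K B} (e : z ≅ z') {y y' : Mod K A} (e' : y ≅ y') :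
    Nonempty (relTensor f z y ≅ relTensor f' z' y') := by
  subst h
  exact ⟨(relFunctor f z).mapIso e' ≪≫ (relFunctorLeft f y').mapIso e⟩

/-- The projection formula. -/
lemma nonempty_relTensor_ext (f : A ⟶ B) [IsMonHom f] (z : Mod K B) (y : Mod K A) :
    Nonempty (relTensor (𝟙 B) z (ext f y) ≅ relTensor f z y) := by
  obtain ⟨e⟩ := nonempty_relTensor_congr (comp_id f) (relRegular (𝟙 B) z) (Iso.refl y)
  exact ⟨relAssoc f (𝟙 B) z (Mod.regular B) y ≪≫ e⟩

lemma nonempty_ext_comp (f : A ⟶ B) (h : B ⟶ D) [IsMonHom f] [IsMonHom h] (y : Mod K A) :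
    Nonempty (ext h (ext f y) ≅ ext (f ≫ h) y) := by
  obtain ⟨e⟩ := nonempty_relTensor_congr (rfl : f ≫ h = f ≫ h)
    (relRegular h (Mod.regular D)) (Iso.refl y)
  exact ⟨relAssoc f h (Mod.regular D) (Mod.regular B) y ≪≫ e⟩

lemma nonempty_relTensor_assoc (x y z : Mod K A) :
    Nonempty (relTensor (𝟙 A) x (relTensor (𝟙 A) y z) ≅
      relTensor (𝟙 A) (relTensor (𝟙 A) x y) z) := by
  obtain ⟨e⟩ := nonempty_relTensor_congr (comp_id (𝟙 A))
    (Iso.refl (relTensor (𝟙 A) x y)) (Iso.refl z)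
  exact ⟨relAssoc (𝟙 A) (𝟙 A) x y z ≪≫ e⟩

/-- Extension of scalars preserves tensor products. -/
lemma nonempty_ext_relTensor (f : A ⟶ B) [IsMonHom f] (x y : Mod K A) :
    Nonempty (ext f (relTensor (𝟙 A) x y) ≅ relTensor (𝟙 B) (ext f x) (ext f y)) := by
  obtain ⟨e⟩ := nonempty_relTensor_congr (id_comp f) (Iso.refl (ext f x)) (Iso.refl y)
  obtain ⟨e'⟩ := nonempty_relTensor_ext f (ext f x) y
  exact ⟨relAssoc (𝟙 A) f (Mod.regular B) x y ≪≫ e ≪≫ e'.symm⟩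

lemma nonempty_relTensor_interchange (a b c d : Mod K A) :
    Nonempty (relTensor (𝟙 A) (relTensor (𝟙 A) a b) (relTensor (𝟙 A) c d) ≅
      relTensor (𝟙 A) (relTensor (𝟙 A) a c) (relTensor (𝟙 A) b d)) := by
  obtain ⟨e₁⟩ := nonempty_relTensor_assoc (relTensor (𝟙 A) a b) c d
  obtain ⟨e₂⟩ := nonempty_relTensor_assoc a b c
  obtain ⟨e₃⟩ := nonempty_relTensor_swap b c
  obtain ⟨e₄⟩ := nonempty_relTensor_assoc a c b
  obtain ⟨e₅⟩ := nonempty_relTensor_assoc (relTensor (𝟙 A) a c) b d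
  exact ⟨e₁ ≪≫ (relFunctorLeft (𝟙 A) d).mapIso
    (e₂.symm ≪≫ (relFunctor (𝟙 A) a).mapIso e₃ ≪≫ e₄) ≪≫ e₅.symm⟩

end RelativeTensorIsos

/-! ### Chains of ideals and of primes. -/

section Zorn

variable {C : Type u} [Category.{v} C] [HasShift C ℤ] {𝒯 : Set (Triangle C)} {t : C → C → C}

lemma IsThickTensorIdeal.sUnion {c : Set (Set C)}
    (hc : ∀ P ∈ c, IsThickTensorIdeal 𝒯 t P) (hchain : IsChain (· ⊆ ·) c) (hne : c.Nonempty) :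
    IsThickTensorIdeal 𝒯 t (⋃₀ c) := by
  have h₂ {x y : C} (hx : (⋃₀ c) x) (hy : (⋃₀ c) y) : ∃ P ∈ c, P x ∧ P y := by
    obtain ⟨P, hP, hPx⟩ := hx
    obtain ⟨Q, hQ, hQy⟩ := hy
    rcases hchain.total hP hQ with h | h
    · exact ⟨Q, hQ, h hPx, hQy⟩
    · exact ⟨P, hP, hPx, h hQy⟩
  constructor
  · obtain ⟨P, hP⟩ := hne
    obtain ⟨z, hz, hz'⟩ := (hc P hP).zero
    exact ⟨z, hz, P, hP, hz'⟩
  · rintro n x ⟨P, hP, hx⟩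
    exact ⟨P, hP, (hc P hP).shift n hx⟩
  · intro T hT h h'
    obtain ⟨P, hP, h, h'⟩ := h₂ h h'
    exact ⟨P, hP, (hc P hP).ext₁ hT h h'⟩
  · intro T hT h h'
    obtain ⟨P, hP, h, h'⟩ := h₂ h h'
    exact ⟨P, hP, (hc P hP).ext₂ hT h h'⟩
  · intro T hT h h'
    obtain ⟨P, hP, h, h'⟩ := h₂ h h'
    exact ⟨P, hP, (hc P hP).ext₃ hT h h'⟩
  · rintro x y r ⟨P, hP, hx⟩
    exact ⟨P, hP, (hc P hP).summand r hx⟩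
  · rintro x y ⟨P, hP, hx⟩
    exact ⟨P, hP, (hc P hP).tensor x hx⟩

/-- If `x` is missing from `P` and `y` from `Q`, the smaller of the two primes misses both, so it
misses their product. -/
lemma IsPrimeTensorIdeal.sInter (h₀ : HasZeroObject C) {c : Set (Set C)}
    (hc : ∀ P ∈ c, IsPrimeTensorIdeal 𝒯 t P) (hchain : IsChain (· ⊆ ·) c) (hne : c.Nonempty) :
    IsPrimeTensorIdeal 𝒯 t (⋂₀ c) where
  zero := by
    obtain ⟨z, hz⟩ := h₀.zero
    refine ⟨z, hz, fun P hP => ?_⟩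
    obtain ⟨z', hz', h⟩ := (hc P hP).zero
    exact (hc P hP).of_iso (hz'.iso hz) h
  shift n x hx P hP := (hc P hP).shift n (hx P hP)
  ext₁ hT h h' P hP := (hc P hP).ext₁ hT (h P hP) (h' P hP)
  ext₂ hT h h' P hP := (hc P hP).ext₂ hT (h P hP) (h' P hP)
  ext₃ hT h h' P hP := (hc P hP).ext₃ hT (h P hP) (h' P hP)
  summand r hy P hP := (hc P hP).summand r (hy P hP)
  tensor x y hy P hP := (hc P hP).tensor x (hy P hP)
  proper := by
    obtain ⟨P, hP⟩ := hne
    obtain ⟨x, hx⟩ := (hc P hP).proper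
    exact ⟨x, fun h => hx (h P hP)⟩
  prime {x y} h := by
    by_contra hxy
    obtain ⟨hx, hy⟩ := not_or.1 hxy
    have hx' : ∃ P ∈ c, ¬ P x := by
      by_contra hx'
      exact hx fun P hP => by_contra fun hPx => hx' ⟨P, hP, hPx⟩
    have hy' : ∃ P ∈ c, ¬ P y := by
      by_contra hy'
      exact hy fun P hP => by_contra fun hPy => hy' ⟨P, hP, hPy⟩
    obtain ⟨P, hP, hPx⟩ := hx'
    obtain ⟨Q, hQ, hQy⟩ := hy'
    rcases hchain.total hP hQ with h' | h'
    · exact ((hc P hP).prime (h P hP)).elim hPx fun hy => hQy (h' hy)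
    · exact ((hc Q hQ).prime (h Q hQ)).elim (fun hx => hPx (h' hx)) hQy

end Zorn

/-! ### Contraction of primes, and primes avoiding multiplicative classes. -/

section Primes

variable {K : Type u} [Category.{v} K] [Preadditive K] [HasZeroObject K] [HasShift K ℤ]
  [∀ n : ℤ, (shiftFunctor K n).Additive] [Pretriangulated K] [MonoidalCategory K]
  [SymmetricCategory K] [TensorTriangulated K] [IsIdempotentComplete K]
  {A B : K} [MonObj A] [MonObj B] [IsCommMonObj A] [IsCommMonObj B] [IsSeparableMon A]
  [IsSeparableMon B]

/-- Prime tensor-ideals of modules. -/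
abbrev IsPrime (P : ObjectProperty (Mod K A)) : Prop :=
  IsPrimeTensorIdeal (modDist A) (tensorOver A) P

lemma IsPrime.isIdeal {P : ObjectProperty (Mod K A)} (hP : IsPrime P) : IsIdeal P :=
  hP.toIsThickTensorIdeal

lemma IsPrime.mem_or_mem {P : ObjectProperty (Mod K A)} (hP : IsPrime P) {x y : Mod K A}
    (h : P (relTensor (𝟙 A) x y)) : P x ∨ P y :=
  hP.prime (hP.of_iso (nonempty_tensorOver_iso x y).some h)

/-- Contraction of prime ideals along an extension of scalars. -/
lemma IsPrime.ext_comap (f : A ⟶ B) [IsMonHom f] {T : ObjectProperty (Mod K B)} (hT : IsPrime T) :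
    IsPrime fun y : Mod K A => T (ext f y) where
  toIsThickTensorIdeal := hT.isIdeal.relTensor_comap f (Mod.regular B)
  proper := by
    obtain ⟨w, hw⟩ := hT.proper
    -- A witness outside the contraction is the restriction of any `w ∉ T`, because `w` is a summand
    -- of the extension of its restriction.
    exact ⟨res f w, fun h => hw (hT.summand (nonempty_retract_ext_res f w).some h)⟩
  prime {x y} h := by
    obtain ⟨e⟩ := nonempty_tensorOver_iso x y
    obtain ⟨e'⟩ := nonempty_ext_relTensor f x y
    exact hT.mem_or_mem (hT.of_iso ((relFunctor f (Mod.regular B)).mapIso e.symm ≪≫ e') h)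

/-- Existence of prime ideals avoiding a multiplicative class. -/
lemma exists_prime_avoiding {J : Set (Mod K A)} (hJ : IsIdeal J) {S : Set (Mod K A)}
    (hS : S.Nonempty) (hdisj : ∀ s ∈ S, ¬ J s)
    (hmul : ∀ s ∈ S, ∀ s' ∈ S, ∃ s'' ∈ S, Nonempty (relTensor (𝟙 A) s s' ≅ s'')) :
    ∃ T : ObjectProperty (Mod K A), IsPrime T ∧ J ≤ T ∧ ∀ s ∈ S, ¬ T s := by
  obtain ⟨T, hJT, ⟨hT, hTS⟩, hmax⟩ := zorn_subset_nonempty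
    {T : Set (Mod K A) | IsIdeal T ∧ ∀ s ∈ S, s ∉ T} (fun c hc hchain hne =>
      ⟨⋃₀ c, ⟨IsThickTensorIdeal.sUnion (fun P hP => (hc hP).1) hchain hne,
        fun s hs ⟨P, hP, hsP⟩ => (hc hP).2 s hs hsP⟩, fun P hP => Set.subset_sUnion_of_mem hP⟩)
    J ⟨hJ, hdisj⟩
  -- The quotient `{u | y ⊗ u ∈ T}` is an ideal containing `T`. If it also contains some `x ∉ T`, it
  -- is strictly larger and must meet `S` by maximality.
  have key (y : Mod K A) (x : Mod K A) (hx : x ∉ T) (hxy : relTensor (𝟙 A) y x ∈ T) :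
      ∃ s ∈ S, relTensor (𝟙 A) y s ∈ T := by
    by_contra hcon
    have hN : {u | relTensor (𝟙 A) y u ∈ T} ∈
        {T : Set (Mod K A) | IsIdeal T ∧ ∀ s ∈ S, s ∉ T} :=
      ⟨IsIdeal.relTensor_comap (𝟙 A) hT y, fun s hs h => hcon ⟨s, hs, h⟩⟩
    exact hx (hmax hN (fun u hu => IsIdeal.relTensor_right hT y hu) hxy)
  refine ⟨T, { toIsThickTensorIdeal := hT, proper := ?_, prime := ?_ }, hJT, hTS⟩
  · obtain ⟨s, hs⟩ := hS
    exact ⟨s, hTS s hs⟩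
  · intro x y h
    by_contra hxy
    obtain ⟨hx, hy⟩ := not_or.1 hxy
    have h' : relTensor (𝟙 A) x y ∈ T := hT.of_iso (nonempty_tensorOver_iso x y).some.symm h
    -- Two applications replace `y` and then `x` by elements of `S` while the product stays in `T`;
    -- this product is isomorphic to an element of `S`.
    obtain ⟨s, hs, hs'⟩ := key x y hy h'
    obtain ⟨s', hs₁, hs₂⟩ := key s x hx (hT.of_iso (nonempty_relTensor_swap x s).some hs')
    obtain ⟨s'', h₁, ⟨e⟩⟩ := hmul s hs s' hs₁
    exact hTS s'' h₁ (hT.of_iso e hs₂)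

/-- Classes of modules which are closed under tensor products up to isomorphism. -/
def IsMultiplicative (U : Set (Mod K A)) : Prop :=
  U.Nonempty ∧ ∀ a ∈ U, ∀ b ∈ U, ∃ c ∈ U, Nonempty (relTensor (𝟙 A) a b ≅ c)

/-- The products `a ⊗ b` form one multiplicative class, by the interchange of factors. A prime
avoiding all of them avoids `U` and `V` separately, being an ideal, and since neither class is
empty. -/
lemma exists_prime_of_isMultiplicative {J : Set (Mod K A)} (hJ : IsIdeal J) {U V : Set (Mod K A)}
    (hU : IsMultiplicative U) (hV : IsMultiplicative V)
    (h : ∀ a ∈ U, ∀ b ∈ V, ¬ J (relTensor (𝟙 A) a b)) :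
    ∃ T : ObjectProperty (Mod K A), IsPrime T ∧ J ≤ T ∧ (∀ a ∈ U, ¬ T a) ∧ ∀ b ∈ V, ¬ T b := by
  obtain ⟨⟨a₀, ha₀⟩, hU⟩ := hU
  obtain ⟨⟨b₀, hb₀⟩, hV⟩ := hV
  obtain ⟨T, hT, hJT, hTS⟩ := exists_prime_avoiding (S := Set.image2 (relTensor (𝟙 A)) U V) hJ
    ⟨_, a₀, ha₀, b₀, hb₀, rfl⟩ (by
      rintro _ ⟨a, ha, b, hb, rfl⟩
      exact h a ha b hb) (by
      rintro _ ⟨a, ha, b, hb, rfl⟩ _ ⟨a', ha', b', hb', rfl⟩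
      obtain ⟨c, hc, ⟨e⟩⟩ := hU a ha a' ha'
      obtain ⟨d, hd, ⟨e'⟩⟩ := hV b hb b' hb'
      obtain ⟨e₁⟩ := nonempty_relTensor_interchange a b a' b'
      obtain ⟨e₂⟩ := nonempty_relTensor_congr (rfl : 𝟙 A = 𝟙 A) e e'
      exact ⟨_, ⟨c, hc, d, hd, rfl⟩, ⟨e₁ ≪≫ e₂⟩⟩)
  exact ⟨T, hT, hJT,
    fun a ha h => hTS _ ⟨a, ha, b₀, hb₀, rfl⟩ (IsIdeal.relTensor_left hT.isIdeal h b₀),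
    fun b hb h => hTS _ ⟨a₀, ha₀, b, hb, rfl⟩ (IsIdeal.relTensor_right hT.isIdeal a₀ h)⟩

lemma IsPrime.isMultiplicative_compl {P : ObjectProperty (Mod K A)} (hP : IsPrime P) :
    IsMultiplicative {a | ¬ P a} :=
  ⟨hP.proper, fun _ ha _ hb => ⟨_, fun h => (hP.mem_or_mem h).elim ha hb, ⟨Iso.refl _⟩⟩⟩

lemma IsPrime.isMultiplicative_ext (f : A ⟶ B) [IsMonHom f] {P : ObjectProperty (Mod K A)}
    (hP : IsPrime P) : IsMultiplicative (ext f '' {a | ¬ P a}) := by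
  refine ⟨hP.isMultiplicative_compl.1.image _, ?_⟩
  rintro _ ⟨a, ha, rfl⟩ _ ⟨b, hb, rfl⟩
  obtain ⟨e⟩ := nonempty_ext_relTensor f a b
  exact ⟨_, ⟨_, fun h => (hP.mem_or_mem h).elim ha hb, rfl⟩, ⟨e.symm⟩⟩

end Primes

/-! ### Lying over, and incomparability for finite degree. -/

section Incomparability

variable {K : Type u} [Category.{v} K] [Preadditive K] [HasZeroObject K] [HasShift K ℤ]
  [∀ n : ℤ, (shiftFunctor K n).Additive] [Pretriangulated K] [MonoidalCategory K]
  [SymmetricCategory K] [TensorTriangulated K] [IsIdempotentComplete K]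

section Step

variable {R A C : K} [MonObj R] [MonObj A] [MonObj C] [IsCommMonObj R] [IsCommMonObj A]
  [IsCommMonObj C] [IsSeparableMon R] [IsSeparableMon A] [IsSeparableMon C]

/-- Evaluate the balancing relation at `1 ⊗ r ⊗ 1`: it says that `f(r) ⊗ 1` and `1 ⊗ f(r)` have the
same image under `g`. -/
lemma comp_inclL_eq_comp_inclR (f : R ⟶ A) [IsMonHom f] {g : A ⊗ A ⟶ C}
    (w : (A ◁ f ≫ μ) ▷ A ≫ g = (α_ A R A).hom ≫ A ◁ (f ▷ A ≫ μ) ≫ g) :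
    f ≫ inclL g = f ≫ inclR g := by
  have h := ((ρ_ R).inv ≫ R ◁ η ≫ ((λ_ R).inv ≫ η ▷ R) ▷ A) ≫= w
  have h₁ : (R ◁ η ≫ ((λ_ R).inv ≫ η ▷ R) ▷ A) ≫ (A ◁ f ≫ μ) ▷ A = f ▷ 𝟙_ K ≫ A ◁ η := by
    have e : ((λ_ R).inv ≫ (η : 𝟙_ K ⟶ A) ▷ R) ≫ A ◁ f ≫ μ = f := by
      rw [assoc, ← whisker_exchange_assoc, MonObj.one_mul]
      simp
    rw [assoc, ← comp_whiskerRight, e, whisker_exchange]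
  have h₂ : (R ◁ η ≫ ((λ_ R).inv ≫ η ▷ R) ▷ A) ≫ (α_ A R A).hom ≫ A ◁ (f ▷ A ≫ μ) =
      (ρ_ R).hom ≫ f ≫ (λ_ A).inv ≫ η ▷ A := by
    have e : R ◁ (η : 𝟙_ K ⟶ A) ≫ f ▷ A ≫ μ = (ρ_ R).hom ≫ f := by
      rw [whisker_exchange_assoc, MonObj.mul_one, rightUnitor_naturality]
    have e' : (((λ_ R).inv ≫ (η : 𝟙_ K ⟶ A) ▷ R) ▷ A ≫ (α_ A R A).hom) =
        (λ_ (R ⊗ A)).inv ≫ η ▷ (R ⊗ A) := by simp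
    rw [assoc, reassoc_of% e', ← whisker_exchange, ← leftUnitor_inv_naturality_assoc, assoc,
      reassoc_of% e]
  simp only [assoc] at h h₁ h₂
  rw [reassoc_of% h₁, reassoc_of% h₂] at h
  rw [inclL, inclR]
  simpa using h

/-- The two contractions of a prime of `C`-modules to `A` therefore lie in one fibre over `R`. This
links the two maps `A ⟶ C` in the induction. -/
lemma mem_ext_comp_iff {D : K} [MonObj D] [IsCommMonObj D] [IsSeparableMon D]
    {T : ObjectProperty (Mod K D)} (hT : IsPrime T) (f : R ⟶ A) (h h' : A ⟶ D)
    [IsMonHom f] [IsMonHom h] [IsMonHom h'] (e : f ≫ h = f ≫ h') (w : Mod K R) :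
    T (ext h (ext f w)) ↔ T (ext h' (ext f w)) := by
  obtain ⟨e₁⟩ := nonempty_ext_comp f h w
  obtain ⟨e₂⟩ := nonempty_ext_comp f h' w
  obtain ⟨e₃⟩ := nonempty_relTensor_congr e (Iso.refl (Mod.regular D)) (Iso.refl w)
  let e' := e₁ ≪≫ e₃ ≪≫ e₂.symm
  exact ⟨hT.of_iso e', hT.of_iso e'.symm⟩

/-- By the projection formula the restricted module is `res f z ⊗_A y`, to which primality of `P`
applies. -/
lemma IsPrime.mem_or_mem_of_res {P : ObjectProperty (Mod K A)} (hP : IsPrime P) (f : A ⟶ C)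
    [IsMonHom f] {z : Mod K C} {y : Mod K A} (h : P (res f (relTensor (𝟙 C) z (ext f y)))) :
    P (res f z) ∨ P y := by
  obtain ⟨e⟩ := nonempty_relTensor_ext f z y
  exact hP.mem_or_mem (hP.of_iso (resIso f e ≪≫ (resRelTensor f z y).symm) h)

lemma IsIdeal.res_ext {P : ObjectProperty (Mod K A)} (hP : IsIdeal P) (f : A ⟶ C)
    [IsMonHom f] {y : Mod K A} (h : P y) : P (res f (ext f y)) :=
  hP.of_iso (resRelTensor f (Mod.regular C) y) (IsIdeal.relTensor_right hP _ h)

/-- Lying over for `A ⟶ C`, with an additional constraint: a prime ideal over `P` which avoids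
a given multiplicative class. -/
lemma IsPrime.exists_over {P : ObjectProperty (Mod K A)} (hP : IsPrime P) (f : A ⟶ C) [IsMonHom f]
    {U : Set (Mod K C)} (hU : IsMultiplicative U) (h : ∀ z ∈ U, ¬ P (res f z)) :
    ∃ T : ObjectProperty (Mod K C), IsPrime T ∧ (∀ z, P (res f z) → T z) ∧ (∀ z ∈ U, ¬ T z) ∧
      ∀ y, T (ext f y) ↔ P y := by
  -- The second class to avoid consists of the extensions of modules outside `P`. Avoiding it gives
  -- one direction of the contraction formula; containing every `z` with restriction in `P` gives
  -- the other.
  obtain ⟨T, hT, hJT, hTU, hTV⟩ := exists_prime_of_isMultiplicative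
    (J := {z | P (res f z)}) (IsIdeal.res_comap f hP.isIdeal) hU (hP.isMultiplicative_ext f) (by
      rintro a ha _ ⟨y, hy, rfl⟩ h'
      exact (hP.mem_or_mem_of_res f h').elim (h a ha) hy)
  exact ⟨T, hT, fun _ hz => hJT hz, hTU, fun y => ⟨fun h => by_contra fun hy => hTV _ ⟨y, hy, rfl⟩ h,
    fun h => hJT (hP.isIdeal.res_ext f h)⟩⟩

end Step

/-- Every module is a summand of `A ⊗ x`, so over a zero monoid all modules vanish and no ideal is
proper. -/
lemma not_isPrime_of_isZero {A : K} [MonObj A] [IsCommMonObj A] [IsSeparableMon A]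
    (hA : IsZero A) {P : ObjectProperty (Mod K A)} (hP : IsPrime P) : False := by
  obtain ⟨x, hx⟩ := hP.proper
  obtain ⟨z, hz, hz'⟩ := hP.zero
  have h : IsZero x.X := by
    have h₁ : IsZero (A ⊗ x.X) := (isZero_tensor x.X hA).of_iso (β_ A x.X)
    rw [IsZero.iff_id_eq_zero, ← sec_act, h₁.eq_of_tgt (sec x) 0, zero_comp]
  exact hx (hP.of_iso (hz.iso (isZero_mod h)) hz')

/-- The prime ideals with the same contraction as `P` have a minimal element below a given one. -/
lemma exists_minimal_prime {R A : K} [MonObj R] [MonObj A] [IsCommMonObj R] [IsCommMonObj A]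
    [IsSeparableMon R] [IsSeparableMon A] (f : R ⟶ A) [IsMonHom f] (S : Set (Mod K R))
    {P : Set (Mod K A)} (hP : IsPrime P) (hPS : ∀ w, ext f w ∈ P ↔ w ∈ S) :
    ∃ M : Set (Mod K A), IsPrime M ∧ (∀ w, ext f w ∈ M ↔ w ∈ S) ∧ M ⊆ P ∧
      ∀ N : Set (Mod K A), IsPrime N → (∀ w, ext f w ∈ N ↔ w ∈ S) → N ⊆ M → M ⊆ N := by
  obtain ⟨M, hMP, ⟨hM, hM'⟩, hmin⟩ := zorn_superset_nonempty
    {N : Set (Mod K A) | IsPrime N ∧ ∀ w, ext f w ∈ N ↔ w ∈ S} (fun c hc hchain hne =>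
      ⟨⋂₀ c, ⟨IsPrimeTensorIdeal.sInter inferInstance (fun N hN => (hc hN).1) hchain hne, fun w => by
        obtain ⟨N, hN⟩ := hne
        exact ⟨fun h => ((hc hN).2 w).1 (h N hN), fun h N' hN' => ((hc hN').2 w).2 h⟩⟩,
        fun N hN => Set.sInter_subset_of_mem hN⟩) P ⟨hP, hPS⟩
  exact ⟨M, hM, hM', hMP, fun N hN hN' h => hmin ⟨hN, hN'⟩ h⟩

/-- Incomparability for extensions of finite degree. -/
lemma DegreeLE.incomparable : ∀ (n : ℕ) {R A : K} [MonObj R] [MonObj A] [IsCommMonObj R]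
    [IsCommMonObj A] [IsSeparableMon R] [IsSeparableMon A] (f : R ⟶ A) [IsMonHom f],
    DegreeLE n f → ∀ {P₁ P : Set (Mod K A)}, IsPrime P₁ → IsPrime P → P₁ ⊆ P →
      (∀ w, ext f w ∈ P₁ ↔ ext f w ∈ P) → P ⊆ P₁
  | 0, _, _, _, _, _, _, _, _, _, _, h, _, _, _, hP, _, _ => (not_isPrime_of_isZero h hP).elim
  | n + 1, R, A, _, _, _, _, _, _, f, _, h, P₁, P, hP₁, hP, hP₁P, hf => by
    obtain ⟨C, _, _, _, g, _, w, ⟨hw⟩, hdeg⟩ := h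
    change DegreeLE n (inclL g) at hdeg
    have hfg : f ≫ inclL g = f ≫ inclR g := by
      have h := w =≫ biprod.snd
      simp only [assoc, biprod.lift_snd] at h
      exact comp_inclL_eq_comp_inclR f h
    -- It suffices to show `P ⊆ M`. Minimality of `M` will later turn two inclusions of contractions
    -- into equalities.
    obtain ⟨M, hM, hMf, hMP₁, hmin⟩ := exists_minimal_prime f {w | ext f w ∈ P} hP₁ hf
    refine Set.Subset.trans ?_ hMP₁
    have hMP := hMP₁.trans hP₁P
    intro x₀ hx₀
    by_contra hx₀M
    -- `T` is sought over `P` along `inclR g`, with contraction along `inclL g` inside `M`. The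
    -- obstruction would be some `x ∉ M` with `C ⊗_A x` in `P`. Then `x' = x ⊗ x₀` and `C ⊗_A x'`
    -- lie in `P`, so `A ⊗_R x'` lies in `P`; being extended from `R`, it lies in `M`. So does its
    -- summand `x'`, against primality of `M`.
    obtain ⟨T, hT, hJT, hTU, hTP⟩ := hP.exists_over (inclR g) (hM.isMultiplicative_ext (inclL g)) (by
      rintro _ ⟨x, hx, rfl⟩ hPx
      let x' := relTensor (𝟙 A) x x₀
      have h₁ : P x' := IsIdeal.relTensor_right hP.isIdeal x hx₀
      have h₂ : P (res (inclR g) (ext (inclL g) x')) := by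
        obtain ⟨e⟩ := nonempty_ext_relTensor (inclL g) x x₀
        exact hP.of_iso (resIso (inclR g) e.symm)
          (IsIdeal.relTensor_left (IsIdeal.res_comap (inclR g) hP.isIdeal) hPx _)
      have h₃ : M (ext f (res f x')) := (hMf _).2 (hP.isIdeal.ext_res f g hw h₁ h₂)
      exact (hM.mem_or_mem (hM.summand (nonempty_retract_ext_res f x').some h₃)).elim hx hx₀M)
    have hTM : ∀ x, T (ext (inclL g) x) ↔ M x := by
      have h₁ : {x | T (ext (inclL g) x)} ⊆ M := fun x hx =>
        by_contra fun h => hTU _ ⟨x, h, rfl⟩ hx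
      have h₂ := hmin {x | T (ext (inclL g) x)} (hT.ext_comap (inclL g))
        (fun w => (mem_ext_comp_iff hT f (inclL g) (inclR g) hfg w).trans (hTP _)) h₁
      exact fun x => ⟨fun h => h₁ h, fun h => h₂ h⟩
    -- Going down along `inclR g`: avoiding the complement of `T` forces `T₁ ⊆ T`. This is possible
    -- because a module whose restriction lies in `M ⊆ P` already belongs to `T`.
    obtain ⟨T₁, hT₁, -, hT₁U, hT₁P⟩ := hM.exists_over (inclR g) hT.isMultiplicative_compl
      (fun z hz h => hz (hJT z (hMP h)))
    have hT₁T : ∀ z, T₁ z → T z := fun z hz => by_contra fun h => hT₁U z h hz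
    have hT₁M : ∀ x, M x → T₁ (ext (inclL g) x) :=
      hmin {x | T₁ (ext (inclL g) x)} (hT₁.ext_comap (inclL g))
        (fun w => (mem_ext_comp_iff hT₁ f (inclL g) (inclR g) hfg w).trans
          ((hT₁P _).trans (hMf w)))
        (fun x hx => (hTM x).1 (hT₁T _ hx))
    -- Both primes contract to `M` along `inclL g`, which has degree at most `n`. Comparing
    -- contractions along `inclR g` then moves `x₀` from `P` to `M`.
    have hTT₁ : T ≤ T₁ := DegreeLE.incomparable n (inclL g) hdeg (P₁ := T₁) (P := T) hT₁ hT hT₁T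
      (fun w => ⟨fun h => hT₁T _ h, fun h => hT₁M w ((hTM w).1 h)⟩)
    exact hx₀M ((hT₁P x₀).1 (hTT₁ _ ((hTP x₀).2 hx₀)))

end Incomparability

/-! ### Incomparability over the unit, and compatibility of `F` with free modules. -/

section Main

variable {K : Type u} [Category.{v} K] [Preadditive K] [HasZeroObject K] [HasShift K ℤ]
  [∀ n : ℤ, (shiftFunctor K n).Additive] [Pretriangulated K] [MonoidalCategory K]
  [SymmetricCategory K] [TensorTriangulated K] [IsIdempotentComplete K]

section

variable (A : K) [MonObj A] [IsCommMonObj A] [IsSeparableMon A]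

lemma nonempty_retract_extScalars (x : Mod K A) : Nonempty (Retract x ((extScalars A).obj x.X)) :=
  ⟨(nonempty_retract_ext_res (η : 𝟙_ K ⟶ A) x).some.trans (Retract.ofIso (extUnit (res η x)))⟩

/-- Incomparability for the extension of scalars along the unit. -/
lemma HasFiniteDegree.incomparable (hA : HasFiniteDegree A) {P₁ P : SpcMod A}
    (h : P₁.1 ≤ P.1) (h' : extScalarsSpc A P₁ = extScalarsSpc A P) : P₁ = P := by
  obtain ⟨n, hn⟩ := hA
  have hk (k : K) : P₁.1 ((extScalars A).obj k) ↔ P.1 ((extScalars A).obj k) :=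
    iff_of_eq (congr_fun (congr_arg Subtype.val h') k)
  -- `extUnit` translates the fibre condition from free modules to extensions along the unit `𝟙 ⟶
  -- A`.
  have hle : P.1 ≤ P₁.1 := DegreeLE.incomparable n η hn (P₁ := P₁.1) (P := P.1) P₁.2 P.2 h
    (fun w => ⟨fun hw => h _ hw, fun hw => P₁.2.of_iso (extUnit w).symm
      ((hk w.X).2 (P.2.of_iso (extUnit w) hw))⟩)
  exact Subtype.ext (le_antisymm h hle)

end

variable {L : Type u'} [Category.{v'} L] [MonoidalCategory L] (F : K ⥤ L) [F.Monoidal]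

/-- `F(A ⊗ k)` is the extension of scalars of `F(k)`. -/
def modMapExtScalars (A : K) [MonObj A] (k : K) :
    (modMap F A).obj ((extScalars A).obj k) ≅ (extScalars (F.obj A)).obj (F.obj k) :=
  (mkIso (x := (extScalars (F.obj A)).obj (F.obj k))
    (y := (modMap F A).obj ((extScalars A).obj k)) (Functor.Monoidal.μIso F A k) (by
      change ((α_ (F.obj A) (F.obj A) (F.obj k)).inv ≫
        (Functor.LaxMonoidal.μ F A A ≫ F.map μ) ▷ F.obj k) ≫ Functor.LaxMonoidal.μ F A k =
          F.obj A ◁ Functor.LaxMonoidal.μ F A k ≫ Functor.LaxMonoidal.μ F A (A ⊗ k) ≫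
            F.map ((α_ A A k).inv ≫ μ ▷ k)
      simp)).symm

end Main

/-! ### A prime over `Q` whose contraction lies in `P`. -/

section Lifting

variable {K : Type u} [Category.{v} K] [Preadditive K] [HasZeroObject K] [HasShift K ℤ]
  [∀ n : ℤ, (shiftFunctor K n).Additive] [Pretriangulated K] [MonoidalCategory K]
  [SymmetricCategory K] [TensorTriangulated K] [IsIdempotentComplete K]
  {L : Type u'} [Category.{v'} L] [Preadditive L] [HasZeroObject L] [HasShift L ℤ]
  [∀ n : ℤ, (shiftFunctor L n).Additive] [Pretriangulated L] [MonoidalCategory L]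
  [SymmetricCategory L] [TensorTriangulated L] [IsIdempotentComplete L]

/-- The images of the complement of a prime ideal under a functor which preserves tensor products
form a multiplicative class. -/
lemma IsPrimeTensorIdeal.isMultiplicative_image {C : Type u'} [Category.{v'} C] [HasShift C ℤ]
    {𝒯 : Set (Triangle C)} {t : C → C → C} {P : ObjectProperty C} (hP : IsPrimeTensorIdeal 𝒯 t P)
    {B : K} [MonObj B] [IsCommMonObj B] [IsSeparableMon B] (G : C → Mod K B)
    (hG : ∀ x y, Nonempty (G (t x y) ≅ tensorOver B (G x) (G y))) :
    IsMultiplicative (G '' {x | ¬ P x}) := by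
  obtain ⟨x, hx⟩ := hP.proper
  refine ⟨⟨_, x, hx, rfl⟩, ?_⟩
  rintro _ ⟨a, ha, rfl⟩ _ ⟨b, hb, rfl⟩
  exact ⟨_, ⟨_, fun h => (hP.prime h).elim ha hb, rfl⟩,
    ⟨(nonempty_tensorOver_iso _ _).some ≪≫ (hG a b).some.symm⟩⟩

/-- A prime ideal of `F(A)`-modules over `Q` which contracts into `P`. -/
lemma exists_prime_over_of_extScalars (F : K ⥤ L) [F.CommShift ℤ] [F.Braided] [IsTTFunctor F]
    (A : K) [MonObj A] [IsCommMonObj A] [IsSeparableMon A] (P : SpcMod A) (Q : Spc L)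
    (hPQ : ∀ k, P.1 ((extScalars A).obj k) ↔ Q.1 (F.obj k)) :
    ∃ Q' : SpcMod (F.obj A), extScalarsSpc (F.obj A) Q' = Q ∧ (modMapSpc F A Q').1 ≤ P.1 := by
  obtain ⟨T, hT, hJT, hTU, hTV⟩ := exists_prime_of_isMultiplicative
    (isIdeal_forget (F.obj A) Q.2.toIsThickTensorIdeal)
    (P.2.isMultiplicative_image (modMap F A).obj (modMap_isTensorExact F A).tensor)
    (Q.2.isMultiplicative_image (extScalars (F.obj A)).obj
      (extScalars_isTensorExact (F.obj A)).tensor) (by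
      -- By the projection formula the product has underlying object `F(x) ⊗ y`. If `F(x)` is in
      -- `Q`, then `A ⊗ x` is in `P` by the fibre hypothesis, and `x` is a summand of it.
      rintro _ ⟨x, hx, rfl⟩ _ ⟨y, hy, rfl⟩ h
      have h' : Q.1 (F.obj x.X ⊗ y) :=
        Q.2.of_iso ((Mod.forget _).mapIso (relFree (𝟙 (F.obj A)) ((modMap F A).obj x) y)) h
      refine (Q.2.prime h').elim (fun h' => hx ?_) hy
      exact P.2.summand (nonempty_retract_extScalars A x).some ((hPQ x.X).2 h'))
  -- The contraction to `L` is contained in `Q` because `T` avoids the free modules on objects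
  -- outside `Q`; it contains `Q` because `F(A) ⊗ k` has underlying object in `Q` whenever `k` does.
  refine ⟨⟨T, hT⟩, Subtype.ext (funext fun k => propext
    ⟨fun h => by_contra fun hk => hTV _ ⟨k, hk, rfl⟩ h, fun hk => ?_⟩),
    fun x hx => by_contra fun h => hTU _ ⟨x, h, rfl⟩ hx⟩
  have h : Q.1 (F.obj A ⊗ k) := Q.2.tensor (F.obj A) hk
  exact hJT h

end Lifting

end TTGeom

end

theorem corollary3p8
    {K : Type u} [Category.{v} K] [Preadditive K] [HasZeroObject K] [HasShift K ℤ]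
    [∀ n : ℤ, (shiftFunctor K n).Additive] [Pretriangulated K] [IsTriangulated K]
    [IsIdempotentComplete K] [MonoidalCategory K] [SymmetricCategory K] [TensorTriangulated K]
    {L : Type u'} [Category.{v'} L] [Preadditive L] [HasZeroObject L] [HasShift L ℤ]
    [∀ n : ℤ, (shiftFunctor L n).Additive] [Pretriangulated L] [IsTriangulated L]
    [IsIdempotentComplete L] [MonoidalCategory L] [SymmetricCategory L] [TensorTriangulated L]
    (A : K) [MonObj A] [IsCommMonObj A] [IsSeparableMon A] (hA : HasFiniteDegree A)
    (F : K ⥤ L) [F.CommShift ℤ] [F.Braided] [IsTTFunctor F] :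
    (∀ Q' : SpcMod (F.obj A),
      extScalarsSpc A (modMapSpc F A Q') = ttSpc F (extScalarsSpc (F.obj A) Q')) ∧
    ∀ (P : SpcMod A) (Q : Spc L), extScalarsSpc A P = ttSpc F Q →
      ∃ Q' : SpcMod (F.obj A), modMapSpc F A Q' = P ∧ extScalarsSpc (F.obj A) Q' = Q := by
  have hsq : ∀ Q' : SpcMod (F.obj A),
      extScalarsSpc A (modMapSpc F A Q') = ttSpc F (extScalarsSpc (F.obj A) Q') := by
    intro Q'
    refine Subtype.ext (funext fun k => propext ?_)
    exact ⟨Q'.2.of_iso (modMapExtScalars F A k), Q'.2.of_iso (modMapExtScalars F A k).symm⟩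
  refine ⟨hsq, fun P Q h => ?_⟩
  have hPQ (k : K) : P.1 ((extScalars A).obj k) ↔ Q.1 (F.obj k) :=
    iff_of_eq (congr_fun (congr_arg Subtype.val h) k)
  obtain ⟨Q', hQ, hQ'⟩ := exists_prime_over_of_extScalars F A P Q hPQ
  -- By commutativity of the square, the contraction of `Q'` and `P` both lie over the image of `Q`
  -- in the spectrum of `K`. One contains the other, so finite degree makes them equal.
  refine ⟨Q', hA.incomparable A hQ' ?_, hQ⟩
  rw [hsq, hQ, h]
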